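/- **Theorem (Whitman theorem).** Polycategories are symmetric: channels are named (or, equivalently, may be permuted), and $\mathrm{Hom}(\Gamma;\Delta)$ is the set of polymorphisms from a finite string of objects $\Gamma$ to a finite string of objects $\Delta$, composed by cut along one channel. A polycategory *has finite sums and products* if for all objects $X_1,\dots,X_n$ ($n\ge 0$) it has objects $\sum_i X_i$ and $\prod_i X_i$ with poly-natural bijections $$\mathrm{Hom}(\Gamma,\textstyle\sum_i X_i;\Delta)\cong\prod_i \mathrm{Hom}(\Gamma,X_i;\Delta),\qquad \mathrm{Hom}(\Gamma;\textstyle\prod_i X_i,\Delta)\cong\prod_i \mathrm{Hom}(\Gamma;X_i,\Delta).$$ The identities of $\prod_i X_i$ and $\sum_i X_i$ correspond to projections $\prod_i X_i\to X_k$ and injections $X_k\to\sum_i X_i$. For a polycategory $\mathcal A$, let $\Sigma\Pi_{\mathcal A}$ be the following polycategory. Its objects are the formulas built from the objects of $\mathcal A$ by formal finite (possibly empty) sums and products. Its polymorphisms are the derivations built from the polymorphisms of $\mathcal A$ (axioms) by cut, renaming of channels, cotupling (sum in the domain), tupling (product in the codomain), projection (product in the domain) and injection (sum in the codomain), modulo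 the congruence generated by the polycategory laws (identities being defined by recursion on formulas), the identification of the identities, cuts and renamings of axioms with those of $\mathcal A$, and the cut-elimination and permuting conversions of these rules. Let $\mathcal B$ be a polycategory with finite sums and products, and let $F:\mathcal A\to\mathcal B$ be a full inclusion of polycategories (a morphism that is injective on objects and bijective on each poly-hom-set), where the objects of $\mathcal B$ are generated, up to isomorphism, from the objects $F(a)$, $a\in\mathcal A$, by finite sums and products. Let $F^*:\Sigma\Pi_{\mathcal A}\to\mathcal B$ be the induced comparison morphism, which is $F$ on atoms and axioms and interprets formal sums, products, (co)tuples, projections and injections by those of $\mathcal B$. An *output poly-hom-set* of $\mathcal B$ is a poly-hom-set $\mathrm{Hom}(\Gamma;\Delta)$ for which each channel of $\Gamma$ is given as an atom $F(a)$ or as a finite (possibly empty) product, each channel of $\Delta$ is given as an atom $F(a)$ or as a finite (possibly empty) sum, and at least one channel is given as a product or a sum. Its *output index* consists of the pairs $(\gamma,k)$ of a channel $\gamma$ that is given as a product or a sum and an index $k$ of one of its components. Let $[\mathrm{Hom}(\Gamma;\Delta)]_{(\gamma,k)}$ be the poly-hom-set in which the object on $\gamma$ is replaced by its $k$-th component,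 and let $\overline{\gamma}[k]:[\mathrm{Hom}(\Gamma;\Delta)]_{(\gamma,k)}\to\mathrm{Hom}(\Gamma;\Delta)$ be composition with the $k$-th projection or injection. Similarly, $[\mathrm{Hom}(\Gamma;\Delta)]_{((\alpha,i),(\beta,j))}$ has two replacements, on channels $\alpha\ne\beta$. Say that $F$ is a *semi-soft extension* if for each output poly-hom-set the map $$q=\{\overline{\gamma}[k]\}_{(\gamma,k)}:\ \coprod_{(\gamma,k)}[\mathrm{Hom}(\Gamma;\Delta)]_{(\gamma,k)}\to\mathrm{Hom}(\Gamma;\Delta)$$ is surjective; a *soft extension* if for each output poly-hom-set $q$ is, in the category of sets, the coequalizer of the two maps $$\coprod_{\alpha\neq\beta,\ (\alpha,i),(\beta,j)}[\mathrm{Hom}(\Gamma;\Delta)]_{((\alpha,i),(\beta,j))}\rightrightarrows\coprod_{(\gamma,k)}[\mathrm{Hom}(\Gamma;\Delta)]_{(\gamma,k)}$$ given by $\overline{\beta}[j]$ (landing in the summand $(\alpha,i)$) and by $\overline{\alpha}[i]$ (landing in the summand $(\beta,j)$); and *soft* if it is both. 1. If $F$ is a semi-soft extension, then $F^*$ is full,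 that is, surjective on each poly-hom-set. 2. If $F$ is soft, then $F^*$ is an equivalence of polycategories: there is a morphism $G:\mathcal B\to\Sigma\Pi_{\mathcal A}$ with natural isomorphisms $F^*;G\cong\mathrm{id}$ and $G;F^*\cong\mathrm{id}$. -/

import Mathlib

universe u v u' v' u'' v''

namespace Poly

/-- A channel of a polymorphism lies in its domain or in its codomain. -/
inductive Side
  | dom
  | cod

/-- The opposite side. -/
def Side.op : Side → Side
  | dom => cod
  | cod => dom

/-- A sequent `Γ ⊢ Δ` over `C`: a finite set `Ch` of channels, each of which lies in the domain
(these channels make up `Γ`) or in the codomain (these make up `Δ`) and carries an object.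
The strings `Γ` and `Δ` are thus indexed by channel names instead of numbers. -/
structure Sequent (C : Type u) where
  Ch : Type
  finite : Finite Ch
  side : Ch → Side
  obj : Ch → C

namespace Sequent

variable {C : Type u} {D : Type v}

/-- The sequent without channels. -/
def nil : Sequent C := ⟨Empty, inferInstance, Empty.elim, Empty.elim⟩

/-- The sequent with one channel, on side `s` and of type `x`. -/
def one (s : Side) (x : C) : Sequent C := ⟨Unit, inferInstance, fun _ => s, fun _ => x⟩

/-- Juxtaposition: `Γ ⊢ Δ` and `Γ' ⊢ Δ'` give `Γ, Γ' ⊢ Δ, Δ'`. -/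
def app (S T : Sequent C) : Sequent C where
  Ch := S.Ch ⊕ T.Ch
  finite := by
    have := S.finite
    have := T.finite
    infer_instance
  side := Sum.elim S.side T.side
  obj := Sum.elim S.obj T.obj

infixl:65 " ⊹ " => Sequent.app

/-- Apply a map of objects to the type of every channel. -/
def map (F : C → D) (S : Sequent C) : Sequent D := ⟨S.Ch, S.finite, S.side, fun i => F (S.obj i)⟩

/-- The sequent of a list of objects with sides. -/
def ofList : List (Side × C) → Sequent C
  | [] => nil
  | (s, x) :: l => one s x ⊹ ofList l

/-- Remove a channel. -/
def erase (S : Sequent C) (α : S.Ch) : Sequent C where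
  Ch := {β : S.Ch // β ≠ α}
  finite := by
    have := S.finite
    infer_instance
  side := fun β => S.side β
  obj := fun β => S.obj β

open Classical in
/-- Replace the type of the channel `α` by `x`. -/
noncomputable def set (S : Sequent C) (α : S.Ch) (x : C) : Sequent C :=
  ⟨S.Ch, S.finite, S.side, fun β => if β = α then x else S.obj β⟩

theorem set_obj_self (S : Sequent C) (α : S.Ch) (x : C) : (S.set α x).obj α = x :=
  if_pos rfl

theorem set_obj_of_ne (S : Sequent C) {α β : S.Ch} (h : β ≠ α) (x : C) :
    (S.set α x).obj β = S.obj β :=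
  if_neg h

/-- A renaming of channels that respects sides and types; for channels that are numbered, this
is a pair of permutations, of the domain and of the codomain. -/
@[ext]
structure Iso (S T : Sequent C) where
  equiv : S.Ch ≃ T.Ch
  side_eq : ∀ i, T.side (equiv i) = S.side i
  obj_eq : ∀ i, T.obj (equiv i) = S.obj i

namespace Iso

variable {S T U V : Sequent C}

def refl (S : Sequent C) : Iso S S := ⟨Equiv.refl _, fun _ => rfl, fun _ => rfl⟩

def symm (σ : Iso S T) : Iso T S where
  equiv := σ.equiv.symm
  side_eq := fun i => by rw [← σ.side_eq, Equiv.apply_symm_apply]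
  obj_eq := fun i => by rw [← σ.obj_eq, Equiv.apply_symm_apply]

def trans (σ : Iso S T) (τ : Iso T U) : Iso S U where
  equiv := σ.equiv.trans τ.equiv
  side_eq := fun i => by simp [τ.side_eq, σ.side_eq]
  obj_eq := fun i => by simp [τ.obj_eq, σ.obj_eq]

def app (σ : Iso S T) (τ : Iso U V) : Iso (S ⊹ U) (T ⊹ V) where
  equiv := Equiv.sumCongr σ.equiv τ.equiv
  side_eq := by rintro (i | i); exacts [σ.side_eq i, τ.side_eq i]
  obj_eq := by rintro (i | i); exacts [σ.obj_eq i, τ.obj_eq i]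

def map (F : C → D) (σ : Iso S T) : Iso (S.map F) (T.map F) where
  equiv := σ.equiv
  side_eq := σ.side_eq
  obj_eq := fun i => congrArg F (σ.obj_eq i)

def comm (S T : Sequent C) : Iso (S ⊹ T) (T ⊹ S) where
  equiv := Equiv.sumComm _ _
  side_eq := by rintro (i | i) <;> rfl
  obj_eq := by rintro (i | i) <;> rfl

def assoc (S T U : Sequent C) : Iso (S ⊹ T ⊹ U) (S ⊹ (T ⊹ U)) where
  equiv := Equiv.sumAssoc _ _ _
  side_eq := by rintro ((i | i) | i) <;> rfl
  obj_eq := by rintro ((i | i) | i) <;> rfl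

/-- Exchange the last two of three sequents. -/
def exch (S T U : Sequent C) : Iso (S ⊹ T ⊹ U) (S ⊹ U ⊹ T) :=
  ((assoc S T U).trans ((refl S).app (comm T U))).trans (assoc S U T).symm

def nilApp (S : Sequent C) : Iso (nil ⊹ S) S where
  equiv := Equiv.emptySum Empty S.Ch
  side_eq := by rintro (i | i); exacts [i.elim, rfl]
  obj_eq := by rintro (i | i); exacts [i.elim, rfl]

def mapApp (F : C → D) (S T : Sequent C) : Iso ((S ⊹ T).map F) (S.map F ⊹ T.map F) where
  equiv := Equiv.refl _
  side_eq := by rintro (i | i) <;> rfl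
  obj_eq := by rintro (i | i) <;> rfl

/-- `mapApp` where the second sequent has one channel. -/
def mapOne (F : C → D) (S : Sequent C) (s : Side) (x : C) :
    Iso ((S ⊹ one s x).map F) (S.map F ⊹ one s (F x)) :=
  mapApp F S (one s x)

/-- `mapApp` where both sequents have one channel. -/
def mapTwo (F : C → D) (s t : Side) (x y : C) :
    Iso ((one s x ⊹ one t y).map F) (one s (F x) ⊹ one t (F y)) :=
  mapApp F (one s x) (one t y)

/-- `mapApp` where the sequent is given by a list. -/
def mapOfList (F : C → D) : ∀ l : List (Side × C),
    Iso ((ofList l).map F) (ofList (l.map (Prod.map id F)))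
  | [] => ⟨Equiv.refl _, fun i => i.elim, fun i => i.elim⟩
  | (s, x) :: l => (mapApp F (one s x) (ofList l)).trans
      (Iso.app (T := one s (F x)) (refl _) (mapOfList F l))

open Classical in
/-- Put a channel with type `x` back into the place of the removed channel `α`. -/
noncomputable def joinEquiv {ι : Type} (α : ι) : {β : ι // β ≠ α} ⊕ Unit ≃ ι where
  toFun := Sum.elim (fun β => β.1) (fun _ => α)
  invFun := fun β => if e : β = α then Sum.inr () else Sum.inl ⟨β, e⟩
  left_inv := by
    rintro (⟨β, e⟩ | ⟨⟩)
    · simp [e]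
    · simp
  right_inv := fun β => by by_cases e : β = α <;> simp [e]

/-- The sequent `S` is what remains without `α`, together with `α` itself. -/
noncomputable def join (S : Sequent C) (α : S.Ch) {x : C} (h : S.obj α = x) :
    Iso (S.erase α ⊹ one (S.side α) x) S where
  equiv := joinEquiv α
  side_eq := by rintro (i | i) <;> rfl
  obj_eq := by rintro (i | i); exacts [rfl, h]

/-- The same for the sequent in which the type of `α` has been replaced by `x`. -/
noncomputable def joinSet (S : Sequent C) (α : S.Ch) (x : C) :
    Iso (S.erase α ⊹ one (S.side α) x) (S.set α x) where
  equiv := joinEquiv α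
  side_eq := by rintro (i | i) <;> rfl
  obj_eq := by
    rintro (i | i)
    exacts [set_obj_of_ne S i.2 x, set_obj_self S α x]

open Classical in
/-- Replacements on distinct channels commute. -/
noncomputable def setSet (S : Sequent C) (α β : S.Ch) (h : α ≠ β) (x y : C) :
    Iso ((S.set α x).set β y) ((S.set β y).set α x) where
  equiv := Equiv.refl S.Ch
  side_eq := fun _ => rfl
  obj_eq := fun (i : S.Ch) => by
    change (if i = α then x else if i = β then y else S.obj i) =
      if i = β then y else if i = α then x else S.obj i
    by_cases hα : i = α
    · rw [if_pos hα, if_neg (fun hβ => h (hα.symm.trans hβ)), if_pos hα]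
    · rw [if_neg hα, if_neg hα]

end Iso

end Sequent

open Sequent

/-- The data of a symmetric polycategory. The poly-hom-set of a sequent `S`, with domain
channels `Γ` and codomain channels `Δ`, is the set of polymorphisms `Γ → Δ`; `id x` is the
identity `x ⊢ x`; `cut` composes `Γ ⊢ Δ, x` with `x, Γ' ⊢ Δ'` to `Γ, Γ' ⊢ Δ, Δ'`; `rename` is
the symmetric action. -/
structure PolycategoryData where
  Obj : Type u
  Hom : Sequent Obj → Type v
  id : ∀ x : Obj, Hom (one .dom x ⊹ one .cod x)
  cut : ∀ {S T : Sequent Obj} {x : Obj},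
    Hom (S ⊹ one .cod x) → Hom (T ⊹ one .dom x) → Hom (S ⊹ T)
  rename : ∀ {S T : Sequent Obj}, Iso S T → Hom S → Hom T

/-- The cut of two polymorphisms along a channel that lies on side `s` in the first one and on
the opposite side in the second one. -/
def PolycategoryData.cutAt (P : PolycategoryData.{u, v}) :
    ∀ (s : Side) {S T : Sequent P.Obj} {x : P.Obj},
      P.Hom (S ⊹ one s x) → P.Hom (T ⊹ one s.op x) → P.Hom (S ⊹ T)
  | .cod, _, _, _, f, g => P.cut f g
  | .dom, _, _, _, f, g => P.rename (Iso.comm _ _) (P.cut g f)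

/-- A symmetric polycategory. The law `cut_cut` is associativity of cut when `s = t`, and the
two interchange laws when `s ≠ t` (`s = .cod`, `t = .dom`: two polymorphisms are cut into the
domain of `g`; `s = .dom`, `t = .cod`: two polymorphisms are cut into its codomain). -/
structure Polycategory extends PolycategoryData.{u, v} where
  rename_refl : ∀ {S : Sequent Obj} (f : Hom S), rename (Iso.refl S) f = f
  rename_trans : ∀ {S T U : Sequent Obj} (σ : Iso S T) (τ : Iso T U) (f : Hom S),
    rename (σ.trans τ) f = rename τ (rename σ f)
  rename_cut : ∀ {S S' T T' : Sequent Obj} {x : Obj} (σ : Iso S S') (τ : Iso T T')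
    (f : Hom (S ⊹ one .cod x)) (g : Hom (T ⊹ one .dom x)),
    rename (σ.app τ) (cut f g) =
      cut (rename (σ.app (Iso.refl _)) f) (rename (τ.app (Iso.refl _)) g)
  id_cut : ∀ {S : Sequent Obj} {x : Obj} (f : Hom (S ⊹ one .dom x)),
    cut (id x) f = rename (Iso.comm _ _) f
  cut_id : ∀ {S : Sequent Obj} {x : Obj} (f : Hom (S ⊹ one .cod x)),
    cut f (rename (Iso.comm _ _) (id x)) = f
  cut_cut : ∀ (s t : Side) {S T U : Sequent Obj} {x y : Obj}
    (f : Hom (S ⊹ one s x)) (g : Hom (T ⊹ one s.op x ⊹ one t y)) (h : Hom (U ⊹ one t.op y)),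
    rename (Iso.assoc S T U)
        (toPolycategoryData.cutAt t
          (rename (Iso.assoc _ _ _).symm
            (toPolycategoryData.cutAt s f (rename (Iso.exch _ _ _) g))) h) =
      toPolycategoryData.cutAt s f (rename (Iso.exch _ _ _) (toPolycategoryData.cutAt t g h))

/-- A morphism of polycategories. -/
structure Morphism (P : Polycategory.{u, v}) (Q : Polycategory.{u', v'}) where
  obj : P.Obj → Q.Obj
  map : ∀ {S : Sequent P.Obj}, P.Hom S → Q.Hom (S.map obj)
  map_id : ∀ x, Q.rename (Iso.mapTwo obj .dom .cod x x) (map (P.id x)) = Q.id (obj x)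
  map_cut : ∀ {S T : Sequent P.Obj} {x : P.Obj}
    (f : P.Hom (S ⊹ one .cod x)) (g : P.Hom (T ⊹ one .dom x)),
    Q.rename (Iso.mapApp obj S T) (map (P.cut f g)) =
      Q.cut (Q.rename (Iso.mapOne obj S .cod x) (map f))
        (Q.rename (Iso.mapOne obj T .dom x) (map g))
  map_rename : ∀ {S T : Sequent P.Obj} (σ : Iso S T) (f : P.Hom S),
    map (P.rename σ f) = Q.rename (σ.map obj) (map f)

/-- The identity of `x`, with the channel on side `s` first. -/
def PolycategoryData.idAt (P : PolycategoryData.{u, v}) :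
    ∀ (s : Side) (x : P.Obj), P.Hom (one s x ⊹ one s.op x)
  | .dom, x => P.id x
  | .cod, x => P.rename (Iso.comm _ _) (P.id x)

/-- The structure of a poly-sum (`s = .dom`) or a poly-product (`s = .cod`) of the family `X` on
the object `o`: a poly-natural correspondence between families of polymorphisms `Γ, X i ⊢ Δ`
(respectively `Γ ⊢ X i, Δ`) and polymorphisms `Γ, o ⊢ Δ` (respectively `Γ ⊢ o, Δ`).
Poly-natural means that it commutes with renaming the other channels and with cuts, on either
side, along the other channels. -/
structure Additive (P : Polycategory.{u, v}) (s : Side) {n : ℕ} (X : Fin n → P.Obj)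
    (o : P.Obj) where
  tuple : ∀ {S : Sequent P.Obj}, (∀ i, P.Hom (S ⊹ one s (X i))) ≃ P.Hom (S ⊹ one s o)
  tuple_rename : ∀ {S T : Sequent P.Obj} (σ : Iso S T) (f : ∀ i, P.Hom (S ⊹ one s (X i))),
    P.rename (σ.app (Iso.refl _)) (tuple f) =
      tuple fun i => P.rename (σ.app (Iso.refl _)) (f i)
  tuple_cut : ∀ (t : Side) {S T : Sequent P.Obj} {z : P.Obj}
    (f : ∀ i, P.Hom (S ⊹ one t z ⊹ one s (X i))) (g : P.Hom (T ⊹ one t.op z)),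
    P.cutAt t (P.rename (Iso.exch _ _ _) (tuple f)) g =
      P.rename (Iso.exch _ _ _) (tuple fun i =>
        P.rename (Iso.exch _ _ _) (P.cutAt t (P.rename (Iso.exch _ _ _) (f i)) g))

namespace Additive

variable {P : Polycategory.{u, v}} {s : Side} {n : ℕ} {X : Fin n → P.Obj} {o : P.Obj}

/-- The projection `o ⊢ X k` of a poly-product (`s = .dom`), the injection `X k ⊢ o` of a
poly-sum (`s = .cod`): what corresponds to the identity of `o`. -/
def leg (A : Additive P s.op X o) (k : Fin n) : P.Hom (one s o ⊹ one s.op (X k)) :=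
  A.tuple.symm (P.idAt s o) k

/-- The map `Hom (Γ, X k ; Δ) → Hom (Γ, o ; Δ)` that composes with the `k`-th projection of a
poly-product `o` (`s = .dom`), the map `Hom (Γ ; X k, Δ) → Hom (Γ ; o, Δ)` that composes with the
`k`-th injection of a poly-sum `o` (`s = .cod`). -/
def send (A : Additive P s.op X o) {S : Sequent P.Obj} (k : Fin n)
    (f : P.Hom (S ⊹ one s (X k))) : P.Hom (S ⊹ one s o) :=
  P.cutAt s f (A.leg k)

end Additive

/-- Finite poly-sums and poly-products in a polycategory: `inp .dom X` is the sum of the family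
`X` and `inp .cod X` is its product. -/
structure SumsProducts (P : Polycategory.{u, v}) where
  inp : ∀ (_ : Side) {n : ℕ} (_ : Fin n → P.Obj), P.Obj
  additive : ∀ (s : Side) {n : ℕ} (X : Fin n → P.Obj), Additive P s X (inp s X)

/-- The product of `X` for `s = .dom`, the sum of `X` for `s = .cod`: the compound objects whose
channels on side `s` are introduced by a projection or an injection. -/
def SumsProducts.out {P : Polycategory.{u, v}} (B : SumsProducts P) (s : Side) {n : ℕ}
    (X : Fin n → P.Obj) : P.Obj :=
  B.inp s.op X

/-- The formulas over a set of atoms. -/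
inductive Formula (A : Type u)
  | atom (a : A)
  | sum {n : ℕ} (X : Fin n → Formula A)
  | prod {n : ℕ} (X : Fin n → Formula A)

namespace Formula

variable {A : Type u}

/-- The sum for `s = .dom`, the product for `s = .cod`. -/
def inp : ∀ (_ : Side) {n : ℕ} (_ : Fin n → Formula A), Formula A
  | .dom, _, X => sum X
  | .cod, _, X => prod X

/-- The product for `s = .dom`, the sum for `s = .cod`. -/
def out (s : Side) {n : ℕ} (X : Fin n → Formula A) : Formula A := inp s.op X

end Formula

/-- The derivations of the sequent calculus `ΣΠ` over `A`: the axioms are the polymorphisms of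
`A`; `tuple` is the cotuple rule (`s = .dom`) and the tuple rule (`s = .cod`); `send` is the
projection rule (`s = .dom`) and the injection rule (`s = .cod`). -/
inductive Deriv (A : Polycategory.{u, v}) : Sequent (Formula A.Obj) → Type (max 1 u v)
  | ax {S : Sequent A.Obj} (f : A.Hom S) : Deriv A (S.map Formula.atom)
  | cut {S T : Sequent (Formula A.Obj)} {X : Formula A.Obj}
      (f : Deriv A (S ⊹ one .cod X)) (g : Deriv A (T ⊹ one .dom X)) : Deriv A (S ⊹ T)
  | rename {S T : Sequent (Formula A.Obj)} (σ : Iso S T) (f : Deriv A S) : Deriv A T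
  | tuple (s : Side) {S : Sequent (Formula A.Obj)} {n : ℕ} {X : Fin n → Formula A.Obj}
      (f : ∀ i, Deriv A (S ⊹ one s (X i))) : Deriv A (S ⊹ one s (Formula.inp s X))
  | send (s : Side) {S : Sequent (Formula A.Obj)} {n : ℕ} {X : Fin n → Formula A.Obj}
      (k : Fin n) (f : Deriv A (S ⊹ one s (X k))) : Deriv A (S ⊹ one s (Formula.out s X))

namespace Deriv

/-- The identity derivations: on an atom the identity of `A`, on a sum the cotuple of the
injections, on a product the tuple of the projections. -/
def ident (A : Polycategory.{u, v}) :
    ∀ X : Formula A.Obj, Deriv A (one .dom X ⊹ one .cod X)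
  | .atom a => rename (Iso.mapTwo Formula.atom .dom .cod a a) (ax (A.id a))
  | .sum X => rename (Iso.comm _ _) (tuple .dom fun i =>
      rename (Iso.comm _ _) (send .cod (X := X) i (ident A (X i))))
  | .prod X => tuple .cod fun i =>
      rename (Iso.comm _ _) (send .dom (X := X) i (rename (Iso.comm _ _) (ident A (X i))))

/-- The derivations with their operations. -/
def data (A : Polycategory.{u, v}) : PolycategoryData.{u, max 1 u v} where
  Obj := Formula A.Obj
  Hom := Deriv A
  id := ident A
  cut := cut
  rename := rename

/-- The cut along a channel that lies on side `s` in the first derivation. -/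
def cutAt {A : Polycategory.{u, v}} (s : Side) {S T : Sequent (Formula A.Obj)}
    {X : Formula A.Obj} (f : Deriv A (S ⊹ one s X)) (g : Deriv A (T ⊹ one s.op X)) :
    Deriv A (S ⊹ T) :=
  (data A).cutAt s f g

/-- Equality of derivations: the congruence generated by the polycategory laws, the
compatibility of the axioms with the structure of `A`, the cut-elimination conversions
(`tuple_cut`, `send_cut`, `send_cut_tuple`) and the permuting conversions (`tuple_tuple`,
`tuple_send`, `send_send`). The parameters `s` and `t` run over the dual versions. -/
inductive Rel (A : Polycategory.{u, v}) :
    ∀ {S : Sequent (Formula A.Obj)}, Deriv A S → Deriv A S → Prop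
  | refl {S} (f : Deriv A S) : Rel A f f
  | symm {S} {f g : Deriv A S} : Rel A f g → Rel A g f
  | trans {S} {f g h : Deriv A S} : Rel A f g → Rel A g h → Rel A f h
  | congr_cut {S T X} {f f' : Deriv A (S ⊹ one .cod X)} {g g' : Deriv A (T ⊹ one .dom X)} :
      Rel A f f' → Rel A g g' → Rel A (cut f g) (cut f' g')
  | congr_rename {S T} (σ : Iso S T) {f f' : Deriv A S} :
      Rel A f f' → Rel A (rename σ f) (rename σ f')
  | congr_tuple (s : Side) {S} {n : ℕ} {X : Fin n → Formula A.Obj}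
      {f f' : ∀ i, Deriv A (S ⊹ one s (X i))} :
      (∀ i, Rel A (f i) (f' i)) → Rel A (tuple s f) (tuple s f')
  | congr_send (s : Side) {S} {n : ℕ} {X : Fin n → Formula A.Obj} (k : Fin n)
      {f f' : Deriv A (S ⊹ one s (X k))} :
      Rel A f f' → Rel A (send s k f) (send s k f')
  | rename_refl {S} (f : Deriv A S) : Rel A (rename (Iso.refl S) f) f
  | rename_trans {S T U} (σ : Iso S T) (τ : Iso T U) (f : Deriv A S) :
      Rel A (rename (σ.trans τ) f) (rename τ (rename σ f))
  | rename_cut {S S' T T' X} (σ : Iso S S') (τ : Iso T T')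
      (f : Deriv A (S ⊹ one .cod X)) (g : Deriv A (T ⊹ one .dom X)) :
      Rel A (rename (σ.app τ) (cut f g))
        (cut (rename (σ.app (Iso.refl _)) f) (rename (τ.app (Iso.refl _)) g))
  | rename_tuple (s : Side) {S T} (σ : Iso S T) {n : ℕ} {X : Fin n → Formula A.Obj}
      (f : ∀ i, Deriv A (S ⊹ one s (X i))) :
      Rel A (rename (σ.app (Iso.refl _)) (tuple s f))
        (tuple s fun i => rename (σ.app (Iso.refl _)) (f i))
  | rename_send (s : Side) {S T} (σ : Iso S T) {n : ℕ} {X : Fin n → Formula A.Obj} (k : Fin n)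
      (f : Deriv A (S ⊹ one s (X k))) :
      Rel A (rename (σ.app (Iso.refl _)) (send s (X := X) k f))
        (send s k (rename (σ.app (Iso.refl _)) f))
  | rename_ax {S T : Sequent A.Obj} (σ : Iso S T) (f : A.Hom S) :
      Rel A (rename (σ.map Formula.atom) (ax f)) (ax (A.rename σ f))
  | cut_ax {S T : Sequent A.Obj} {a : A.Obj}
      (f : A.Hom (S ⊹ one .cod a)) (g : A.Hom (T ⊹ one .dom a)) :
      Rel A
        (cut (rename (Iso.mapOne Formula.atom S .cod a) (ax f))
          (rename (Iso.mapOne Formula.atom T .dom a) (ax g)))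
        (rename (Iso.mapApp Formula.atom S T) (ax (A.cut f g)))
  | id_cut {S X} (f : Deriv A (S ⊹ one .dom X)) :
      Rel A (cut (ident A X) f) (rename (Iso.comm _ _) f)
  | cut_id {S X} (f : Deriv A (S ⊹ one .cod X)) :
      Rel A (cut f (rename (Iso.comm _ _) (ident A X))) f
  | cut_cut (s t : Side) {S T U X Y}
      (f : Deriv A (S ⊹ one s X)) (g : Deriv A (T ⊹ one s.op X ⊹ one t Y))
      (h : Deriv A (U ⊹ one t.op Y)) :
      Rel A
        (rename (Iso.assoc S T U)
          (cutAt t (rename (Iso.assoc _ _ _).symm (cutAt s f (rename (Iso.exch _ _ _) g))) h))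
        (cutAt s f (rename (Iso.exch _ _ _) (cutAt t g h)))
  | tuple_cut (s t : Side) {S T Z} {n : ℕ} {X : Fin n → Formula A.Obj}
      (f : ∀ i, Deriv A (S ⊹ one t Z ⊹ one s (X i))) (g : Deriv A (T ⊹ one t.op Z)) :
      Rel A (cutAt t (rename (Iso.exch _ _ _) (tuple s f)) g)
        (rename (Iso.exch _ _ _) (tuple s fun i =>
          rename (Iso.exch _ _ _) (cutAt t (rename (Iso.exch _ _ _) (f i)) g)))
  | send_cut (s t : Side) {S T Z} {n : ℕ} {X : Fin n → Formula A.Obj} (k : Fin n)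
      (f : Deriv A (S ⊹ one t Z ⊹ one s (X k))) (g : Deriv A (T ⊹ one t.op Z)) :
      Rel A (cutAt t (rename (Iso.exch _ _ _) (send s (X := X) k f)) g)
        (rename (Iso.exch _ _ _) (send s (X := X) k
          (rename (Iso.exch _ _ _) (cutAt t (rename (Iso.exch _ _ _) f) g))))
  | send_cut_tuple (s : Side) {S T} {n : ℕ} {X : Fin n → Formula A.Obj} (k : Fin n)
      (f : Deriv A (S ⊹ one s (X k))) (g : ∀ i, Deriv A (T ⊹ one s.op (X i))) :
      Rel A (cutAt s (send s k f) (tuple s.op g)) (cutAt s f (g k))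
  | tuple_tuple (s t : Side) {S} {m n : ℕ} {X : Fin m → Formula A.Obj}
      {Y : Fin n → Formula A.Obj} (f : ∀ i j, Deriv A (S ⊹ one s (X i) ⊹ one t (Y j))) :
      Rel A
        (rename (Iso.exch _ _ _)
          (tuple s fun i => rename (Iso.exch _ _ _) (tuple t fun j => f i j)))
        (tuple t fun j =>
          rename (Iso.exch _ _ _) (tuple s fun i => rename (Iso.exch _ _ _) (f i j)))
  | tuple_send (s t : Side) {S} {m n : ℕ} {X : Fin m → Formula A.Obj}
      {Y : Fin n → Formula A.Obj} (k : Fin n)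
      (f : ∀ i, Deriv A (S ⊹ one s (X i) ⊹ one t (Y k))) :
      Rel A
        (rename (Iso.exch _ _ _)
          (tuple s fun i => rename (Iso.exch _ _ _) (send t (X := Y) k (f i))))
        (send t (X := Y) k
          (rename (Iso.exch _ _ _) (tuple s fun i => rename (Iso.exch _ _ _) (f i))))
  | send_send (s t : Side) {S} {m n : ℕ} {X : Fin m → Formula A.Obj}
      {Y : Fin n → Formula A.Obj} (k : Fin m) (l : Fin n)
      (f : Deriv A (S ⊹ one s (X k) ⊹ one t (Y l))) :
      Rel A
        (rename (Iso.exch _ _ _)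
          (send s (X := X) k (rename (Iso.exch _ _ _) (send t (X := Y) l f))))
        (send t (X := Y) l
          (rename (Iso.exch _ _ _) (send s (X := X) k (rename (Iso.exch _ _ _) f))))

/-- The setoid of equality of derivations. -/
def setoid (A : Polycategory.{u, v}) (S : Sequent (Formula A.Obj)) : Setoid (Deriv A S) :=
  ⟨Rel A, .refl, .symm, .trans⟩

end Deriv

/-- The polycategory `ΣΠ_A`: its objects are the formulas over the objects of `A`, its
polymorphisms the derivations up to equality of derivations. -/
def SigmaPi (A : Polycategory.{u, v}) : Polycategory.{u, max 1 u v} where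
  Obj := Formula A.Obj
  Hom := fun S => Quotient (Deriv.setoid A S)
  id := fun X => Quotient.mk _ (Deriv.ident A X)
  cut := Quotient.map₂ Deriv.cut fun _ _ h _ _ h' => .congr_cut h h'
  rename := fun σ => Quotient.map (Deriv.rename σ) fun _ _ h => .congr_rename σ h
  rename_refl := by rintro S ⟨f⟩; exact Quotient.sound (.rename_refl f)
  rename_trans := by rintro S T U σ τ ⟨f⟩; exact Quotient.sound (.rename_trans σ τ f)
  rename_cut := by rintro S S' T T' X σ τ ⟨f⟩ ⟨g⟩; exact Quotient.sound (.rename_cut σ τ f g)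
  id_cut := by rintro S X ⟨f⟩; exact Quotient.sound (.id_cut f)
  cut_id := by rintro S X ⟨f⟩; exact Quotient.sound (.cut_id f)
  cut_cut := by
    rintro s t S T U X Y ⟨f⟩ ⟨g⟩ ⟨h⟩
    cases s <;> cases t <;> exact Quotient.sound (.cut_cut _ _ f g h)

namespace Sequent.Iso

variable {C : Type u} {S T : Sequent C}

theorem eq_of {σ τ : Iso S T} (h : ∀ i, σ.equiv i = τ.equiv i) : σ = τ :=
  Iso.ext (Equiv.ext h)

end Sequent.Iso

namespace Polycategory

variable (P : Polycategory.{u, v})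

theorem rename_congr {S T : Sequent P.Obj} {σ τ : Iso S T} (f : P.Hom S)
    (h : ∀ i, σ.equiv i = τ.equiv i) : P.rename σ f = P.rename τ f := by
  rw [Iso.eq_of h]

theorem rename_id {S : Sequent P.Obj} {σ : Iso S S} (f : P.Hom S)
    (h : ∀ i, σ.equiv i = i) : P.rename σ f = f :=
  (P.rename_congr f (τ := Iso.refl S) h).trans (P.rename_refl f)

theorem rename_rename {S T U : Sequent P.Obj} (σ : Iso S T) (τ : Iso T U) (f : P.Hom S) :
    P.rename τ (P.rename σ f) = P.rename (σ.trans τ) f :=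
  (P.rename_trans σ τ f).symm

theorem rename_cutAt (s : Side) {S S' T T' : Sequent P.Obj} {x : P.Obj} (σ : Iso S S')
    (τ : Iso T T') (f : P.Hom (S ⊹ one s x)) (g : P.Hom (T ⊹ one s.op x)) :
    P.rename (σ.app τ) (P.cutAt s f g) =
      P.cutAt s (P.rename (σ.app (Iso.refl _)) f) (P.rename (τ.app (Iso.refl _)) g) := by
  cases s
  · simp only [PolycategoryData.cutAt]
    rw [rename_rename]
    erw [← P.rename_cut, rename_rename]
    refine P.rename_congr _ ?_
    rintro (i | i) <;> rfl
  · exact P.rename_cut σ τ f g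

theorem rename_cutAt_left (s : Side) {S S' T : Sequent P.Obj} {x : P.Obj} (σ : Iso S S')
    (f : P.Hom (S ⊹ one s x)) (g : P.Hom (T ⊹ one s.op x)) :
    P.rename (σ.app (Iso.refl T)) (P.cutAt s f g) =
      P.cutAt s (P.rename (σ.app (Iso.refl _)) f) g := by
  rw [rename_cutAt, P.rename_id g]
  rintro (i | i) <;> rfl

theorem rename_cutAt_right (s : Side) {S T T' : Sequent P.Obj} {x : P.Obj} (τ : Iso T T')
    (f : P.Hom (S ⊹ one s x)) (g : P.Hom (T ⊹ one s.op x)) :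
    P.rename ((Iso.refl S).app τ) (P.cutAt s f g) =
      P.cutAt s f (P.rename (τ.app (Iso.refl _)) g) := by
  rw [rename_cutAt, P.rename_id f]
  rintro (i | i) <;> rfl

theorem rename_comm_comm {S T : Sequent P.Obj} (f : P.Hom (S ⊹ T)) :
    P.rename (Iso.comm _ _) (P.rename (Iso.comm _ _) f) = f := by
  rw [rename_rename]
  exact P.rename_id _ (by rintro (i | i) <;> rfl)

theorem idAt_cutAt (s : Side) {S : Sequent P.Obj} {x : P.Obj} (f : P.Hom (S ⊹ one s.op x)) :
    P.rename (Iso.comm _ _) (P.cutAt s (P.rename (Iso.comm _ _) (P.idAt s x)) f) = f := by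
  cases s
  · exact (congrArg _ (congrArg _ (P.cut_id f))).trans (P.rename_comm_comm f)
  · have e := P.rename_comm_comm (P.id x)
    exact ((congrArg (fun g => P.rename (Iso.comm _ _) (P.cut g f)) e).trans
      (congrArg _ (P.id_cut f))).trans (P.rename_comm_comm f)

theorem cutAt_cod {S T : Sequent P.Obj} {x : P.Obj} (f : P.Hom (S ⊹ one .cod x))
    (g : P.Hom (T ⊹ one .dom x)) :
    P.cutAt .cod f g = P.rename (Iso.comm _ _) (P.cutAt .dom g f) := by
  change P.cut f g = P.rename _ (P.rename _ (P.cut f g))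
  rw [rename_rename, P.rename_id]
  rintro (i | i) <;> rfl

theorem cutAt_comm_aux (s t : Side) {S T U : Sequent P.Obj} {x y : P.Obj}
    (f : P.Hom (S ⊹ one s.op x ⊹ one t y)) (g : P.Hom (T ⊹ one s x))
    (h : P.Hom (U ⊹ one t.op y)) :
    P.rename (Iso.exch _ _ _) (P.rename (Iso.comm _ _)
        (P.cutAt s g (P.rename (Iso.exch _ _ _) (P.cutAt t f h)))) =
      P.cutAt t (P.rename (Iso.exch _ _ _) (P.rename (Iso.comm _ _)
        (P.cutAt s g (P.rename (Iso.exch _ _ _) f)))) h := by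
  rw [← P.cut_cut s t g f h]
  have e : P.rename (Iso.exch S (one t y) T) (P.rename (Iso.comm _ _)
        (P.cutAt s g (P.rename (Iso.exch _ _ _) f))) =
      P.rename ((Iso.comm T S).app (Iso.refl (one t y)))
        (P.rename (Iso.assoc T S (one t y)).symm (P.cutAt s g (P.rename (Iso.exch _ _ _) f))) := by
    rw [rename_rename, rename_rename]
    exact P.rename_congr _ (by rintro (i | (i | i)) <;> rfl)
  rw [e, ← rename_cutAt_left, rename_rename, rename_rename]
  exact P.rename_congr _ (by rintro ((i | i) | i) <;> rfl)

/-- Two cuts into `f`. -/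
theorem cutAt_comm (s t : Side) {S T U : Sequent P.Obj} {x y : P.Obj}
    (f : P.Hom (S ⊹ one s x ⊹ one t y)) (g : P.Hom (T ⊹ one s.op x))
    (h : P.Hom (U ⊹ one t.op y)) :
    P.rename (Iso.exch _ _ _) (P.cutAt s (P.rename (Iso.exch _ _ _) (P.cutAt t f h)) g) =
      P.cutAt t (P.rename (Iso.exch _ _ _) (P.cutAt s (P.rename (Iso.exch _ _ _) f) g)) h := by
  cases s
  · exact P.cutAt_comm_aux .cod t f g h
  · have key := P.cutAt_comm_aux .dom t f g h
    erw [← P.cutAt_cod, ← P.cutAt_cod] at key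
    exact key

/-- `cut_cut` where `g` has no other channels. -/
theorem cutAt_cutAt_two (s t : Side) {S U : Sequent P.Obj} {x y : P.Obj}
    (f : P.Hom (S ⊹ one s x)) (g : P.Hom (one s.op x ⊹ one t y)) (h : P.Hom (U ⊹ one t.op y)) :
    P.cutAt t (P.cutAt s f (P.rename (Iso.comm _ _) g)) h =
      P.cutAt s f (P.rename (Iso.comm _ _) (P.cutAt t g h)) := by
  have key := P.cut_cut s t f
    (P.rename ((Iso.nilApp (one s.op x)).symm.app (Iso.refl (one t y))) g) h
  rw [← rename_cutAt_left, rename_rename, rename_rename] at key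
  have e₁ : P.rename ((Iso.refl _).app (Iso.nilApp (one t y)).symm)
      (P.cutAt s f (P.rename (Iso.comm _ _) g)) =
      P.cutAt s f (P.rename (((Iso.nilApp (one s.op x)).symm.app (Iso.refl (one t y))).trans
        (Iso.exch nil (one s.op x) (one t y))) g) := by
    rw [rename_cutAt, rename_rename, P.rename_id f]
    · congr 1
      exact P.rename_congr _ (by rintro (i | i) <;> rfl)
    · rintro (i | i) <;> rfl
  rw [← e₁, rename_rename] at key
  have e₂ : P.rename ((Iso.refl _).app (Iso.nilApp U).symm)
      (P.cutAt s f (P.rename (Iso.comm _ _) (P.cutAt t g h))) =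
      P.cutAt s f (P.rename (((Iso.nilApp (one s.op x)).symm.app (Iso.refl U)).trans
        (Iso.exch nil (one s.op x) U)) (P.cutAt t g h)) := by
    rw [rename_cutAt, rename_rename, P.rename_id f]
    · congr 1
      exact P.rename_congr _ (by rintro (i | i) <;> rfl)
    · rintro (i | i) <;> rfl
  rw [← e₂] at key
  have e₃ : P.rename ((((Iso.refl S).app (Iso.nilApp (one t y)).symm).trans
      (Iso.assoc S nil (one t y)).symm)) (P.cutAt s f (P.rename (Iso.comm _ _) g)) =
      P.rename (Iso.app (T := S ⊹ nil) ⟨(Equiv.sumEmpty S.Ch Empty).symm, fun _ => rfl,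
        fun _ => rfl⟩ (Iso.refl _)) (P.cutAt s f (P.rename (Iso.comm _ _) g)) :=
    P.rename_congr _ (by rintro (i | i) <;> rfl)
  erw [e₃, ← rename_cutAt_left, rename_rename] at key
  have key' := congrArg (P.rename ((Iso.refl S).app (Iso.nilApp U))) key
  rw [rename_rename, rename_rename, rename_id, rename_id] at key'
  · exact key'
  · rintro (i | i) <;> rfl
  · rintro (i | i) <;> rfl

end Polycategory

namespace Additive

variable {P : Polycategory.{u, v}} {n : ℕ} {X : Fin n → P.Obj} {o : P.Obj}

theorem tuple_cut_two {s : Side} (A : Additive P s X o) (t : Side) {T : Sequent P.Obj} {z : P.Obj}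
    (f : ∀ i, P.Hom (one t z ⊹ one s (X i))) (g : P.Hom (T ⊹ one t.op z)) :
    P.cutAt t (P.rename (Iso.comm _ _) (A.tuple f)) g =
      P.rename (Iso.comm _ _) (A.tuple fun i =>
        P.rename (Iso.comm _ _) (P.cutAt t (P.rename (Iso.comm _ _) (f i)) g)) := by
  have key := A.tuple_cut t
    (fun i => P.rename ((Iso.nilApp (one t z)).symm.app (Iso.refl (one s (X i)))) (f i)) g
  rw [← A.tuple_rename, P.rename_rename] at key
  have e : ∀ (x : P.Obj) (f : P.Hom (one t z ⊹ one s x)),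
      P.cutAt t (P.rename (((Iso.nilApp (one t z)).symm.app (Iso.refl (one s x))).trans
        (Iso.exch nil (one t z) (one s x))) f) g =
      P.rename ((Iso.nilApp (one s x)).symm.app (Iso.refl T))
        (P.cutAt t (P.rename (Iso.comm _ _) f) g) := by
    intro x f
    rw [P.rename_cutAt_left, P.rename_rename]
    congr 1
    exact P.rename_congr _ (by rintro (i | i) <;> rfl)
  simp only [P.rename_rename, e] at key
  have e' : ∀ i, P.rename (((Iso.nilApp (one s (X i))).symm.app (Iso.refl T)).trans
        (Iso.exch nil (one s (X i)) T)) (P.cutAt t (P.rename (Iso.comm _ _) (f i)) g) =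
      P.rename ((Iso.nilApp T).symm.app (Iso.refl _))
        (P.rename (Iso.comm _ _) (P.cutAt t (P.rename (Iso.comm _ _) (f i)) g)) := by
    intro i
    rw [P.rename_rename]
    exact P.rename_congr _ (by rintro (i | i) <;> rfl)
  simp only [e', ← A.tuple_rename] at key
  have key' := congrArg (P.rename ((Iso.nilApp (one s o)).app (Iso.refl T))) key
  rw [P.rename_rename, P.rename_rename, P.rename_rename, P.rename_id] at key'
  · rw [key']
    exact P.rename_congr _ (by rintro (i | i) <;> rfl)
  · rintro (i | i) <;> rfl

theorem tuple_leg {s : Side} (A : Additive P s.op X o) : A.tuple A.leg = P.idAt s o :=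
  A.tuple.apply_symm_apply _

theorem tuple_symm {s : Side} (A : Additive P s.op X o) {T : Sequent P.Obj}
    (f : P.Hom (T ⊹ one s.op o)) (k : Fin n) :
    A.tuple.symm f k =
      P.rename (Iso.comm _ _) (P.cutAt s (P.rename (Iso.comm _ _) (A.leg k)) f) := by
  have key := A.tuple_cut_two s A.leg f
  rw [tuple_leg] at key
  have key' := congrArg (P.rename (Iso.comm _ _)) key
  rw [P.idAt_cutAt, P.rename_rename, P.rename_id] at key'
  · exact congrFun ((Equiv.symm_apply_eq _).2 key') k
  · rintro (i | i) <;> rfl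

theorem exists_tuple_symm : ∀ {s : Side} (A : Additive P s X o) (k : Fin n),
    ∃ c : P.Hom (one s (X k) ⊹ one s.op o), ∀ {T : Sequent P.Obj} (f : P.Hom (T ⊹ one s o)),
      A.tuple.symm f k = P.cutAt s f c
  | .dom, A, k => ⟨_, fun f => A.tuple_symm (s := .cod) f k⟩
  | .cod, A, k => ⟨P.rename (Iso.comm _ _) (A.leg (s := .dom) k), fun f =>
      (A.tuple_symm (s := .dom) f k).trans (P.cutAt_cod _ _).symm⟩

theorem rename_send {s : Side} (A : Additive P s.op X o) {S T : Sequent P.Obj} (σ : Iso S T)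
    (k : Fin n) (f : P.Hom (S ⊹ one s (X k))) :
    P.rename (σ.app (Iso.refl _)) (A.send k f) =
      A.send k (P.rename (σ.app (Iso.refl _)) f) :=
  P.rename_cutAt_left s σ f _

theorem send_cut {s : Side} (A : Additive P s.op X o) (t : Side) {S T : Sequent P.Obj} {z : P.Obj}
    (k : Fin n) (f : P.Hom (S ⊹ one t z ⊹ one s (X k))) (g : P.Hom (T ⊹ one t.op z)) :
    P.cutAt t (P.rename (Iso.exch _ _ _) (A.send k f)) g =
      P.rename (Iso.exch _ _ _) (A.send k
        (P.rename (Iso.exch _ _ _) (P.cutAt t (P.rename (Iso.exch _ _ _) f) g))) := by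
  have key := congrArg (P.rename (Iso.exch S T (one s o))) (P.cutAt_comm t s f g (A.leg k))
  rw [P.rename_rename, P.rename_id] at key
  · exact key
  · rintro ((i | i) | i) <;> rfl

theorem send_cut_tuple {s : Side} (A : Additive P s.op X o) {S T : Sequent P.Obj}
    (k : Fin n) (f : P.Hom (S ⊹ one s (X k))) (g : ∀ i, P.Hom (T ⊹ one s.op (X i))) :
    P.cutAt s (A.send k f) (A.tuple g) = P.cutAt s f (g k) := by
  have key := P.cutAt_cutAt_two s s f (P.rename (Iso.comm _ _) (A.leg k)) (A.tuple g)
  rw [← A.tuple_symm, A.tuple.symm_apply_apply, P.rename_rename, P.rename_id (A.leg k)] at key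
  · exact key
  · rintro (i | i) <;> rfl

theorem tuple_send {s t : Side} {m : ℕ} {Y : Fin m → P.Obj} {p : P.Obj} (A : Additive P s X o)
    (B : Additive P t.op Y p) {S : Sequent P.Obj} (k : Fin m)
    (f : ∀ i, P.Hom (S ⊹ one s (X i) ⊹ one t (Y k))) :
    P.rename (Iso.exch _ _ _) (A.tuple fun i => P.rename (Iso.exch _ _ _) (B.send k (f i))) =
      B.send k (P.rename (Iso.exch _ _ _) (A.tuple fun i => P.rename (Iso.exch _ _ _) (f i))) := by
  rw [send, A.tuple_cut]
  congr 2
  funext i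
  rw [P.rename_rename, P.rename_id (f i)]
  · rfl
  · rintro ((i | i) | i) <;> rfl

theorem send_send {s t : Side} {m : ℕ} {Y : Fin m → P.Obj} {p : P.Obj} (A : Additive P s.op X o)
    (B : Additive P t.op Y p) {S : Sequent P.Obj} (k : Fin n) (l : Fin m)
    (f : P.Hom (S ⊹ one s (X k) ⊹ one t (Y l))) :
    P.rename (Iso.exch _ _ _) (A.send k (P.rename (Iso.exch _ _ _) (B.send l f))) =
      B.send l (P.rename (Iso.exch _ _ _) (A.send k (P.rename (Iso.exch _ _ _) f))) :=
  P.cutAt_comm s t f (A.leg k) (B.leg l)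

theorem tuple_tuple {s t : Side} {m : ℕ} {Y : Fin m → P.Obj} {p : P.Obj} (A : Additive P s X o)
    (B : Additive P t Y p) {S : Sequent P.Obj}
    (f : ∀ i j, P.Hom (S ⊹ one s (X i) ⊹ one t (Y j))) :
    P.rename (Iso.exch _ _ _)
        (A.tuple fun i => P.rename (Iso.exch _ _ _) (B.tuple fun j => f i j)) =
      B.tuple fun j =>
        P.rename (Iso.exch _ _ _) (A.tuple fun i => P.rename (Iso.exch _ _ _) (f i j)) := by
  rw [← Equiv.symm_apply_eq]
  funext j
  obtain ⟨c, hc⟩ := B.exists_tuple_symm j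
  rw [hc, A.tuple_cut]
  congr 2
  funext i
  rw [P.rename_rename, P.rename_id (B.tuple _), ← hc, Equiv.symm_apply_apply]
  rintro ((i | i) | i) <;> rfl

end Additive

namespace Polycategory

variable (P : Polycategory.{u, v}) {D : Type u'} (e : D → P.Obj)

/-- The data of `P` on new objects `D`, along a map of objects. -/
@[reducible]
def pullData : PolycategoryData.{u', v} where
  Obj := D
  Hom := fun S => P.Hom (S.map e)
  id := fun x => P.rename (Iso.mapTwo e .dom .cod x x).symm (P.id (e x))
  cut := fun {S T x} f g =>
    P.rename (Iso.mapApp e S T).symm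
      (P.cut (P.rename (Iso.mapOne e S .cod x) f)
        (P.rename (Iso.mapOne e T .dom x) g))
  rename := fun σ f => P.rename (σ.map e) f

theorem pull_cutAt (s : Side) {S T : Sequent D} {x : D} (f : P.Hom ((S ⊹ one s x).map e))
    (g : P.Hom ((T ⊹ one s.op x).map e)) :
    (P.pullData e).cutAt s f g =
      P.rename (Iso.mapApp e S T).symm
        (P.cutAt s (P.rename (Iso.mapOne e S s x) f)
          (P.rename (Iso.mapOne e T s.op x) g)) := by
  cases s
  · change P.rename _ (P.rename _ (P.cut _ _)) = P.rename _ (P.rename _ (P.cut _ _))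
    refine (P.rename_rename _ _ _).trans (Eq.trans ?_ (P.rename_rename _ _ _).symm)
    exact P.rename_congr _ (by rintro (i | i) <;> rfl)
  · rfl

/-- The polycategory `P` on new objects `D`, along a map of objects. -/
@[reducible]
def pull : Polycategory.{u', v} where
  toPolycategoryData := P.pullData e
  rename_refl := fun f => P.rename_id _ fun _ => rfl
  rename_trans := fun {S T U : Sequent D} (σ : Iso S T) (τ : Iso T U)
      (f : P.Hom (S.map e)) => by
    change P.rename _ _ = P.rename _ (P.rename _ _)
    rw [rename_rename]
    exact P.rename_congr _ fun _ => rfl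
  rename_cut := fun {S S' T T' : Sequent D} {x : D} (σ : Iso S S') (τ : Iso T T')
      (f : P.Hom ((S ⊹ one .cod x).map e)) (g : P.Hom ((T ⊹ one .dom x).map e)) => by
    change P.rename ((σ.app τ).map e) (P.rename (Iso.mapApp e S T).symm (P.cut _ _)) =
      P.rename (Iso.mapApp e S' T').symm
        (P.cut (P.rename (Iso.mapOne e S' .cod x) (P.rename ((σ.app (Iso.refl (one .cod x))).map e) f))
        (P.rename (Iso.mapOne e T' .dom x) (P.rename ((τ.app (Iso.refl (one .dom x))).map e) g)))
    have key := congrArg (P.rename (Iso.mapApp e S' T').symm)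
      (P.rename_cut (σ.map e) (τ.map e)
      (P.rename (Iso.mapOne e S .cod x) f) (P.rename (Iso.mapOne e T .dom x) g))
    rw [rename_rename, rename_rename, rename_rename] at key
    rw [rename_rename, rename_rename, rename_rename]
    refine Eq.trans (P.rename_congr _ ?_) (key.trans ?_)
    · rintro (i | i) <;> rfl
    · congr 2
  id_cut := fun {S : Sequent D} {x : D} (f : P.Hom ((S ⊹ one .dom x).map e)) => by
    have key := P.id_cut (P.rename (Iso.mapOne e S .dom x) f)
    rw [← P.rename_id (P.id (e x)) (σ := (Iso.mapTwo e .dom .cod x x).symm.trans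
      (Iso.mapTwo e .dom .cod x x)) (fun _ => rfl), ← rename_rename] at key
    refine (congrArg (P.rename (Iso.mapApp e (one .dom x) S).symm) key).trans ?_
    refine (congrArg (P.rename (Iso.mapApp e (one .dom x) S).symm)
      (P.rename_rename _ _ _)).trans ?_
    refine (P.rename_rename _ _ _).trans ?_
    exact P.rename_congr (τ := (Iso.comm S (one .dom x)).map e) f (by rintro (i | i) <;> rfl)
  cut_id := fun {S : Sequent D} {x : D} (f : P.Hom ((S ⊹ one .cod x).map e)) => by
    have key := P.cut_id (P.rename (Iso.mapOne e S .cod x) f)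
    rw [P.rename_congr (P.id (e x)) (τ := ((Iso.mapTwo e .dom .cod x x).symm.trans
      ((Iso.comm (one .dom x) (one .cod x)).map e)).trans (Iso.mapTwo e .cod .dom x x))
      (by rintro (i | i) <;> rfl), ← rename_rename, ← rename_rename] at key
    refine (congrArg (P.rename (Iso.mapApp e S (one .cod x)).symm) key).trans ?_
    exact (P.rename_rename _ _ _).trans (P.rename_id _ fun _ => rfl)
  cut_cut := fun s t {S T U : Sequent D} {x y : D} (f : P.Hom ((S ⊹ one s x).map e))
      (g : P.Hom ((T ⊹ one s.op x ⊹ one t y).map e)) (h : P.Hom ((U ⊹ one t.op y).map e)) => by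
    let f' := P.rename (Iso.mapOne e S s x) f
    obtain ⟨g', hg⟩ : ∃ g' : P.Hom (T.map e ⊹ one s.op (e x) ⊹ one t (e y)),
        P.rename ((Iso.mapOne e (T ⊹ one s.op x) t y).trans
          ((Iso.mapOne e T s.op x).app (Iso.refl _))) g = g' := ⟨_, rfl⟩
    let h' := P.rename (Iso.mapOne e U t.op y) h
    have e₁ : P.rename (Iso.mapOne e (T ⊹ one t y) s.op x)
        (P.rename ((Iso.exch T (one s.op x) (one t y)).map e) g) =
        P.rename ((Iso.mapOne e T t y).symm.app (Iso.refl (one s.op (e x))))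
          (P.rename (Iso.exch _ _ _) g') := by
      rw [← hg, rename_rename, rename_rename, rename_rename]
      refine P.rename_congr _ ?_
      rintro ((i | i) | i) <;> rfl
    have e₂ : P.rename (Iso.mapOne e (S ⊹ T) t y)
        (P.rename ((Iso.assoc S T (one t y)).symm.map e)
          (P.rename (Iso.mapApp e S (T ⊹ one t y)).symm
            (P.cutAt s f' (P.rename ((Iso.mapOne e T t y).symm.app
              (Iso.refl (one s.op (e x)))) (P.rename (Iso.exch _ _ _) g'))))) =
        P.rename ((Iso.mapApp e S T).symm.app (Iso.refl (one t (e y))))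
          (P.rename (Iso.assoc _ _ _).symm
            (P.cutAt s f' (P.rename (Iso.exch _ _ _) g'))) := by
      rw [← rename_cutAt_right, rename_rename, rename_rename, rename_rename, rename_rename]
      exact P.rename_congr _ (by rintro (i | (i | i)) <;> rfl)
    have e₃ : P.rename (Iso.mapOne e (T ⊹ one s.op x) t y) g =
        P.rename ((Iso.mapOne e T s.op x).symm.app (Iso.refl (one t (e y)))) g' := by
      rw [← hg, rename_rename]
      refine P.rename_congr _ ?_
      rintro ((i | i) | i) <;> rfl
    have e₄ : P.rename (Iso.mapOne e (T ⊹ U) s.op x)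
        (P.rename ((Iso.exch T (one s.op x) U).map e)
          (P.rename (Iso.mapApp e (T ⊹ one s.op x) U).symm
            (P.cutAt t (P.rename ((Iso.mapOne e T s.op x).symm.app
              (Iso.refl (one t (e y)))) g') h'))) =
        P.rename ((Iso.mapApp e T U).symm.app (Iso.refl (one s.op (e x))))
          (P.rename (Iso.exch _ _ _) (P.cutAt t g' h')) := by
      rw [← rename_cutAt_left, rename_rename, rename_rename, rename_rename, rename_rename]
      refine P.rename_congr _ ?_
      rintro ((i | i) | i) <;> rfl
    have key := congrArg (P.rename ((Iso.mapApp e S (T ⊹ U)).trans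
      ((Iso.refl _).app (Iso.mapApp e T U))).symm) (P.cut_cut s t f' g' h')
    have l : (P.pullData e).rename (Iso.assoc S T U) ((P.pullData e).cutAt t
        ((P.pullData e).rename (Iso.assoc _ _ _).symm
          ((P.pullData e).cutAt s f ((P.pullData e).rename (Iso.exch _ _ _) g))) h) =
        P.rename ((Iso.mapApp e S (T ⊹ U)).trans
          ((Iso.refl _).app (Iso.mapApp e T U))).symm (P.rename (Iso.assoc _ _ _)
            (P.cutAt t (P.rename (Iso.assoc _ _ _).symm
              (P.cutAt s f' (P.rename (Iso.exch _ _ _) g'))) h')) := by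
      refine (congrArg (fun k => P.rename ((Iso.assoc S T U).map e) ((P.pullData e).cutAt t
        (P.rename ((Iso.assoc S T (one t y)).symm.map e) k) h)) (P.pull_cutAt e s f _)).trans ?_
      refine (congrArg (P.rename ((Iso.assoc S T U).map e)) (P.pull_cutAt e t _ h)).trans ?_
      change P.rename ((Iso.assoc S T U).map e) (P.rename (Iso.mapApp e (S ⊹ T) U).symm
        (P.cutAt t (P.rename (Iso.mapOne e (S ⊹ T) t y)
          (P.rename ((Iso.assoc S T (one t y)).symm.map e)
            (P.rename (Iso.mapApp e S (T ⊹ one t y)).symm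
              (P.cutAt s f' (P.rename (Iso.mapOne e (T ⊹ one t y) s.op x)
                (P.rename ((Iso.exch T (one s.op x) (one t y)).map e) g)))))) h')) = _
      rw [e₁, e₂, ← rename_cutAt_left, rename_rename, rename_rename]
      refine Eq.trans ?_ (P.rename_rename _ _ _).symm
      refine P.rename_congr _ ?_
      rintro ((i | i) | i) <;> rfl
    have r : (P.pullData e).cutAt s f ((P.pullData e).rename (Iso.exch _ _ _)
        ((P.pullData e).cutAt t g h)) =
        P.rename ((Iso.mapApp e S (T ⊹ U)).trans
          ((Iso.refl _).app (Iso.mapApp e T U))).symm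
            (P.cutAt s f' (P.rename (Iso.exch _ _ _) (P.cutAt t g' h'))) := by
      refine (congrArg (fun k => (P.pullData e).cutAt s f (P.rename ((Iso.exch T (one s.op x) U).map e)
        k)) (P.pull_cutAt e t g h)).trans ((P.pull_cutAt e s f _).trans ?_)
      change P.rename (Iso.mapApp e S (T ⊹ U)).symm (P.cutAt s f'
        (P.rename (Iso.mapOne e (T ⊹ U) s.op x)
        (P.rename ((Iso.exch T (one s.op x) U).map e)
          (P.rename (Iso.mapApp e (T ⊹ one s.op x) U).symm
            (P.cutAt t (P.rename (Iso.mapOne e (T ⊹ one s.op x) t y) g) h'))))) = _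
      rw [e₃, e₄, ← rename_cutAt_right, rename_rename]
      exact P.rename_congr _ (by rintro (i | (i | i)) <;> rfl)
    exact l.trans (key.trans r.symm)

end Polycategory

namespace Additive

variable {P : Polycategory.{u, v}} {D : Type u'} (e : D → P.Obj) {n : ℕ} {X : Fin n → D} {o : D}

/-- The correspondence of `A`, on new objects. -/
def pullTuple {s : Side} (A : Additive P s (fun i => e (X i)) (e o)) (S : Sequent D) :
    (∀ i, P.Hom ((S ⊹ one s (X i)).map e)) ≃ P.Hom ((S ⊹ one s o).map e) where
  toFun := fun f => P.rename (Iso.mapOne e S s o).symm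
    (A.tuple fun i => P.rename (Iso.mapOne e S s (X i)) (f i))
  invFun := fun g i =>
    P.rename (Iso.mapOne e S s (X i)).symm (A.tuple.symm (P.rename (Iso.mapOne e S s o) g) i)
  left_inv := fun f => by
    funext i
    dsimp only
    rw [P.rename_rename, P.rename_id (A.tuple _), Equiv.symm_apply_apply, P.rename_rename]
    · exact P.rename_id _ fun _ => rfl
    · exact fun _ => rfl
  right_inv := fun g => by
    have h : ∀ i (f : P.Hom (S.map e ⊹ one s (e (X i)))),
        P.rename ((Iso.mapOne e S s (X i)).symm.trans (Iso.mapOne e S s (X i))) f = f :=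
      fun i f => P.rename_id f fun _ => rfl
    dsimp only
    simp only [P.rename_rename, h, Equiv.apply_symm_apply]
    exact P.rename_id _ fun _ => rfl

/-- Poly-sums and poly-products on new objects. -/
def pull {s : Side} (A : Additive P s (fun i => e (X i)) (e o)) : Additive (P.pull e) s X o where
  tuple := fun {S} => A.pullTuple e S
  tuple_rename := fun {S T : Sequent D} (σ : Iso S T)
      (f : ∀ i, P.Hom ((S ⊹ one s (X i)).map e)) => by
    change P.rename ((σ.app (Iso.refl (one s o))).map e) (P.rename (Iso.mapOne e S s o).symm
        (A.tuple fun i => P.rename (Iso.mapOne e S s (X i)) (f i))) =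
      P.rename (Iso.mapOne e T s o).symm (A.tuple fun i => P.rename (Iso.mapOne e T s (X i))
        (P.rename ((σ.app (Iso.refl (one s (X i)))).map e) (f i)))
    have h : ∀ i, P.rename (Iso.mapOne e T s (X i))
        (P.rename ((σ.app (Iso.refl (one s (X i)))).map e) (f i)) =
        P.rename ((σ.map e).app (Iso.refl _)) (P.rename (Iso.mapOne e S s (X i)) (f i)) := by
      intro i
      rw [P.rename_rename, P.rename_rename]
      refine P.rename_congr _ ?_
      rintro (i | i) <;> rfl
    simp only [h, ← A.tuple_rename]
    rw [P.rename_rename, P.rename_rename]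
    refine P.rename_congr _ ?_
    rintro (i | i) <;> rfl
  tuple_cut := fun t {S T : Sequent D} {z : D}
      (f : ∀ i, P.Hom ((S ⊹ one t z ⊹ one s (X i)).map e)) (g : P.Hom ((T ⊹ one t.op z).map e)) => by
    obtain ⟨f', hf⟩ : ∃ f' : ∀ i, P.Hom (S.map e ⊹ one t (e z) ⊹ one s (e (X i))),
        ∀ i, P.rename ((Iso.mapOne e (S ⊹ one t z) s (X i)).trans
          ((Iso.mapOne e S t z).app (Iso.refl _))) (f i) = f' i := ⟨_, fun _ => rfl⟩
    obtain ⟨g', hg⟩ : ∃ g', P.rename (Iso.mapOne e T t.op z) g = g' := ⟨_, rfl⟩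
    have h₁ : P.rename (Iso.mapOne e (S ⊹ one s o) t z)
        (P.rename ((Iso.exch S (one t z) (one s o)).map e)
          (P.rename (Iso.mapOne e (S ⊹ one t z) s o).symm
            (A.tuple fun i => P.rename (Iso.mapOne e (S ⊹ one t z) s (X i)) (f i)))) =
        P.rename ((Iso.mapOne e S s o).symm.app (Iso.refl (one t (e z))))
          (P.rename (Iso.exch _ _ _) (A.tuple f')) := by
      have h : ∀ i, P.rename (Iso.mapOne e (S ⊹ one t z) s (X i)) (f i) =
          P.rename ((Iso.mapOne e S t z).symm.app (Iso.refl _)) (f' i) := by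
        intro i
        rw [← hf, P.rename_rename]
        refine P.rename_congr _ ?_
        rintro ((i | i) | i) <;> rfl
      simp only [h, ← A.tuple_rename, P.rename_rename]
      refine P.rename_congr _ ?_
      rintro ((i | i) | i) <;> rfl
    have h₂ : ∀ i, P.rename (Iso.mapOne e (S ⊹ T) s (X i))
        (P.rename ((Iso.exch S (one s (X i)) T).map e)
          (P.rename (Iso.mapApp e (S ⊹ one s (X i)) T).symm
            (P.cutAt t (P.rename (Iso.mapOne e (S ⊹ one s (X i)) t z)
              (P.rename ((Iso.exch S (one t z) (one s (X i))).map e) (f i))) g'))) =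
        P.rename ((Iso.mapApp e S T).symm.app (Iso.refl _))
          (P.rename (Iso.exch _ _ _) (P.cutAt t (P.rename (Iso.exch _ _ _) (f' i)) g')) := by
      intro i
      have h : P.rename (Iso.mapOne e (S ⊹ one s (X i)) t z)
          (P.rename ((Iso.exch S (one t z) (one s (X i))).map e) (f i)) =
          P.rename ((Iso.mapOne e S s (X i)).symm.app (Iso.refl (one t (e z))))
            (P.rename (Iso.exch _ _ _) (f' i)) := by
        rw [← hf, P.rename_rename, P.rename_rename, P.rename_rename]
        refine P.rename_congr _ ?_
        rintro ((i | i) | i) <;> rfl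
      rw [h, ← P.rename_cutAt_left]
      simp only [P.rename_rename]
      refine P.rename_congr _ ?_
      rintro ((i | i) | i) <;> rfl
    refine (P.pull_cutAt e t _ g).trans ?_
    change P.rename (Iso.mapApp e (S ⊹ one s o) T).symm
        (P.cutAt t (P.rename (Iso.mapOne e (S ⊹ one s o) t z)
        (P.rename ((Iso.exch S (one t z) (one s o)).map e)
          (P.rename (Iso.mapOne e (S ⊹ one t z) s o).symm
            (A.tuple fun i => P.rename (Iso.mapOne e (S ⊹ one t z) s (X i)) (f i)))))
          (P.rename (Iso.mapOne e T t.op z) g)) =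
      P.rename ((Iso.exch S T (one s o)).map e) (P.rename (Iso.mapOne e (S ⊹ T) s o).symm
        (A.tuple fun i => P.rename (Iso.mapOne e (S ⊹ T) s (X i))
          (P.rename ((Iso.exch S (one s (X i)) T).map e)
            ((P.pullData e).cutAt t
              (P.rename ((Iso.exch S (one t z) (one s (X i))).map e) (f i)) g))))
    have h₃ : ∀ i, (P.pullData e).cutAt t
        (P.rename ((Iso.exch S (one t z) (one s (X i))).map e) (f i)) g =
        P.rename (Iso.mapApp e (S ⊹ one s (X i)) T).symm
            (P.cutAt t (P.rename (Iso.mapOne e (S ⊹ one s (X i)) t z)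
              (P.rename ((Iso.exch S (one t z) (one s (X i))).map e) (f i))) g') := by
      intro i
      rw [← hg]
      exact P.pull_cutAt e t _ g
    simp only [h₃, h₂]
    rw [h₁, ← P.rename_cutAt_left, hg, A.tuple_cut, ← A.tuple_rename]
    simp only [P.rename_rename]
    refine P.rename_congr _ ?_
    rintro ((i | i) | i) <;> rfl

end Additive

theorem Additive.tuple_send_id {P : Polycategory.{u, v}} {s : Side} {n : ℕ} {X : Fin n → P.Obj}
    {o : P.Obj} (A : Additive P s.op X o) :
    (A.tuple fun i => P.rename (Iso.comm _ _) (A.send i (P.rename (Iso.comm _ _) (P.idAt s (X i))))) =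
      P.idAt s o := by
  refine (congrArg A.tuple (funext fun i => ?_)).trans A.tuple_leg
  exact P.idAt_cutAt s (A.leg i)

section Comparison

variable {A : Polycategory.{u, v}} {B : Polycategory.{u', v'}} (S : SumsProducts B)
  (F : Morphism A B)

/-- The object of `B` that a formula over `A` denotes. -/
def Formula.eval : Formula A.Obj → B.Obj
  | .atom a => F.obj a
  | .sum X => S.inp .dom fun i => eval (X i)
  | .prod X => S.inp .cod fun i => eval (X i)

/-- `B` with the formulas over `A` as objects. -/
@[reducible]
def onFormulas : Polycategory.{u, v'} := B.pull (Formula.eval S F)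

/-- The sums and products of formulas, in `B`. -/
def additiveOnFormulas : ∀ (s : Side) {n : ℕ} (X : Fin n → Formula A.Obj),
    Additive (onFormulas S F) s X (Formula.inp s X)
  | .dom, _, X => (S.additive .dom fun i => (X i).eval S F).pull (Formula.eval S F)
  | .cod, _, X => (S.additive .cod fun i => (X i).eval S F).pull (Formula.eval S F)

/-- The polymorphism of `B` that a derivation over `A` denotes. -/
def Deriv.eval : ∀ {R : Sequent (Formula A.Obj)}, Deriv A R → (onFormulas S F).Hom R
  | _, .ax f => F.map f
  | _, .cut f g => (onFormulas S F).cut (eval f) (eval g)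
  | _, .rename σ f => (onFormulas S F).rename σ (eval f)
  | _, .tuple s f => (additiveOnFormulas S F s _).tuple fun i => eval (f i)
  | _, .send s (X := X) k f => (additiveOnFormulas S F s.op X).send k (eval f)

theorem Deriv.eval_ident : ∀ X : Formula A.Obj,
    (Deriv.ident A X).eval S F = (onFormulas S F).id X
  | .atom a => by
    change B.rename _ (F.map (A.id a)) = B.rename _ (B.id (F.obj a))
    rw [← F.map_id]
    have h := B.rename_rename (Iso.mapTwo F.obj .dom .cod a a)
      (Iso.mapTwo (Formula.eval S F) .dom .cod (.atom a) (.atom a)).symm (F.map (A.id a))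
    refine Eq.trans ?_ h.symm
    exact B.rename_congr (F.map (A.id a)) fun _ => rfl
  | .sum X => by
    have h := (additiveOnFormulas S F (Side.op .cod) X).tuple_send_id
    refine Eq.trans ?_ ((congrArg ((onFormulas S F).rename (Iso.comm _ _)) h).trans
      ((onFormulas S F).rename_comm_comm _))
    refine congrArg _ (congrArg (additiveOnFormulas S F .dom X).tuple (funext fun i => ?_))
    refine congrArg _ (congrArg ((additiveOnFormulas S F .dom X).send (s := .cod) i) ?_)
    exact (Deriv.eval_ident (X i)).trans ((onFormulas S F).rename_comm_comm _).symm
  | .prod X => by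
    have h := (additiveOnFormulas S F (Side.op .dom) X).tuple_send_id
    refine Eq.trans ?_ h
    refine congrArg (additiveOnFormulas S F .cod X).tuple (funext fun i => ?_)
    refine congrArg _ (congrArg ((additiveOnFormulas S F .cod X).send (s := .dom) i) ?_)
    exact congrArg ((onFormulas S F).rename (Iso.comm _ _)) (Deriv.eval_ident (X i))

theorem Deriv.eval_eq {R : Sequent (Formula A.Obj)} {f g : Deriv A R} (h : Deriv.Rel A f g) :
    f.eval S F = g.eval S F := by
  induction h with
  | refl f => rfl
  | symm _ ih => exact ih.symm
  | trans _ _ ih ih' => exact ih.trans ih'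
  | congr_cut _ _ ih ih' => exact congrArg₂ (onFormulas S F).cut ih ih'
  | congr_rename σ _ ih => exact congrArg ((onFormulas S F).rename σ) ih
  | congr_tuple s _ ih => exact congrArg (additiveOnFormulas S F s _).tuple (funext ih)
  | congr_send s k _ ih => exact congrArg ((additiveOnFormulas S F s.op _).send k) ih
  | rename_refl f => exact (onFormulas S F).rename_refl _
  | rename_trans σ τ f => exact (onFormulas S F).rename_trans σ τ _
  | rename_cut σ τ f g => exact (onFormulas S F).rename_cut σ τ _ _
  | rename_tuple s σ f => exact (additiveOnFormulas S F s _).tuple_rename σ _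
  | rename_send s σ k f => exact (additiveOnFormulas S F s.op _).rename_send σ k _
  | rename_ax σ f => exact (F.map_rename σ f).symm
  | @cut_ax R T a f g =>
    let e := Iso.mapApp (Formula.eval S F) (R.map Formula.atom) (T.map Formula.atom)
    have key := congrArg (B.rename e.symm) (F.map_cut f g)
    have h₁ := B.rename_rename (Iso.mapApp F.obj R T) e.symm (F.map (A.cut f g))
    have h₂ := B.rename_congr (F.map (A.cut f g)) (σ := (Iso.mapApp F.obj R T).trans e.symm)
      (τ := (Iso.mapApp Formula.atom R T).map (Formula.eval S F)) fun _ => rfl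
    refine Eq.trans ?_ (key.symm.trans (h₁.trans h₂))
    refine congrArg (B.rename e.symm) (congrArg₂ B.cut ?_ ?_)
    · exact (B.rename_rename _ _ _).trans (B.rename_congr (F.map f) fun _ => rfl)
    · exact (B.rename_rename _ _ _).trans (B.rename_congr (F.map g) fun _ => rfl)
  | id_cut f =>
    refine Eq.trans ?_ ((onFormulas S F).id_cut (f.eval S F))
    exact congrArg (fun g => (onFormulas S F).cut g (f.eval S F)) (Deriv.eval_ident S F _)
  | cut_id f =>
    refine Eq.trans ?_ ((onFormulas S F).cut_id (f.eval S F))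
    exact congrArg (fun g => (onFormulas S F).cut (f.eval S F)
      ((onFormulas S F).rename (Iso.comm _ _) g)) (Deriv.eval_ident S F _)
  | cut_cut s t f g h =>
    have key := (onFormulas S F).cut_cut s t (f.eval S F) (g.eval S F) (h.eval S F)
    cases s <;> cases t <;> exact key
  | tuple_cut s t f g =>
    have key := (additiveOnFormulas S F s _).tuple_cut t (fun i => (f i).eval S F) (g.eval S F)
    cases t <;> exact key
  | send_cut s t k f g =>
    have key := (additiveOnFormulas S F s.op _).send_cut t k (f.eval S F) (g.eval S F)
    cases t <;> exact key
  | send_cut_tuple s k f g =>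
    have key := (additiveOnFormulas S F s.op _).send_cut_tuple k (f.eval S F)
      (fun i => (g i).eval S F)
    cases s <;> exact key
  | tuple_tuple s t f =>
    exact (additiveOnFormulas S F s _).tuple_tuple (additiveOnFormulas S F t _)
      fun i j => (f i j).eval S F
  | tuple_send s t k f =>
    exact (additiveOnFormulas S F s _).tuple_send (additiveOnFormulas S F t.op _) k
      fun i => (f i).eval S F
  | send_send s t k l f =>
    exact (additiveOnFormulas S F s.op _).send_send (additiveOnFormulas S F t.op _) k l
      (f.eval S F)

/-- The morphism `F* : ΣΠ_A → B` induced by a morphism `F : A → B` to a polycategory with finite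
sums and products: it is `F` on atoms and axioms, and it takes formal sums and products,
cotuples, tuples, projections and injections to those of `B`. -/
def comparison : Morphism (SigmaPi A) B where
  obj := Formula.eval S F
  map := Quotient.lift (Deriv.eval S F) fun _ _ h => Deriv.eval_eq S F h
  map_id := fun X => by
    refine (congrArg (B.rename _) (Deriv.eval_ident S F X)).trans ?_
    exact (B.rename_rename _ _ _).trans (B.rename_id _ fun _ => rfl)
  map_cut := by
    rintro R T X ⟨f⟩ ⟨g⟩
    exact (B.rename_rename _ _ _).trans (B.rename_id _ fun _ => rfl)
  map_rename := by
    rintro R T σ ⟨f⟩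
    rfl

end Comparison

/-- An isomorphism between two objects of a polycategory. -/
structure ObjIso (P : Polycategory.{u, v}) (x y : P.Obj) where
  hom : P.Hom (one .dom x ⊹ one .cod y)
  inv : P.Hom (one .dom y ⊹ one .cod x)
  hom_inv : P.cut hom (P.rename (Iso.comm _ _) inv) = P.id x
  inv_hom : P.cut inv (P.rename (Iso.comm _ _) hom) = P.id y

/-- The polymorphism that, by a cut, turns a channel of type `x` on side `s` into a channel of
type `y`: the isomorphism itself for codomain channels, its inverse for domain channels. -/
def ObjIso.along {P : Polycategory.{u, v}} {x y : P.Obj} (θ : ObjIso P x y) :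
    ∀ s : Side, P.Hom (one s y ⊹ one s.op x)
  | .dom => θ.inv
  | .cod => P.rename (Iso.comm _ _) θ.hom

namespace Morphism

variable {P : Polycategory.{u, v}} {Q : Polycategory.{u', v'}} {R : Polycategory.{u'', v''}}

/-- The identity morphism. -/
def id (P : Polycategory.{u, v}) : Morphism P P where
  obj := fun x => x
  map := fun f => f
  map_id := fun _ => P.rename_id _ fun _ => rfl
  map_cut := fun {S T x} f g => by
    refine (P.rename_id _ fun _ => rfl).trans (congrArg₂ P.cut ?_ ?_)
    · exact (P.rename_id f fun _ => rfl).symm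
    · exact (P.rename_id g fun _ => rfl).symm
  map_rename := fun _ _ => rfl

/-- Composition of morphisms. -/
def comp (F : Morphism P Q) (G : Morphism Q R) : Morphism P R where
  obj := fun x => G.obj (F.obj x)
  map := fun f => G.map (F.map f)
  map_id := fun x => by
    refine Eq.trans ?_ (G.map_id (F.obj x))
    rw [← F.map_id, G.map_rename]
    exact ((R.rename_rename ((Iso.mapTwo F.obj .dom .cod x x).map G.obj)
      (Iso.mapTwo G.obj .dom .cod (F.obj x) (F.obj x)) _).trans
        (R.rename_congr _ fun _ => rfl)).symm
  map_cut := fun {S T x} f g => by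
    have h₁ := G.map_cut (Q.rename (Iso.mapOne F.obj S .cod x) (F.map f))
      (Q.rename (Iso.mapOne F.obj T .dom x) (F.map g))
    rw [← F.map_cut, G.map_rename, G.map_rename, G.map_rename] at h₁
    refine Eq.trans ?_ (h₁.trans (congrArg₂ R.cut ?_ ?_))
    · exact ((R.rename_rename ((Iso.mapApp F.obj S T).map G.obj)
        (Iso.mapApp G.obj (S.map F.obj) (T.map F.obj)) _).trans
          (R.rename_congr _ fun _ => rfl)).symm
    · exact (R.rename_rename _ _ _).trans (R.rename_congr (G.map (F.map f)) fun _ => rfl)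
    · exact (R.rename_rename _ _ _).trans (R.rename_congr (G.map (F.map g)) fun _ => rfl)
  map_rename := fun {S T} σ f => by
    rw [F.map_rename, G.map_rename]
    rfl

/-- `F` is full: it is surjective on each poly-hom-set. -/
def Full (F : Morphism P Q) : Prop :=
  ∀ S : Sequent P.Obj, Function.Surjective fun f : P.Hom S => F.map f

/-- `F` is a full inclusion: it is injective on objects and bijective on each poly-hom-set. -/
def FullInclusion (F : Morphism P Q) : Prop :=
  Function.Injective F.obj ∧ ∀ S : Sequent P.Obj, Function.Bijective fun f : P.Hom S => F.map f

/-- `F` on a polymorphism whose channels are listed. -/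
def mapList (F : Morphism P Q) (l : List (Side × P.Obj)) (f : P.Hom (ofList l)) :
    Q.Hom (ofList (l.map (Prod.map _root_.id F.obj))) :=
  Q.rename (Iso.mapOfList F.obj l) (F.map f)

end Morphism

/-- Turn the channels `F x` of a polymorphism that are listed in `l` into channels `G x`, by cuts
with isomorphisms; the channels in `R` are left alone. -/
def Polycategory.transport (Q : Polycategory.{u', v'}) {D : Type u} {F G : D → Q.Obj}
    (θ : ∀ x, ObjIso Q (F x) (G x)) : ∀ (l : List (Side × D)) (R : Sequent Q.Obj),
      Q.Hom (R ⊹ ofList (l.map (Prod.map id F))) → Q.Hom (R ⊹ ofList (l.map (Prod.map id G)))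
  | [], _, f => f
  | (s, x) :: l, R, f =>
      Q.rename (Iso.assoc R (one s (G x)) _)
        (transport Q θ l (R ⊹ one s (G x))
          (Q.rename (Iso.exch R _ (one s (G x)))
            (Q.cutAt s
              (Q.rename (Iso.exch R (one s (F x)) _) (Q.rename (Iso.assoc R (one s (F x)) _).symm f))
              ((θ x).along s))))

/-- A natural isomorphism between two morphisms of polycategories: isomorphisms
`θ x : F x ≅ G x` such that, for each `f : Γ → Δ`, cutting `F f` with `θ` along all codomain
channels and with the inverse of `θ` along all domain channels gives `G f`. -/
structure NatIso {P : Polycategory.{u, v}} {Q : Polycategory.{u', v'}} (F G : Morphism P Q) where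
  iso : ∀ x, ObjIso Q (F.obj x) (G.obj x)
  natural : ∀ (l : List (Side × P.Obj)) (f : P.Hom (ofList l)),
    Q.transport iso l nil (Q.rename (Iso.nilApp _).symm (F.mapList l f)) =
      Q.rename (Iso.nilApp _).symm (G.mapList l f)

/-- `F` is an equivalence of polycategories: it has a quasi-inverse. -/
def Morphism.IsEquivalence {P : Polycategory.{u, v}} {Q : Polycategory.{u', v'}}
    (F : Morphism P Q) : Prop :=
  ∃ G : Morphism Q P, Nonempty (NatIso (F.comp G) (Morphism.id P)) ∧
    Nonempty (NatIso (G.comp F) (Morphism.id Q))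

section Softness

variable {A : Polycategory.{u, v}} {B : Polycategory.{u', v'}} (S : SumsProducts B)
  (F : Morphism A B)

/-- The objects of `B` that are generated from the objects of `A` by finite sums and products,
up to isomorphism. -/
inductive Generated : B.Obj → Prop
  | atom (a : A.Obj) : Generated (F.obj a)
  | inp (s : Side) {n : ℕ} (X : Fin n → B.Obj) :
      (∀ i, Generated (X i)) → Generated (S.inp s X)
  | iso {x y : B.Obj} : ObjIso B x y → Generated x → Generated y

/-- The type of a channel of an output sequent: an object of `A`, or a family of objects of `B`
whose product (if the channel is in the domain) or sum (if it is in the codomain) is meant. -/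
inductive Tag (A : Polycategory.{u, v}) (B : Polycategory.{u', v'})
  | atom (a : A.Obj)
  | compound {n : ℕ} (X : Fin n → B.Obj)

namespace Tag

/-- The number of components. -/
def arity : Tag A B → ℕ
  | .atom _ => 0
  | .compound (n := n) _ => n

/-- The components. -/
def component : ∀ t : Tag A B, Fin t.arity → B.Obj
  | .atom _ => Fin.elim0
  | .compound X => X

/-- The object of `B` that is meant. -/
def realize (s : Side) : Tag A B → B.Obj
  | .atom a => F.obj a
  | .compound X => S.out s X

theorem realize_eq (s : Side) : ∀ (t : Tag A B) (_ : Fin t.arity),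
    t.realize S F s = S.out s t.component
  | .compound _, _ => rfl

end Tag

/-- An output sequent over `B`: every channel in the domain is an object of `A` or a (possibly
empty) product, every channel in the codomain is an object of `A` or a (possibly empty) sum, and
at least one channel is a product or a sum. -/
structure OutputSequent (A : Polycategory.{u, v}) (B : Polycategory.{u', v'}) where
  tags : Sequent (Tag A B)
  compound : ∃ (α : tags.Ch) (n : ℕ) (X : Fin n → B.Obj), tags.obj α = .compound X

namespace OutputSequent

variable (T : OutputSequent A B)

/-- The underlying sequent over `B`. -/
def toSequent : Sequent B.Obj :=
  ⟨T.tags.Ch, T.tags.finite, T.tags.side, fun α => (T.tags.obj α).realize S F (T.tags.side α)⟩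

/-- The output index: a compound channel together with one of its components. -/
def Index : Type := Σ α : T.tags.Ch, Fin (T.tags.obj α).arity

variable {T}

/-- The chosen component. -/
def Index.component (c : T.Index) : B.Obj := (T.tags.obj c.1).component c.2

/-- The channel `c.1` is the product or the sum of its components. -/
theorem Index.obj_eq (c : T.Index) :
    (T.toSequent S F).obj c.1 = S.out (T.tags.side c.1) (T.tags.obj c.1).component :=
  Tag.realize_eq S F _ _ c.2

end OutputSequent

/-- The map of poly-hom-sets that projects from (in the domain) or injects into (in the codomain)
the channel `α`, which is the product respectively the sum of `X`, at the component `k`. -/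
noncomputable def sendAt (R : Sequent B.Obj) (α : R.Ch) {n : ℕ} {X : Fin n → B.Obj}
    (h : R.obj α = S.out (R.side α) X) (k : Fin n) (f : B.Hom (R.set α (X k))) : B.Hom R :=
  B.rename (Iso.join R α h)
    ((S.additive (R.side α).op X).send k (B.rename (Iso.joinSet R α (X k)).symm f))

namespace OutputSequent

variable (T : OutputSequent A B)

/-- The disjoint union of the poly-hom-sets in which one compound channel has been replaced by
one of its components. -/
def Single : Type v' :=
  Σ c : T.Index, B.Hom ((T.toSequent S F).set c.1 c.component)

/-- The disjoint union of the poly-hom-sets in which two different compound channels have been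
replaced by one of their components. -/
def Double : Type v' :=
  Σ p : {p : T.Index × T.Index // p.1.1 ≠ p.2.1},
    B.Hom (((T.toSequent S F).set p.1.1.1 p.1.1.component).set p.1.2.1 p.1.2.component)

/-- Project or inject on the one channel. -/
noncomputable def send (x : T.Single S F) : B.Hom (T.toSequent S F) :=
  sendAt S (T.toSequent S F) x.1.1 (x.1.obj_eq S F) x.1.2 x.2

/-- Project or inject on the second of two channels. -/
noncomputable def sendSnd (x : T.Double S F) : T.Single S F :=
  let c := x.1.1.1
  let d := x.1.1.2
  ⟨c, sendAt S ((T.toSequent S F).set c.1 c.component) d.1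
    ((set_obj_of_ne (T.toSequent S F) x.1.2.symm _).trans (d.obj_eq S F)) d.2 x.2⟩

/-- Project or inject on the first of two channels. -/
noncomputable def sendFst (x : T.Double S F) : T.Single S F :=
  let c := x.1.1.1
  let d := x.1.1.2
  ⟨d, sendAt S ((T.toSequent S F).set d.1 d.component) c.1
    ((set_obj_of_ne (T.toSequent S F) x.1.2 _).trans (c.obj_eq S F)) c.2
    (B.rename (Iso.setSet (T.toSequent S F) c.1 d.1 x.1.2 c.component d.component) x.2)⟩

end OutputSequent

/-- `F` is a semi-soft extension: on each output poly-hom-set of `B`, every polymorphism factors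
through a projection of a product in its domain or an injection of a sum in its codomain. -/
def SemiSoft : Prop :=
  ∀ T : OutputSequent A B, Function.Surjective (T.send S F)

/-- `F` is a soft extension: each output poly-hom-set of `B` is the coequalizer of the two maps
from the poly-hom-sets with two channels replaced to those with one channel replaced. -/
def SoftExtension : Prop :=
  ∀ T : OutputSequent A B, ∃ h : T.send S F ∘ T.sendSnd S F = T.send S F ∘ T.sendFst S F,
    Function.Bijective (Function.Coequalizer.desc (T.sendSnd S F) (T.sendFst S F) (T.send S F) h)

/-- `F` is soft. -/
def Soft : Prop :=
  SemiSoft S F ∧ SoftExtension S F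

end Softness

end Poly

/-!
The comparison morphism `F* : ΣΠ_A → B` is treated through the sequent calculus `ΣΠ_A`. Only the
operations and conversions of `ΣΠ_A` matter, and they are collected in the structure `Calculus`;
that `F*` preserves them is `Calculus.Interpretation`.

*Cut elimination* (`Calculus.cutFree`). Up to conversion and renaming, every derivation is free of
cuts. A cut on a formula is permuted upwards in its first and then in its second premise until it
meets the rules that introduce the formula; there it disappears into an axiom, or becomes a cut on
a component of the formula.

*Fullness* (`Calculus.Interpretation.full`). Let `f` be a polymorphism of `B` whose channels are
values of formulas. If there is a sum in the domain or a product in the codomain, then `f` is a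
cotuple or a tuple. If all channels are atoms, then `f` comes from `A`, as `F` is full. Otherwise
`f` lies in an output poly-hom-set, and semi-softness makes it factor through a projection or an
injection. In each case the sequent gets smaller, and induction gives a derivation with value `f`.

*Faithfulness* (`Calculus.Interpretation.faithful`). The same induction is used. The (co)tuple
rules are invertible, and on atoms a cut-free derivation is an axiom, so the critical case is that
of an output sequent. There a cut-free derivation ends with a projection or an injection. By the
inductive hypothesis and fullness, the poly-hom-sets with one component replaced are the same in
`ΣΠ_A` and in `B`, and the map that adds the last rule respects the relation of the coequalizer,
because projections and injections on distinct channels may be permuted. As the poly-hom-set of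
`B` is this coequalizer, the derivation is determined by its value.

*Equivalence* (`Morphism.isEquivalence`). Since sums and products of isomorphic families are
isomorphic, every object of `B` is isomorphic to the value of a formula. Given isomorphisms
`θ b : F* (g b) ≅ b`, the quasi-inverse sends `f` to the derivation whose value becomes `f` by
composition with `θ` on all channels. These compositions are made one after the other; as
compositions on distinct channels commute, their order is irrelevant, and `Transported` expresses
the result as a relation that does not mention an order (`Transported.exists_bijective`,
`Transported.unique`). It is compatible with renaming, with cut, where `θ` and its inverse cancel
(`Carries.cut`), and with morphisms (`Carries.map`). Functoriality and naturality follow from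
uniqueness.
-/

namespace Poly

open Sequent

/-! ### Sequents and the calculus `ΣΠ` -/

namespace Sequent

variable {C : Type u} {D : Type v}

namespace Iso

/-- An isomorphism that matches the last channels restricts to the remaining ones. -/
theorem app_refl_of_inr {S S' : Sequent C} {s t : Side} {x z : C}
    (ρ : Iso (S' ⊹ one t z) (S ⊹ one s x)) (h : ρ.equiv (Sum.inr ()) = Sum.inr ()) :
    t = s ∧ z = x ∧ ∃ ρ' : Iso S' S, ∀ i, ρ.equiv i = Sum.map ρ'.equiv _root_.id i := by
  have hne : ∀ i : S'.Ch, ∃ j : S.Ch, ρ.equiv (Sum.inl i) = Sum.inl j := by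
    intro i
    rcases e : ρ.equiv (Sum.inl i) with j | j
    · exact ⟨j, rfl⟩
    · have := ρ.equiv.injective (e.trans h.symm)
      cases this
  choose f hf using hne
  have hinj : Function.Injective f := by
    intro i j e
    have := ρ.equiv.injective ((hf i).trans ((congrArg Sum.inl e).trans (hf j).symm))
    exact Sum.inl_injective this
  have hsurj : Function.Surjective f := by
    intro j
    obtain ⟨i, hi⟩ := ρ.equiv.surjective (Sum.inl j)
    rcases i with i | i
    · exact ⟨i, Sum.inl_injective ((hf i).symm.trans hi)⟩
    · have := h.symm.trans hi
      cases this
  refine ⟨?_, ?_, ⟨Equiv.ofBijective f ⟨hinj, hsurj⟩, fun i => ?_, fun i => ?_⟩, ?_⟩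
  · have := ρ.side_eq (Sum.inr ())
    rw [h] at this
    exact this.symm
  · have := ρ.obj_eq (Sum.inr ())
    rw [h] at this
    exact this.symm
  · have := ρ.side_eq (Sum.inl i)
    rw [hf] at this
    exact this
  · have := ρ.obj_eq (Sum.inl i)
    rw [hf] at this
    exact this
  · rintro (i | i)
    · exact hf i
    · exact h

/-- An isomorphism between sequents with a distinguished last channel either matches the two last
channels, or it exchanges them up to isomorphisms of the rest. -/
theorem split {S S' : Sequent C} {s t : Side} {x z : C} (ρ : Iso (S' ⊹ one t z) (S ⊹ one s x)) :
    (t = s ∧ z = x ∧ ∃ ρ' : Iso S' S, ∀ i, ρ.equiv i = Sum.map ρ'.equiv _root_.id i) ∨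
      ∃ (U : Sequent C) (σ : Iso S' (U ⊹ one s x)) (τ : Iso (U ⊹ one t z) S),
        ρ = ((σ.app (refl (one t z))).trans (exch U (one s x) (one t z))).trans
          (τ.app (refl (one s x))) := by
  rcases e : ρ.equiv (Sum.inr ()) with β | β
  · right
    have hs : S.side β = t := by
      have := ρ.side_eq (Sum.inr ())
      rw [e] at this
      exact this
    have ho : S.obj β = z := by
      have := ρ.obj_eq (Sum.inr ())
      rw [e] at this
      exact this
    subst hs
    let τ := join S β ho
    let κ : Iso (S.erase β ⊹ one s x ⊹ one (S.side β) z) (S ⊹ one s x) :=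
      (exch (S.erase β) (one s x) (one (S.side β) z)).trans (τ.app (refl (one s x)))
    have hκ : κ.equiv (Sum.inr ()) = Sum.inl β := rfl
    obtain ⟨-, -, σ, hσ⟩ := app_refl_of_inr (ρ.trans κ.symm) (by
      exact (congrArg κ.equiv.symm (e.trans hκ.symm)).trans (κ.equiv.symm_apply_apply _))
    refine ⟨S.erase β, σ, τ, eq_of fun i => ?_⟩
    have h := congrArg κ.equiv (hσ i)
    have h' : κ.equiv ((ρ.trans κ.symm).equiv i) = ρ.equiv i := κ.equiv.apply_symm_apply _
    rw [← h', h]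
    rcases i with i | i <;> rfl
  · left
    exact app_refl_of_inr ρ e

end Iso

end Sequent

/-- The structure of the sequent calculus `ΣΠ` over `A` on a polycategory `P`: the objects of `P`
are freely generated from those of `A` by finite sums (`inp .dom`) and products (`inp .cod`), and
the polymorphisms are generated, under cut and renaming, by axioms, (co)tuples (`tuple`) and
projections and injections (`send`), subject to conversions. The permuting conversions that involve
`tuple` are not listed: they follow from the other laws, by which (co)tuples are invertible. -/
structure Calculus (A : Polycategory.{u, v}) (P : Polycategory.{u', v'}) where
  atom : A.Obj → P.Obj
  inp : ∀ (_ : Side) {n : ℕ} (_ : Fin n → P.Obj), P.Obj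
  atom_injective : Function.Injective atom
  atom_ne_inp : ∀ (a : A.Obj) (s : Side) {n : ℕ} (X : Fin n → P.Obj), atom a ≠ inp s X
  inp_injective : ∀ {s t : Side} {m n : ℕ} {X : Fin m → P.Obj} {Y : Fin n → P.Obj},
    inp s X = inp t Y →
      (⟨s, m, X⟩ : Σ (_ : Side) (n : ℕ), Fin n → P.Obj) = ⟨t, n, Y⟩
  obj_induction : ∀ {p : P.Obj → Prop}, (∀ a, p (atom a)) →
    (∀ (s : Side) {n : ℕ} (X : Fin n → P.Obj), (∀ i, p (X i)) → p (inp s X)) → ∀ x, p x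
  size : P.Obj → ℕ
  size_lt : ∀ (s : Side) {n : ℕ} (X : Fin n → P.Obj) (k : Fin n), size (X k) < size (inp s X)
  ax : ∀ {S : Sequent A.Obj}, A.Hom S → P.Hom (S.map atom)
  tuple : ∀ (s : Side) {S : Sequent P.Obj} {n : ℕ} {X : Fin n → P.Obj},
    (∀ i, P.Hom (S ⊹ one s (X i))) → P.Hom (S ⊹ one s (inp s X))
  send : ∀ (s : Side) {S : Sequent P.Obj} {n : ℕ} {X : Fin n → P.Obj} (k : Fin n),
    P.Hom (S ⊹ one s (X k)) → P.Hom (S ⊹ one s (inp s.op X))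
  hom_induction : ∀ {p : ∀ {S : Sequent P.Obj}, P.Hom S → Prop},
    (∀ {S : Sequent A.Obj} (f : A.Hom S), p (ax f)) →
    (∀ {S T : Sequent P.Obj} {x : P.Obj} (f : P.Hom (S ⊹ one .cod x))
      (g : P.Hom (T ⊹ one .dom x)), p f → p g → p (P.cut f g)) →
    (∀ {S T : Sequent P.Obj} (σ : Iso S T) (f : P.Hom S), p f → p (P.rename σ f)) →
    (∀ (s : Side) {S : Sequent P.Obj} {n : ℕ} {X : Fin n → P.Obj}
      (f : ∀ i, P.Hom (S ⊹ one s (X i))), (∀ i, p (f i)) → p (tuple s f)) →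
    (∀ (s : Side) {S : Sequent P.Obj} {n : ℕ} {X : Fin n → P.Obj} (k : Fin n)
      (f : P.Hom (S ⊹ one s (X k))), p f → p (send s (X := X) k f)) →
    ∀ {S : Sequent P.Obj} (f : P.Hom S), p f
  rename_ax : ∀ {S T : Sequent A.Obj} (σ : Iso S T) (f : A.Hom S),
    P.rename (σ.map atom) (ax f) = ax (A.rename σ f)
  cut_ax : ∀ {S T : Sequent A.Obj} {a : A.Obj} (f : A.Hom (S ⊹ one .cod a))
    (g : A.Hom (T ⊹ one .dom a)),
    P.cut (P.rename (Iso.mapOne atom S .cod a) (ax f))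
        (P.rename (Iso.mapOne atom T .dom a) (ax g)) =
      P.rename (Iso.mapApp atom S T) (ax (A.cut f g))
  rename_tuple : ∀ (s : Side) {S T : Sequent P.Obj} (σ : Iso S T) {n : ℕ} {X : Fin n → P.Obj}
    (f : ∀ i, P.Hom (S ⊹ one s (X i))),
    P.rename (σ.app (Iso.refl _)) (tuple s f) =
      tuple s fun i => P.rename (σ.app (Iso.refl _)) (f i)
  rename_send : ∀ (s : Side) {S T : Sequent P.Obj} (σ : Iso S T) {n : ℕ} {X : Fin n → P.Obj}
    (k : Fin n) (f : P.Hom (S ⊹ one s (X k))),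
    P.rename (σ.app (Iso.refl _)) (send s (X := X) k f) =
      send s k (P.rename (σ.app (Iso.refl _)) f)
  tuple_cut : ∀ (s t : Side) {S T : Sequent P.Obj} {z : P.Obj} {n : ℕ} {X : Fin n → P.Obj}
    (f : ∀ i, P.Hom (S ⊹ one t z ⊹ one s (X i))) (g : P.Hom (T ⊹ one t.op z)),
    P.cutAt t (P.rename (Iso.exch _ _ _) (tuple s f)) g =
      P.rename (Iso.exch _ _ _) (tuple s fun i =>
        P.rename (Iso.exch _ _ _) (P.cutAt t (P.rename (Iso.exch _ _ _) (f i)) g))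
  send_cut : ∀ (s t : Side) {S T : Sequent P.Obj} {z : P.Obj} {n : ℕ} {X : Fin n → P.Obj}
    (k : Fin n) (f : P.Hom (S ⊹ one t z ⊹ one s (X k))) (g : P.Hom (T ⊹ one t.op z)),
    P.cutAt t (P.rename (Iso.exch _ _ _) (send s (X := X) k f)) g =
      P.rename (Iso.exch _ _ _) (send s (X := X) k
        (P.rename (Iso.exch _ _ _) (P.cutAt t (P.rename (Iso.exch _ _ _) f) g)))
  send_cut_tuple : ∀ (s : Side) {S T : Sequent P.Obj} {n : ℕ} {X : Fin n → P.Obj} (k : Fin n)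
    (f : P.Hom (S ⊹ one s (X k))) (g : ∀ i, P.Hom (T ⊹ one s.op (X i))),
    P.cutAt s (send s k f) (tuple s.op g) = P.cutAt s f (g k)
  send_send : ∀ (s t : Side) {S : Sequent P.Obj} {m n : ℕ} {X : Fin m → P.Obj}
    {Y : Fin n → P.Obj} (k : Fin m) (l : Fin n) (f : P.Hom (S ⊹ one s (X k) ⊹ one t (Y l))),
    P.rename (Iso.exch _ _ _)
        (send s (X := X) k (P.rename (Iso.exch _ _ _) (send t (X := Y) l f))) =
      send t (X := Y) l (P.rename (Iso.exch _ _ _)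
        (send s (X := X) k (P.rename (Iso.exch _ _ _) f)))
  tuple_send_id : ∀ (s : Side) {n : ℕ} (X : Fin n → P.Obj),
    (tuple s.op fun i => P.rename (Iso.comm _ _)
      (send s (X := X) i (P.rename (Iso.comm _ _) (P.idAt s (X i))))) =
      P.idAt s (inp s.op X)

namespace SigmaPi

variable {A : Polycategory.{u, v}}

/-- The axiom given by a polymorphism of `A`. -/
def ax {S : Sequent A.Obj} (f : A.Hom S) : (SigmaPi A).Hom (S.map Formula.atom) :=
  Quotient.mk _ (Deriv.ax f)

/-- The (co)tuple rule on classes of derivations. -/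
noncomputable def tuple (s : Side) {S : Sequent (Formula A.Obj)} {n : ℕ}
    {X : Fin n → Formula A.Obj} (f : ∀ i, (SigmaPi A).Hom (S ⊹ one s (X i))) :
    (SigmaPi A).Hom (S ⊹ one s (Formula.inp s X)) :=
  Quotient.mk _ (Deriv.tuple s fun i => (f i).out)

/-- The projection and injection rules on classes of derivations. -/
def send (s : Side) {S : Sequent (Formula A.Obj)} {n : ℕ} {X : Fin n → Formula A.Obj} (k : Fin n)
    (f : (SigmaPi A).Hom (S ⊹ one s (X k))) : (SigmaPi A).Hom (S ⊹ one s (Formula.out s X)) :=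
  Quotient.map (Deriv.send s k) (fun _ _ h => .congr_send s k h) f

theorem tuple_mk (s : Side) {S : Sequent (Formula A.Obj)} {n : ℕ} {X : Fin n → Formula A.Obj}
    (f : ∀ i, Deriv A (S ⊹ one s (X i))) :
    tuple s (fun i => Quotient.mk (Deriv.setoid A _) (f i)) =
      Quotient.mk (Deriv.setoid A _) (Deriv.tuple s f) :=
  Quotient.sound (Deriv.Rel.congr_tuple s fun i => Quotient.mk_out (s := Deriv.setoid A _) (f i))

theorem exists_mk {S : Sequent (Formula A.Obj)} {n : ℕ} {s : Side} {X : Fin n → Formula A.Obj}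
    (f : ∀ i, (SigmaPi A).Hom (S ⊹ one s (X i))) :
    ∃ g : ∀ i, Deriv A (S ⊹ one s (X i)), f = fun i => Quotient.mk (Deriv.setoid A _) (g i) :=
  ⟨fun i => (f i).out, funext fun i => (Quotient.out_eq (f i)).symm⟩

theorem mk_cutAt (s : Side) {S T : Sequent (Formula A.Obj)} {x : Formula A.Obj}
    (f : Deriv A (S ⊹ one s x)) (g : Deriv A (T ⊹ one s.op x)) :
    (SigmaPi A).cutAt s (Quotient.mk (Deriv.setoid A _) f) (Quotient.mk (Deriv.setoid A _) g) =
      Quotient.mk (Deriv.setoid A _) (Deriv.cutAt s f g) := by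
  cases s <;> rfl

theorem rename_ax {S T : Sequent A.Obj} (σ : Iso S T) (f : A.Hom S) :
    (SigmaPi A).rename (σ.map Formula.atom) (ax f) = ax (A.rename σ f) :=
  Quotient.sound (Deriv.Rel.rename_ax σ f)

theorem cut_ax {S T : Sequent A.Obj} {a : A.Obj} (f : A.Hom (S ⊹ one .cod a))
    (g : A.Hom (T ⊹ one .dom a)) :
    (SigmaPi A).cut ((SigmaPi A).rename (Iso.mapOne Formula.atom S .cod a) (ax f))
        ((SigmaPi A).rename (Iso.mapOne Formula.atom T .dom a) (ax g)) =
      (SigmaPi A).rename (Iso.mapApp Formula.atom S T) (ax (A.cut f g)) :=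
  Quotient.sound (Deriv.Rel.cut_ax f g)

theorem rename_tuple (s : Side) {S T : Sequent (Formula A.Obj)} (σ : Iso S T) {n : ℕ}
    {X : Fin n → Formula A.Obj} (f : ∀ i, (SigmaPi A).Hom (S ⊹ one s (X i))) :
    (SigmaPi A).rename (σ.app (Iso.refl _)) (tuple s f) =
      tuple s fun i => (SigmaPi A).rename (σ.app (Iso.refl _)) (f i) := by
  obtain ⟨f, rfl⟩ := exists_mk f
  exact (congrArg _ (tuple_mk s f)).trans
    ((Quotient.sound (Deriv.Rel.rename_tuple s σ f)).trans (tuple_mk s _).symm)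

theorem rename_send (s : Side) {S T : Sequent (Formula A.Obj)} (σ : Iso S T) {n : ℕ}
    {X : Fin n → Formula A.Obj} (k : Fin n) (f : (SigmaPi A).Hom (S ⊹ one s (X k))) :
    (SigmaPi A).rename (σ.app (Iso.refl _)) (send s (X := X) k f) =
      send s k ((SigmaPi A).rename (σ.app (Iso.refl _)) f) := by
  obtain ⟨f⟩ := f
  exact Quotient.sound (Deriv.Rel.rename_send s σ k f)

theorem tuple_cut (s t : Side) {S T : Sequent (Formula A.Obj)} {z : Formula A.Obj} {n : ℕ}
    {X : Fin n → Formula A.Obj} (f : ∀ i, (SigmaPi A).Hom (S ⊹ one t z ⊹ one s (X i)))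
    (g : (SigmaPi A).Hom (T ⊹ one t.op z)) :
    (SigmaPi A).cutAt t ((SigmaPi A).rename (Iso.exch _ _ _) (tuple s f)) g =
      (SigmaPi A).rename (Iso.exch _ _ _) (tuple s fun i =>
        (SigmaPi A).rename (Iso.exch _ _ _)
          ((SigmaPi A).cutAt t ((SigmaPi A).rename (Iso.exch _ _ _) (f i)) g)) := by
  obtain ⟨f, rfl⟩ := exists_mk f
  obtain ⟨g⟩ := g
  refine ((congrArg (fun h => (SigmaPi A).cutAt t ((SigmaPi A).rename (Iso.exch _ _ _) h) _)
    (tuple_mk s f)).trans (mk_cutAt t _ g)).trans ?_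
  refine (Quotient.sound (Deriv.Rel.tuple_cut s t f g)).trans ?_
  change (SigmaPi A).rename (Iso.exch S T (one s (Formula.inp s X)))
    (Quotient.mk (Deriv.setoid A _) (Deriv.tuple s _)) = _
  refine congrArg ((SigmaPi A).rename (Iso.exch S T (one s (Formula.inp s X)))) ?_
  refine (tuple_mk s _).symm.trans (congrArg (tuple s) (funext fun i => ?_))
  exact congrArg ((SigmaPi A).rename (Iso.exch S (one s (X i)) T)) (mk_cutAt t _ g).symm

theorem send_cut (s t : Side) {S T : Sequent (Formula A.Obj)} {z : Formula A.Obj} {n : ℕ}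
    {X : Fin n → Formula A.Obj} (k : Fin n)
    (f : (SigmaPi A).Hom (S ⊹ one t z ⊹ one s (X k)))
    (g : (SigmaPi A).Hom (T ⊹ one t.op z)) :
    (SigmaPi A).cutAt t ((SigmaPi A).rename (Iso.exch _ _ _) (send s (X := X) k f)) g =
      (SigmaPi A).rename (Iso.exch _ _ _) (send s (X := X) k
        ((SigmaPi A).rename (Iso.exch _ _ _)
          ((SigmaPi A).cutAt t ((SigmaPi A).rename (Iso.exch _ _ _) f) g))) := by
  obtain ⟨f⟩ := f
  obtain ⟨g⟩ := g
  refine (mk_cutAt t _ g).trans ((Quotient.sound (Deriv.Rel.send_cut s t k f g)).trans ?_)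
  change (SigmaPi A).rename (Iso.exch S T (one s (Formula.out s X))) (send s k
    ((SigmaPi A).rename (Iso.exch S (one s (X k)) T) (Quotient.mk (Deriv.setoid A _) _))) = _
  refine congrArg (fun h => (SigmaPi A).rename (Iso.exch S T (one s (Formula.out s X)))
    (send s k ((SigmaPi A).rename (Iso.exch S (one s (X k)) T) h))) ?_
  exact (mk_cutAt t _ g).symm

theorem send_cut_tuple (s : Side) {S T : Sequent (Formula A.Obj)} {n : ℕ}
    {X : Fin n → Formula A.Obj} (k : Fin n) (f : (SigmaPi A).Hom (S ⊹ one s (X k)))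
    (g : ∀ i, (SigmaPi A).Hom (T ⊹ one s.op (X i))) :
    (SigmaPi A).cutAt s (send s k f) (tuple s.op g) = (SigmaPi A).cutAt s f (g k) := by
  obtain ⟨f⟩ := f
  obtain ⟨g, rfl⟩ := exists_mk g
  refine (congrArg (fun h => (SigmaPi A).cutAt s _ h) (tuple_mk s.op g)).trans ?_
  exact (mk_cutAt s _ _).trans ((Quotient.sound (Deriv.Rel.send_cut_tuple s k f g)).trans
    (mk_cutAt s f (g k)).symm)

theorem send_send (s t : Side) {S : Sequent (Formula A.Obj)} {m n : ℕ}
    {X : Fin m → Formula A.Obj} {Y : Fin n → Formula A.Obj} (k : Fin m) (l : Fin n)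
    (f : (SigmaPi A).Hom (S ⊹ one s (X k) ⊹ one t (Y l))) :
    (SigmaPi A).rename (Iso.exch _ _ _)
        (send s (X := X) k ((SigmaPi A).rename (Iso.exch _ _ _) (send t (X := Y) l f))) =
      send t (X := Y) l ((SigmaPi A).rename (Iso.exch _ _ _)
        (send s (X := X) k ((SigmaPi A).rename (Iso.exch _ _ _) f))) := by
  obtain ⟨f⟩ := f
  exact Quotient.sound (Deriv.Rel.send_send s t k l f)

theorem tuple_send_id : ∀ (s : Side) {n : ℕ} (X : Fin n → Formula A.Obj),
    (tuple s.op fun i => (SigmaPi A).rename (Iso.comm _ _)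
      (send s (X := X) i ((SigmaPi A).rename (Iso.comm _ _) ((SigmaPi A).idAt s (X i))))) =
      (SigmaPi A).idAt s (Formula.out s X)
  | .dom, _, _ => tuple_mk .cod _
  | .cod, n, X => by
    refine Eq.trans (congrArg (tuple .dom) (funext fun i => congrArg _ (congrArg (send .cod i)
      ((SigmaPi A).rename_comm_comm ((SigmaPi A).id (X i)))))) ?_
    refine (tuple_mk .dom fun i => Deriv.rename
      (Iso.comm (one .dom (X i)) (one .cod (Formula.out .cod X)))
      (Deriv.send .cod (X := X) i (Deriv.ident A (X i)))).trans ?_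
    exact ((SigmaPi A).rename_comm_comm (S := one .cod (Formula.sum X))
      (T := one .dom (Formula.sum X)) (Quotient.mk (Deriv.setoid A _) (Deriv.tuple .dom _))).symm

theorem inp_injective {s t : Side} {m n : ℕ} {X : Fin m → Formula A.Obj}
    {Y : Fin n → Formula A.Obj} (h : Formula.inp s X = Formula.inp t Y) :
    (⟨s, m, X⟩ : Σ (_ : Side) (n : ℕ), Fin n → Formula A.Obj) = ⟨t, n, Y⟩ := by
  cases s <;> cases t <;> cases h <;> rfl

/-- The number of connectives in a formula, counted so that empty sums and products are
not of size zero. -/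
def size : Formula A.Obj → ℕ
  | .atom _ => 0
  | .sum X => 1 + ∑ i, size (X i)
  | .prod X => 1 + ∑ i, size (X i)

/-- The calculus `ΣΠ_A`. -/
noncomputable def calculus (A : Polycategory.{u, v}) : Calculus A (SigmaPi A) where
  atom := Formula.atom
  inp := Formula.inp
  atom_injective := fun _ _ h => Formula.atom.inj h
  atom_ne_inp := fun a s n X h => by cases s <;> cases h
  inp_injective := inp_injective
  obj_induction := fun {p} h₁ h₂ x => by
    induction x with
    | atom a => exact h₁ a
    | sum X ih => exact h₂ .dom X ih
    | prod X ih => exact h₂ .cod X ih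
  size := size
  size_lt := fun s n X k => by
    have h := Finset.single_le_sum (f := fun i => size (X i)) (fun _ _ => Nat.zero_le _)
      (Finset.mem_univ k)
    cases s <;> exact Nat.lt_one_add_iff.2 h
  ax := ax
  tuple := tuple
  send := send
  hom_induction := fun {p} h₁ h₂ h₃ h₄ h₅ S f => by
    refine Quotient.inductionOn f fun g => ?_
    clear f
    induction g with
    | ax f => exact h₁ f
    | cut f g hf hg => exact h₂ _ _ hf hg
    | rename σ f hf => exact h₃ σ _ hf
    | tuple s f hf =>
      have h := h₄ s (fun i => Quotient.mk (Deriv.setoid A _) (f i)) hf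
      rw [tuple_mk] at h
      exact h
    | send s k f hf => exact h₅ s k _ hf
  rename_ax := rename_ax
  cut_ax := cut_ax
  rename_tuple := rename_tuple
  rename_send := rename_send
  tuple_cut := tuple_cut
  send_cut := send_cut
  send_cut_tuple := send_cut_tuple
  send_send := send_send
  tuple_send_id := tuple_send_id

end SigmaPi

namespace Calculus

variable {A : Polycategory.{u, v}} {P : Polycategory.{u', v'}} (K : Calculus A P)

/-- `tuple_cut` where the components of the tuple have one further channel. -/
theorem tuple_cut_two (s t : Side) {T : Sequent P.Obj} {z : P.Obj} {n : ℕ}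
    {X : Fin n → P.Obj} (f : ∀ i, P.Hom (one t z ⊹ one s (X i)))
    (g : P.Hom (T ⊹ one t.op z)) :
    P.cutAt t (P.rename (Iso.comm _ _) (K.tuple s f)) g =
      P.rename (Iso.comm _ _) (K.tuple s fun i =>
        P.rename (Iso.comm _ _)
          (P.cutAt t (P.rename (Iso.comm _ _) (f i)) g)) := by
  have key := K.tuple_cut s t
    (fun i => P.rename ((Iso.nilApp (one t z)).symm.app (Iso.refl (one s (X i)))) (f i)) g
  rw [← K.rename_tuple, P.rename_rename] at key
  have e : ∀ (x : P.Obj) (f : P.Hom (one t z ⊹ one s x)),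
      P.cutAt t (P.rename (((Iso.nilApp (one t z)).symm.app (Iso.refl (one s x))).trans
        (Iso.exch nil (one t z) (one s x))) f) g =
      P.rename ((Iso.nilApp (one s x)).symm.app (Iso.refl T))
        (P.cutAt t (P.rename (Iso.comm _ _) f) g) := by
    intro x f
    rw [P.rename_cutAt_left, P.rename_rename]
    congr 1
    exact P.rename_congr _ (by rintro (i | i) <;> rfl)
  simp only [P.rename_rename, e] at key
  have e' : ∀ i, P.rename (((Iso.nilApp (one s (X i))).symm.app (Iso.refl T)).trans
        (Iso.exch nil (one s (X i)) T)) (P.cutAt t (P.rename (Iso.comm _ _) (f i)) g) =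
      P.rename ((Iso.nilApp T).symm.app (Iso.refl _))
        (P.rename (Iso.comm _ _) (P.cutAt t (P.rename (Iso.comm _ _) (f i)) g)) := by
    intro i
    rw [P.rename_rename]
    exact P.rename_congr _ (by rintro (i | i) <;> rfl)
  simp only [e', ← K.rename_tuple] at key
  have key' := congrArg (P.rename ((Iso.nilApp (one s (K.inp s X))).app (Iso.refl T))) key
  rw [P.rename_rename, P.rename_rename, P.rename_rename, P.rename_id] at key'
  · rw [key']
    exact P.rename_congr _ (by rintro (i | i) <;> rfl)
  · rintro (i | i) <;> rfl

/-- A polymorphism with a channel of compound type is its own cut with an identity, which is a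
(co)tuple. -/
theorem tuple_surjective_aux (s : Side) {S : Sequent P.Obj} {n : ℕ}
    {X : Fin n → P.Obj} (h : P.Hom (S ⊹ one s.op (K.inp s.op X))) :
    ∃ f, h = K.tuple s.op f := by
  have key := P.idAt_cutAt s h
  rw [← K.tuple_send_id, K.tuple_cut_two, P.rename_comm_comm] at key
  exact ⟨_, key.symm⟩

theorem tuple_surjective (s : Side) {S : Sequent P.Obj} {n : ℕ}
    {X : Fin n → P.Obj} (h : P.Hom (S ⊹ one s (K.inp s X))) :
    ∃ f, h = K.tuple s f := by
  cases s
  · exact K.tuple_surjective_aux .cod h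
  · exact K.tuple_surjective_aux .dom h

end Calculus

/-! ### Cut elimination -/

theorem Side.op_ne (s : Side) : s.op ≠ s := by cases s <;> exact Side.noConfusion

namespace Sequent.Iso

variable {C : Type u}

/-- Rewriting of the side and the type of the last channel. -/
def last (S : Sequent C) {s t : Side} {x y : C} (hs : s = t) (hx : x = y) :
    Iso (S ⊹ one s x) (S ⊹ one t y) where
  equiv := Equiv.refl _
  side_eq := by subst hs; exact fun _ => rfl
  obj_eq := by
    subst hx
    rintro (i | i) <;> rfl

end Sequent.Iso

namespace Calculus

variable {A : Polycategory.{u, v}} {P : Polycategory.{u', v'}} (K : Calculus A P)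

/-- The polymorphisms that have a derivation without cut, up to renaming of channels. -/
inductive CutFree : ∀ {R : Sequent P.Obj}, P.Hom R → Prop
  | ax {S : Sequent A.Obj} {R : Sequent P.Obj} (σ : Iso (S.map K.atom) R) (f : A.Hom S) :
      CutFree (P.rename σ (K.ax f))
  | tuple (s : Side) {S R : Sequent P.Obj} {n : ℕ} {X : Fin n → P.Obj}
      (σ : Iso (S ⊹ one s (K.inp s X)) R) (f : ∀ i, P.Hom (S ⊹ one s (X i))) :
      (∀ i, CutFree (f i)) → CutFree (P.rename σ (K.tuple s f))
  | send (s : Side) {S R : Sequent P.Obj} {n : ℕ} {X : Fin n → P.Obj}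
      (σ : Iso (S ⊹ one s (K.inp s.op X)) R) (k : Fin n) (f : P.Hom (S ⊹ one s (X k))) :
      CutFree f → CutFree (P.rename σ (K.send s (X := X) k f))

/-- The polymorphisms that have a cut-free derivation whose last rule acts on the last channel. -/
inductive Principal : ∀ {S : Sequent P.Obj} {s : Side} {x : P.Obj}, P.Hom (S ⊹ one s x) → Prop
  | ax {S : Sequent A.Obj} {s : Side} {a : A.Obj} (f : A.Hom (S ⊹ one s a)) :
      Principal (P.rename (Iso.mapOne K.atom S s a) (K.ax f))
  | tuple (s : Side) {S : Sequent P.Obj} {n : ℕ} {X : Fin n → P.Obj}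
      (f : ∀ i, P.Hom (S ⊹ one s (X i))) :
      (∀ i, K.CutFree (f i)) → Principal (K.tuple s f)
  | send (s : Side) {S : Sequent P.Obj} {n : ℕ} {X : Fin n → P.Obj}
      (k : Fin n) (f : P.Hom (S ⊹ one s (X k))) :
      K.CutFree f → Principal (K.send s (X := X) k f)

variable {K}

theorem CutFree.rename {R T : Sequent P.Obj} {f : P.Hom R} (hf : K.CutFree f) (σ : Iso R T) :
    K.CutFree (P.rename σ f) := by
  cases hf with
  | ax τ f => rw [P.rename_rename]; exact .ax _ f
  | tuple s τ f h => rw [P.rename_rename]; exact .tuple s _ f h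
  | send s τ k f h => rw [P.rename_rename]; exact .send s _ k f h

theorem CutFree.of_rename {R T : Sequent P.Obj} {f : P.Hom R} (σ : Iso R T)
    (h : K.CutFree (P.rename σ f)) : K.CutFree f := by
  have := h.rename σ.symm
  rwa [P.rename_rename, P.rename_id] at this
  exact fun i => σ.equiv.symm_apply_apply i

theorem CutFree.of_tuple (s : Side) {S : Sequent P.Obj} {n : ℕ} {X : Fin n → P.Obj}
    (f : ∀ i, P.Hom (S ⊹ one s (X i))) (h : ∀ i, K.CutFree (f i)) : K.CutFree (K.tuple s f) := by
  rw [← P.rename_refl (K.tuple s f)]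
  exact .tuple s _ f h

theorem CutFree.of_send (s : Side) {S : Sequent P.Obj} {n : ℕ} {X : Fin n → P.Obj}
    (k : Fin n) (f : P.Hom (S ⊹ one s (X k))) (h : K.CutFree f) :
    K.CutFree (K.send s (X := X) k f) := by
  rw [← P.rename_refl (K.send s (X := X) k f)]
  exact .send s _ k f h

/-- Any channel of an axiom may be taken as its last channel. -/
theorem exists_rename_ax {s : Side} {x : P.Obj} {S : Sequent P.Obj} {R : Sequent A.Obj}
    (ρ : Iso (R.map K.atom) (S ⊹ one s x)) (f : A.Hom R) :
    ∃ (a : A.Obj) (hx : K.atom a = x) (U : Sequent A.Obj) (g : A.Hom (U ⊹ one s a))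
      (σ : Iso (U.map K.atom) S), P.rename ρ (K.ax f) =
        P.rename (Iso.last S rfl hx) (P.rename (σ.app (Iso.refl _))
          (P.rename (Iso.mapOne K.atom U s a) (K.ax g))) := by
  obtain ⟨α, hα⟩ : ∃ α, ρ.equiv α = Sum.inr () := ρ.equiv.surjective _
  have hx : K.atom (R.obj α) = x := by
    have := ρ.obj_eq α
    rw [hα] at this
    exact this.symm
  have hs : R.side α = s := by
    have := ρ.side_eq α
    rw [hα] at this
    exact this.symm
  subst hx hs
  let j := Iso.join R α rfl
  obtain ⟨-, -, σ, hσ⟩ := Iso.app_refl_of_inr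
    ((Iso.mapOne K.atom (R.erase α) (R.side α) (R.obj α)).symm.trans ((j.map K.atom).trans ρ)) hα
  refine ⟨R.obj α, rfl, R.erase α, A.rename j.symm f, σ, ?_⟩
  rw [← K.rename_ax, P.rename_rename, P.rename_rename, P.rename_rename]
  refine P.rename_congr _ fun i => ?_
  obtain ⟨i, rfl⟩ := j.equiv.surjective i
  refine (hσ i).trans ?_
  change _ = Sum.map σ.equiv _root_.id (j.equiv.symm (j.equiv i))
  rw [Equiv.symm_apply_apply]
  rfl

/-- To eliminate a cut, one may assume that the last rule of the first derivation acts on the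
channel that is cut: all other rules can be permuted with the cut. -/
theorem CutFree.cutAt_left {s : Side} {x : P.Obj} {T : Sequent P.Obj} {g : P.Hom (T ⊹ one s.op x)}
    (H : ∀ {S : Sequent P.Obj} (f : P.Hom (S ⊹ one s x)), K.Principal f →
      K.CutFree (P.cutAt s f g)) {R : Sequent P.Obj} {f : P.Hom R} (hf : K.CutFree f) :
    ∀ {S : Sequent P.Obj} (σ : Iso R (S ⊹ one s x)), K.CutFree (P.cutAt s (P.rename σ f) g) := by
  induction hf with
  | ax τ f =>
    intro S σ
    rw [P.rename_rename]
    obtain ⟨a, rfl, U, f', ρ, e⟩ := K.exists_rename_ax (τ.trans σ) f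
    rw [e, P.rename_id _ (fun _ => rfl), ← P.rename_cutAt_left]
    exact (H _ (.ax f')).rename _
  | tuple t τ f hf ih =>
    intro S σ
    rw [P.rename_rename]
    rcases Iso.split (τ.trans σ) with ⟨rfl, rfl, ρ, hρ⟩ | ⟨U, ρ, κ, e⟩
    · rw [P.rename_congr (τ := ρ.app (Iso.refl _)) _ hρ, ← P.rename_cutAt_left]
      exact (H _ (.tuple _ f hf)).rename _
    · rw [e, P.rename_trans, P.rename_trans, K.rename_tuple, ← P.rename_cutAt_left, K.tuple_cut]
      refine CutFree.rename (CutFree.rename (.of_tuple _ _ fun i => CutFree.rename ?_ _) _) _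
      rw [P.rename_rename]
      exact ih i _
  | send t τ k f hf ih =>
    intro S σ
    rw [P.rename_rename]
    rcases Iso.split (τ.trans σ) with ⟨rfl, rfl, ρ, hρ⟩ | ⟨U, ρ, κ, e⟩
    · rw [P.rename_congr (τ := ρ.app (Iso.refl _)) _ hρ, ← P.rename_cutAt_left]
      exact (H _ (.send _ k f hf)).rename _
    · rw [e, P.rename_trans, P.rename_trans, K.rename_send, ← P.rename_cutAt_left, K.send_cut]
      refine CutFree.rename (CutFree.rename (.of_send _ _ _ (CutFree.rename ?_ _)) _) _
      rw [P.rename_rename]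
      exact ih _

/-- The counterpart of `CutFree.cutAt_left` for the second derivation. -/
theorem CutFree.cutAt_right {s : Side} {x : P.Obj} {S T : Sequent P.Obj} {f : P.Hom (S ⊹ one s x)}
    (H : ∀ {T : Sequent P.Obj} (g : P.Hom (T ⊹ one s.op x)), K.Principal g →
      K.CutFree (P.cutAt s f g)) {g : P.Hom (T ⊹ one s.op x)} (hg : K.CutFree g) :
    K.CutFree (P.cutAt s f g) := by
  rw [← P.rename_refl g]
  cases s
  · exact (CutFree.cutAt_left (s := .cod) (g := f) (fun h hh => (H h hh).of_rename _) hg _).rename _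
  · refine Eq.mpr (congrArg K.CutFree (P.cutAt_cod f _)) ?_
    refine (CutFree.cutAt_left (s := .dom) (g := f) (fun h hh => ?_) hg _).rename _
    exact (Eq.mp (congrArg K.CutFree (P.cutAt_cod f h)) (H h hh)).of_rename _

/-- The essential cases of cut elimination: an axiom meets an axiom, or a (co)tuple meets a
projection or an injection. -/
theorem Principal.cutAt {s : Side} {x : P.Obj}
    (ih : ∀ (t : Side) {n : ℕ} (X : Fin n → P.Obj), x = K.inp t X → ∀ (i : Fin n) (s : Side)
      {S T : Sequent P.Obj} {f : P.Hom (S ⊹ one s (X i))} {g : P.Hom (T ⊹ one s.op (X i))},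
      K.CutFree f → K.CutFree g → K.CutFree (P.cutAt s f g))
    {S T : Sequent P.Obj} {f : P.Hom (S ⊹ one s x)} (hf : K.Principal f) {t : Side} {y : P.Obj}
    {g : P.Hom (T ⊹ one t y)} (hg : K.Principal g) (ht : t = s.op) (hy : y = x) :
    K.CutFree (P.cutAt s f (P.rename (Iso.last T ht hy) g)) := by
  cases hf with
  | ax f =>
    cases hg with
    | ax g =>
      subst ht
      obtain rfl := K.atom_injective hy
      rw [P.rename_id _ (fun _ => rfl)]
      cases s
      · change K.CutFree (P.rename _ (P.cut _ _))
        erw [K.cut_ax]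
        exact (CutFree.ax _ _).rename _
      · change K.CutFree (P.cut _ _)
        erw [K.cut_ax]
        exact .ax _ _
    | tuple t g h => exact absurd hy.symm (K.atom_ne_inp _ _ _)
    | send t k g h => exact absurd hy.symm (K.atom_ne_inp _ _ _)
  | tuple s f h =>
    cases hg with
    | ax g => exact absurd hy (K.atom_ne_inp _ _ _)
    | tuple t g h' =>
      subst ht
      have := congrArg Sigma.fst (K.inp_injective hy)
      exact absurd this (Side.op_ne _)
    | send t k g h' =>
      subst ht
      have e := K.inp_injective hy
      cases s
      · cases e
        refine Eq.mpr (congrArg (fun h => K.CutFree (P.cutAt .dom (K.tuple .dom f) h))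
          (P.rename_id (K.send .cod k g) fun _ => rfl)) ?_
        refine CutFree.rename (Eq.mpr (congrArg K.CutFree (K.send_cut_tuple .cod k g f)) ?_) _
        exact ih _ _ rfl k .cod h' (h k)
      · cases e
        refine Eq.mpr (congrArg (fun h => K.CutFree (P.cutAt .cod (K.tuple .cod f) h))
          (P.rename_id (K.send .dom k g) fun _ => rfl)) ?_
        refine Eq.mpr (congrArg K.CutFree (P.cutAt_cod (K.tuple .cod f) (K.send .dom k g))) ?_
        refine CutFree.rename (Eq.mpr (congrArg K.CutFree (K.send_cut_tuple .dom k g f)) ?_) _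
        exact ih _ _ rfl k .dom h' (h k)
  | send s k f h =>
    cases hg with
    | ax g => exact absurd hy (K.atom_ne_inp _ _ _)
    | tuple t g h' =>
      subst ht
      cases K.inp_injective hy
      rw [P.rename_id _ (fun _ => rfl), K.send_cut_tuple]
      exact ih _ _ rfl k s h (h' k)
    | send t l g h' =>
      subst ht
      have := congrArg Sigma.fst (K.inp_injective hy)
      exact absurd this (Side.op_ne _)

/-- Cuts between cut-free derivations can be eliminated, by induction on the cut formula. -/
theorem CutFree.cutAt (x : P.Obj) : ∀ (s : Side) {S T : Sequent P.Obj}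
    {f : P.Hom (S ⊹ one s x)} {g : P.Hom (T ⊹ one s.op x)},
    K.CutFree f → K.CutFree g → K.CutFree (P.cutAt s f g) := by
  have main : ∀ (x : P.Obj), (∀ (t : Side) {n : ℕ} (X : Fin n → P.Obj), x = K.inp t X →
      ∀ (i : Fin n) (s : Side) {S T : Sequent P.Obj} {f : P.Hom (S ⊹ one s (X i))}
        {g : P.Hom (T ⊹ one s.op (X i))},
        K.CutFree f → K.CutFree g → K.CutFree (P.cutAt s f g)) →
      ∀ (s : Side) {S T : Sequent P.Obj} {f : P.Hom (S ⊹ one s x)} {g : P.Hom (T ⊹ one s.op x)},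
        K.CutFree f → K.CutFree g → K.CutFree (P.cutAt s f g) := by
    intro x ih s S T f g hf hg
    rw [← P.rename_refl f]
    refine CutFree.cutAt_left (fun f' hf' => ?_) hf _
    refine CutFree.cutAt_right (fun g' hg' => ?_) hg
    have := hf'.cutAt ih hg' rfl rfl
    rwa [P.rename_id _ (fun _ => rfl)] at this
  refine K.obj_induction (p := fun x => ∀ (s : Side) {S T : Sequent P.Obj}
    {f : P.Hom (S ⊹ one s x)} {g : P.Hom (T ⊹ one s.op x)},
    K.CutFree f → K.CutFree g → K.CutFree (P.cutAt s f g))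
    (fun a => main _ fun t n X h => absurd h (K.atom_ne_inp _ _ _))
    (fun t n X h => main _ fun t' n' X' e => ?_) x
  cases K.inp_injective e
  exact fun i => h i

variable (K)

/-- Cut elimination. -/
theorem cutFree {R : Sequent P.Obj} (f : P.Hom R) : K.CutFree f := by
  refine K.hom_induction (p := fun f => K.CutFree f) (fun {S} f => ?_) (fun f g hf hg => ?_)
    (fun σ f hf => hf.rename σ) (fun s _ _ _ f h => .of_tuple s f h)
    (fun s _ _ _ k f h => .of_send s k f h) f
  · rw [← P.rename_refl (K.ax f)]
    exact .ax _ f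
  · exact CutFree.cutAt _ .cod hf hg

end Calculus

/-! ### Weights and introductions on arbitrary channels -/

namespace Sequent

variable {C : Type u} {D : Type v}

/-- The sum of the weights of the types of all channels. -/
noncomputable def weight (w : C → ℕ) (S : Sequent C) : ℕ :=
  ∑ᶠ i, w (S.obj i)

theorem weight_congr (w : C → ℕ) {S T : Sequent C} (σ : Iso S T) : S.weight w = T.weight w := by
  unfold weight
  rw [← finsum_comp_equiv σ.equiv]
  exact finsum_congr fun i => by rw [σ.obj_eq]

theorem weight_app_one (w : C → ℕ) (S : Sequent C) (s : Side) (x : C) :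
    (S ⊹ one s x).weight w = S.weight w + w x := by
  have := S.finite
  have := Fintype.ofFinite S.Ch
  let f : S.Ch ⊕ Unit → ℕ := fun i => w ((S ⊹ one s x).obj i)
  change ∑ᶠ i : S.Ch ⊕ Unit, f i = (∑ᶠ i, w (S.obj i)) + w x
  rw [finsum_eq_sum_of_fintype, finsum_eq_sum_of_fintype, Fintype.sum_sum_type]
  simp [f, app, one]

theorem weight_lt (w : C → ℕ) {R S : Sequent C} {s : Side} {x y : C} (σ : Iso (S ⊹ one s x) R)
    (h : w y < w x) : (S ⊹ one s y).weight w < R.weight w := by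
  rw [← weight_congr w σ, weight_app_one, weight_app_one]
  exact Nat.add_lt_add_left h _

theorem weight_set_lt (w : C → ℕ) (R : Sequent C) (α : R.Ch) {x y : C} (hx : R.obj α = x)
    (h : w y < w x) : (R.set α y).weight w < R.weight w := by
  rw [← weight_congr w (Iso.joinSet R α y)]
  exact weight_lt w (Iso.join R α hx) h

namespace Iso

/-- A sequent with the channels of `R` and possibly other types on `α` and `β` is what remains of
`R` without `α` and `β`, together with `α` and `β`. -/
noncomputable def joinTwo (R : Sequent C) {α β : R.Ch} (h : β ≠ α) (o : R.Ch → C)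
    (ho : ∀ γ, γ ≠ α → γ ≠ β → o γ = R.obj γ) {x y : C} (hx : o α = x) (hy : o β = y) :
    Iso ((R.erase α).erase ⟨β, h⟩ ⊹ one (R.side α) x ⊹ one (R.side β) y)
      ⟨R.Ch, R.finite, R.side, o⟩ where
  equiv := ((Equiv.sumAssoc _ _ _).trans (((Equiv.refl _).sumCongr (Equiv.sumComm _ _)).trans
    (Equiv.sumAssoc _ _ _).symm)).trans
      (((joinEquiv (⟨β, h⟩ : (R.erase α).Ch)).sumCongr (Equiv.refl Unit)).trans (joinEquiv α))
  side_eq := by rintro ((i | i) | i) <;> rfl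
  obj_eq := by
    rintro ((i | i) | i)
    · exact ho _ i.1.2 fun e => i.2 (Subtype.ext e)
    · exact hx
    · exact hy

end Iso

end Sequent

/-- An operation on the channel `α` that is natural in the other channels can be computed in any
presentation of the sequent with `α` as its last channel. -/
theorem Polycategory.rename_join (P : Polycategory.{u, v}) {R U : Sequent P.Obj} (α : R.Ch)
    {x y : P.Obj} (h : R.obj α = x)
    (φ : ∀ {S : Sequent P.Obj}, P.Hom (S ⊹ one (R.side α) y) → P.Hom (S ⊹ one (R.side α) x))
    (hφ : ∀ {S T : Sequent P.Obj} (σ : Iso S T) (f : P.Hom (S ⊹ one (R.side α) y)),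
      P.rename (σ.app (Iso.refl _)) (φ f) = φ (P.rename (σ.app (Iso.refl _)) f))
    (σ : Iso (U ⊹ one (R.side α) x) R) (hα : σ.equiv (Sum.inr ()) = α)
    (σ' : Iso (U ⊹ one (R.side α) y) (R.set α y)) (hσ : ∀ i, σ'.equiv i = σ.equiv i)
    (f : P.Hom (U ⊹ one (R.side α) y)) :
    P.rename (Iso.join R α h) (φ (P.rename (Iso.joinSet R α y).symm (P.rename σ' f))) =
      P.rename σ (φ f) := by
  have e : (σ.trans (Iso.join R α h).symm).equiv (Sum.inr ()) = Sum.inr () := by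
    refine (congrArg (Iso.joinEquiv α).symm hα).trans ?_
    exact (Equiv.symm_apply_eq _).2 rfl
  obtain ⟨-, -, ρ, hρ⟩ := Iso.app_refl_of_inr _ e
  have hρ' : ∀ i, (Iso.joinEquiv α).symm (σ.equiv i) = Sum.map ρ.equiv _root_.id i := hρ
  rw [P.rename_rename, P.rename_congr (τ := ρ.app (Iso.refl _)) f (fun i => ?_), ← hφ,
    P.rename_rename]
  · refine P.rename_congr _ fun i => ?_
    refine (congrArg (Iso.joinEquiv α) (hρ' i)).symm.trans ?_
    exact (Iso.joinEquiv α).apply_symm_apply _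
  · refine Eq.trans ?_ (hρ' i)
    exact congrArg (Iso.joinEquiv α).symm (hσ i)

theorem sendAt_rename {B : Polycategory.{u, v}} (S : SumsProducts B) {R U : Sequent B.Obj}
    {α : R.Ch} {n : ℕ} {X : Fin n → B.Obj} (h : R.obj α = S.out (R.side α) X) (k : Fin n)
    {s : Side} (hs : R.side α = s) (σ : Iso (U ⊹ one s (S.out s X)) R)
    (hα : σ.equiv (Sum.inr ()) = α)
    (σ' : Iso (U ⊹ one s (X k)) (R.set α (X k))) (hσ : ∀ i, σ'.equiv i = σ.equiv i)
    (f : B.Hom (U ⊹ one s (X k))) :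
    sendAt S R α h k (B.rename σ' f) = B.rename σ ((S.additive s.op X).send k f) := by
  subst hs
  exact B.rename_join α h (fun f => (S.additive (R.side α).op X).send k f)
    (fun σ f => (S.additive (R.side α).op X).rename_send σ k f) σ hα σ' hσ f

namespace Calculus

variable {A : Polycategory.{u, v}} {P : Polycategory.{u', v'}} (K : Calculus A P)

/-- The projection or injection rule on the channel `α`. -/
noncomputable def sendAt (R : Sequent P.Obj) (α : R.Ch) {n : ℕ} {X : Fin n → P.Obj}
    (h : R.obj α = K.inp (R.side α).op X) (k : Fin n) (f : P.Hom (R.set α (X k))) : P.Hom R :=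
  P.rename (Iso.join R α h) (K.send (R.side α) k (P.rename (Iso.joinSet R α (X k)).symm f))

theorem sendAt_rename {R U : Sequent P.Obj}
    {α : R.Ch} {n : ℕ} {X : Fin n → P.Obj} (h : R.obj α = K.inp (R.side α).op X) (k : Fin n)
    {s : Side} (hs : R.side α = s) (σ : Iso (U ⊹ one s (K.inp s.op X)) R)
    (hα : σ.equiv (Sum.inr ()) = α)
    (σ' : Iso (U ⊹ one s (X k)) (R.set α (X k))) (hσ : ∀ i, σ'.equiv i = σ.equiv i)
    (f : P.Hom (U ⊹ one s (X k))) :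
    K.sendAt R α h k (P.rename σ' f) = P.rename σ (K.send s k f) := by
  subst hs
  exact P.rename_join α h (fun f => K.send (R.side α) k f)
    (fun σ f => K.rename_send (R.side α) σ k f) σ hα σ' hσ f

/-- Projections and injections on distinct channels may be permuted. -/
theorem sendAt_sendAt {R : Sequent P.Obj} {α β : R.Ch} (hαβ : α ≠ β)
    {m n : ℕ} {X : Fin m → P.Obj} {Y : Fin n → P.Obj} (hX : R.obj α = K.inp (R.side α).op X)
    (hY : R.obj β = K.inp (R.side β).op Y) (k : Fin m) (l : Fin n)
    (hX' : (R.set β (Y l)).obj α = K.inp (R.side α).op X)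
    (hY' : (R.set α (X k)).obj β = K.inp (R.side β).op Y)
    (f : P.Hom ((R.set α (X k)).set β (Y l))) :
    K.sendAt R α hX k (K.sendAt (R.set α (X k)) β hY' l f) =
      K.sendAt R β hY l (K.sendAt (R.set β (Y l)) α hX' k
        (P.rename (Iso.setSet R α β hαβ (X k) (Y l)) f)) := by
  -- present all sequents with `α` and `β` as their last two channels, where `send_send` applies
  let U := (R.erase α).erase ⟨β, hαβ.symm⟩
  let σ : Iso (U ⊹ one (R.side α) (K.inp (R.side α).op X) ⊹
      one (R.side β) (K.inp (R.side β).op Y)) R :=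
    Iso.joinTwo R hαβ.symm R.obj (fun _ _ _ => rfl) hX hY
  let σα : Iso (U ⊹ one (R.side α) (X k) ⊹ one (R.side β) (K.inp (R.side β).op Y))
      (R.set α (X k)) :=
    Iso.joinTwo R hαβ.symm _ (fun _ h _ => set_obj_of_ne R h _) (set_obj_self R α _) hY'
  let σβ : Iso (U ⊹ one (R.side α) (K.inp (R.side α).op X) ⊹ one (R.side β) (Y l))
      (R.set β (Y l)) :=
    Iso.joinTwo R hαβ.symm _ (fun _ _ h => set_obj_of_ne R h _) hX' (set_obj_self R β _)
  let σαβ : Iso (U ⊹ one (R.side α) (X k) ⊹ one (R.side β) (Y l))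
      ((R.set α (X k)).set β (Y l)) :=
    Iso.joinTwo R hαβ.symm _
      (fun _ h h' => (set_obj_of_ne (R.set α (X k)) h' _).trans (set_obj_of_ne R h _))
      ((set_obj_of_ne (R.set α (X k)) hαβ _).trans (set_obj_self R α _))
      (set_obj_self (R.set α (X k)) β _)
  obtain ⟨g, rfl⟩ : ∃ g, f = P.rename σαβ g := by
    refine ⟨P.rename σαβ.symm f, ?_⟩
    rw [P.rename_rename, P.rename_id]
    exact fun i => σαβ.equiv.apply_symm_apply i
  have e₁ : P.rename σα (K.send (R.side β) l g) = P.rename ((Iso.exch _ _ _).trans σα)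
      (P.rename (Iso.exch _ _ _) (K.send (R.side β) l g)) := by
    rw [P.rename_rename]
    exact P.rename_congr _ (by rintro ((i | i) | i) <;> rfl)
  have e₂ : P.rename (Iso.setSet R α β hαβ (X k) (Y l)) (P.rename σαβ g) =
      P.rename ((Iso.exch _ _ _).trans (σαβ.trans (Iso.setSet R α β hαβ (X k) (Y l))))
        (P.rename (Iso.exch _ _ _) g) := by
    rw [P.rename_rename, P.rename_rename]
    exact P.rename_congr _ (by rintro ((i | i) | i) <;> rfl)
  have l₁ := K.sendAt_rename (R := R.set α (X k)) (α := β) hY' l rfl σα rfl σαβ (fun _ => rfl) g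
  have l₂ := K.sendAt_rename hX k rfl ((Iso.exch _ _ _).trans σ) rfl ((Iso.exch _ _ _).trans σα)
    (fun _ => rfl) (P.rename (Iso.exch _ _ _) (K.send (R.side β) l g))
  have r₁ := K.sendAt_rename (R := R.set β (Y l)) (α := α) hX' k rfl ((Iso.exch _ _ _).trans σβ)
    rfl ((Iso.exch _ _ _).trans (σαβ.trans (Iso.setSet R α β hαβ (X k) (Y l)))) (fun _ => rfl)
    (P.rename (Iso.exch _ _ _) g)
  have r₂ := K.sendAt_rename hY l rfl σ rfl σβ (fun _ => rfl)
    (P.rename (Iso.exch _ _ _) (K.send (R.side α) k (P.rename (Iso.exch _ _ _) g)))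
  refine (congrArg (K.sendAt R α hX k) (l₁.trans e₁)).trans (l₂.trans ?_)
  rw [P.rename_trans, K.send_send, ← r₂]
  refine congrArg (K.sendAt R β hY l) (Eq.trans ?_
    ((congrArg (K.sendAt (R.set β (Y l)) α hX' k) e₂).trans r₁).symm)
  exact (P.rename_trans _ _ _).symm

theorem obj_cases (x : P.Obj) :
    (∃ a, x = K.atom a) ∨ ∃ (s : Side) (n : ℕ) (X : Fin n → P.Obj), x = K.inp s X :=
  K.obj_induction (p := fun x => (∃ a, x = K.atom a) ∨
    ∃ (s : Side) (n : ℕ) (X : Fin n → P.Obj), x = K.inp s X)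
    (fun a => .inl ⟨a, rfl⟩) (fun s n X _ => .inr ⟨s, n, X, rfl⟩) x

/-- The possible types of a channel on side `s` of an output sequent. -/
inductive Shape (s : Side) (x : P.Obj)
  | atom (a : A.Obj) (h : x = K.atom a)
  | compound {n : ℕ} (X : Fin n → P.Obj) (h : x = K.inp s.op X)

/-- A sequent has a channel to which the (co)tuple rule applies, or each of its channels is an
atom, or it is an output sequent. -/
theorem sequent_cases (R : Sequent P.Obj) :
    (∃ (s : Side) (n : ℕ) (X : Fin n → P.Obj) (U : Sequent P.Obj),
      Nonempty (Iso (U ⊹ one s (K.inp s X)) R)) ∨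
    (∃ U : Sequent A.Obj, Nonempty (Iso (U.map K.atom) R)) ∨
    ((∀ α, Nonempty (K.Shape (R.side α) (R.obj α))) ∧
      ∃ (α : R.Ch) (n : ℕ) (X : Fin n → P.Obj), R.obj α = K.inp (R.side α).op X) := by
  by_cases h₁ : ∃ (α : R.Ch) (n : ℕ) (X : Fin n → P.Obj), R.obj α = K.inp (R.side α) X
  · obtain ⟨α, n, X, h⟩ := h₁
    exact .inl ⟨R.side α, n, X, R.erase α, ⟨Iso.join R α h⟩⟩
  have h₂ : ∀ α, (∃ a, R.obj α = K.atom a) ∨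
      ∃ (n : ℕ) (X : Fin n → P.Obj), R.obj α = K.inp (R.side α).op X := by
    intro α
    rcases K.obj_cases (R.obj α) with h | ⟨s, n, X, h⟩
    · exact .inl h
    · refine .inr ⟨n, X, ?_⟩
      have : s ≠ R.side α := fun e => h₁ ⟨α, n, X, e ▸ h⟩
      have : (R.side α).op = s := by
        revert this
        cases s <;> cases R.side α <;> simp [Side.op]
      rw [this, h]
  right
  by_cases h₃ : ∃ (α : R.Ch) (n : ℕ) (X : Fin n → P.Obj), R.obj α = K.inp (R.side α).op X
  · refine .inr ⟨fun α => ?_, h₃⟩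
    rcases h₂ α with ⟨a, h⟩ | ⟨n, X, h⟩
    exacts [⟨.atom a h⟩, ⟨.compound X h⟩]
  · have h₄ : ∀ α, ∃ a, R.obj α = K.atom a := fun α =>
      (h₂ α).resolve_right fun h => h₃ ⟨α, h⟩
    choose a ha using h₄
    exact .inl ⟨⟨R.Ch, R.finite, R.side, a⟩, ⟨⟨Equiv.refl _, fun _ => rfl, ha⟩⟩⟩

end Calculus

/-! ### Interpretations of the calculus -/

/-- In a pulled back polycategory, projections and injections are those of the original one. -/
theorem Additive.pull_send {P : Polycategory.{u, v}} {D : Type u'} (e : D → P.Obj) {s : Side}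
    {n : ℕ} {X : Fin n → D} {o : D} (A : Additive P s.op (fun i => e (X i)) (e o))
    {R : Sequent D} (k : Fin n) (f : P.Hom ((R ⊹ one s (X k)).map e)) :
    (A.pull e).send k f =
      P.rename (Iso.mapOne e R s o).symm (A.send k (P.rename (Iso.mapOne e R s (X k)) f)) := by
  refine (P.pull_cutAt e s f ((A.pull e).leg k)).trans ?_
  refine congrArg (fun g => P.rename (Iso.mapOne e R s o).symm
    (P.cutAt s (P.rename (Iso.mapOne e R s (X k)) f) g)) ?_
  refine (P.rename_rename (Iso.mapOne e (one s o) s.op (X k)).symm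
    (Iso.mapOne e (one s o) s.op (X k)) _).trans ((P.rename_id _ fun _ => rfl).trans ?_)
  refine congrArg (fun g => A.tuple.symm g k) ?_
  cases s
  · exact (P.rename_rename _ _ _).trans (P.rename_id _ fun _ => rfl)
  · refine (congrArg _ (P.rename_rename _ _ _)).trans ((P.rename_rename _ _ _).trans ?_)
    exact P.rename_congr _ (by rintro (i | i) <;> rfl)

namespace Calculus

variable {A : Polycategory.{u, v}} {P : Polycategory.{u', v'}} {B : Polycategory.{u'', v''}}

/-- The morphism `M` interprets the calculus `K` over `A` in a polycategory with finite sums and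
products: it extends `F` and preserves the rules. -/
structure Interpretation (K : Calculus A P) (S : SumsProducts B) (F : Morphism A B)
    (M : Morphism P B) : Prop where
  obj_atom : ∀ a, M.obj (K.atom a) = F.obj a
  obj_inp : ∀ (s : Side) {n : ℕ} (X : Fin n → P.Obj),
    M.obj (K.inp s X) = S.inp s fun i => M.obj (X i)
  map_ax : ∀ {R : Sequent A.Obj} (f : A.Hom R), M.map (K.ax f) =
    B.rename (S := R.map F.obj) (T := (R.map K.atom).map M.obj)
      ⟨Equiv.refl _, fun _ => rfl, fun i => obj_atom (R.obj i)⟩ (F.map f)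
  map_tuple : ∀ (s : Side) {R : Sequent P.Obj} {n : ℕ} {X : Fin n → P.Obj}
    (f : ∀ i, P.Hom (R ⊹ one s (X i))),
    B.rename ((Iso.mapOne M.obj R s (K.inp s X)).trans (Iso.last _ rfl (obj_inp s X)))
        (M.map (K.tuple s f)) =
      (S.additive s fun i => M.obj (X i)).tuple fun i =>
        B.rename (Iso.mapOne M.obj R s (X i)) (M.map (f i))
  map_send : ∀ (s : Side) {R : Sequent P.Obj} {n : ℕ} {X : Fin n → P.Obj} (k : Fin n)
    (f : P.Hom (R ⊹ one s (X k))),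
    B.rename ((Iso.mapOne M.obj R s (K.inp s.op X)).trans (Iso.last _ rfl (obj_inp s.op X)))
        (M.map (K.send s (X := X) k f)) =
      (S.additive s.op fun i => M.obj (X i)).send k
        (B.rename (Iso.mapOne M.obj R s (X k)) (M.map f))

end Calculus

theorem comparison_interpretation {A : Polycategory.{u, v}} {B : Polycategory.{u'', v''}}
    (S : SumsProducts B) (F : Morphism A B) :
    (SigmaPi.calculus A).Interpretation S F (comparison S F) where
  obj_atom := fun _ => rfl
  obj_inp := fun s n X => by cases s <;> rfl
  map_ax := fun {R} f => (B.rename_id (S := R.map F.obj) (F.map f) fun _ => rfl).symm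
  map_tuple := fun s {R n X} f => by
    obtain ⟨f, rfl⟩ := SigmaPi.exists_mk f
    refine (congrArg (fun g => B.rename _ ((comparison S F).map g)) (SigmaPi.tuple_mk s f)).trans ?_
    cases s <;> exact (B.rename_rename _ _ _).trans (B.rename_id _ fun _ => rfl)
  map_send := fun s {R n X} k f => by
    refine Quotient.inductionOn f fun f => ?_
    cases s
    · have h := ((S.additive (Side.op .dom) fun i => (X i).eval S F).pull_send
        (Formula.eval S F) (o := Formula.out .dom X) k (f.eval S F))
      refine (congrArg (B.rename _) h).trans ?_
      exact (B.rename_rename _ _ _).trans (B.rename_id _ fun _ => rfl)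
    · have h := ((S.additive (Side.op .cod) fun i => (X i).eval S F).pull_send
        (Formula.eval S F) (o := Formula.out .cod X) k (f.eval S F))
      refine (congrArg (B.rename _) h).trans ?_
      exact (B.rename_rename _ _ _).trans (B.rename_id _ fun _ => rfl)

/-! ### Fullness and faithfulness -/

namespace Polycategory

variable (P : Polycategory.{u, v})

theorem rename_symm_rename {S T : Sequent P.Obj} (σ : Iso S T) (f : P.Hom S) :
    P.rename σ.symm (P.rename σ f) = f := by
  rw [P.rename_rename]
  exact P.rename_id f fun i => σ.equiv.symm_apply_apply i

theorem rename_rename_symm {S T : Sequent P.Obj} (σ : Iso S T) (f : P.Hom T) :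
    P.rename σ (P.rename σ.symm f) = f := by
  rw [P.rename_rename]
  exact P.rename_id f fun i => σ.equiv.apply_symm_apply i

theorem rename_injective {S T : Sequent P.Obj} (σ : Iso S T) :
    Function.Injective (P.rename σ) :=
  Function.LeftInverse.injective (P.rename_symm_rename σ)

theorem rename_bijective {S T : Sequent P.Obj} (σ : Iso S T) :
    Function.Bijective (P.rename σ) :=
  Function.bijective_iff_has_inverse.2 ⟨_, P.rename_symm_rename σ, P.rename_rename_symm σ⟩

end Polycategory

/-- Replacement of types commutes with a map of objects, which may be given up to equality. -/
noncomputable def Sequent.Iso.setMap {C : Type u} {D : Type v} (m : C → D) (R : Sequent C)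
    (α : R.Ch) (o : R.Ch → D) (ho : ∀ i, o i = m (R.obj i)) {x : C} {y : D} (h : y = m x) :
    Iso ((R.set α x).map m) (Sequent.set ⟨R.Ch, R.finite, R.side, o⟩ α y) where
  equiv := Equiv.refl _
  side_eq := fun _ => rfl
  obj_eq := fun (i : R.Ch) => by
    change (Sequent.set ⟨R.Ch, R.finite, R.side, o⟩ α y).obj i = m ((R.set α x).obj i)
    by_cases hi : i = α
    · subst hi
      exact (set_obj_self _ _ _).trans (h.trans (congrArg m (set_obj_self R i x).symm))
    · exact (set_obj_of_ne ⟨R.Ch, R.finite, R.side, o⟩ hi y).trans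
        ((ho i).trans (congrArg m (set_obj_of_ne R hi x).symm))

namespace Calculus

variable {A : Polycategory.{u, v}} {P : Polycategory.{u', v'}} {B : Polycategory.{u'', v''}}
  {K : Calculus A P}

namespace Shape

variable (M : Morphism P B) {s : Side} {x : P.Obj}

/-- The tag by which an output sequent of `B` records the type of the channel. -/
def tag : K.Shape s x → Tag A B
  | .atom a _ => .atom a
  | .compound X _ => .compound fun i => M.obj (X i)

/-- The components of the type of the channel. -/
def component : ∀ t : K.Shape s x, Fin (t.tag M).arity → P.Obj
  | .atom _ _ => Fin.elim0
  | .compound X _ => X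

theorem obj_eq : ∀ (t : K.Shape s x) (_ : Fin (t.tag M).arity), x = K.inp s.op (t.component M)
  | .compound _ h, _ => h

theorem tag_component : ∀ t : K.Shape s x,
    (t.tag M).component = fun i => M.obj (t.component M i)
  | .atom _ _ => funext fun i => i.elim0
  | .compound _ _ => rfl

end Shape

/-- The output sequent of `B` given by a sequent of `P` all of whose channels are atoms, products
in the domain or sums in the codomain. -/
def outputSequent (M : Morphism P B) {R : Sequent P.Obj}
    (t : ∀ α, K.Shape (R.side α) (R.obj α))
    (hR : ∃ (α : R.Ch) (n : ℕ) (X : Fin n → P.Obj), R.obj α = K.inp (R.side α).op X) :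
    OutputSequent A B where
  tags := ⟨R.Ch, R.finite, R.side, fun α => (t α).tag M⟩
  compound := by
    obtain ⟨α, n, X, h⟩ := hR
    rcases e : t α with ⟨a, ha⟩ | ⟨Y, hY⟩
    · exact absurd (ha.symm.trans h) (K.atom_ne_inp _ _ _)
    · exact ⟨α, _, fun i => M.obj (Y i), congrArg (Shape.tag M) e⟩

theorem weight_component_lt {R : Sequent P.Obj} (M : Morphism P B)
    (t : ∀ α, K.Shape (R.side α) (R.obj α)) (α : R.Ch) (k : Fin ((t α).tag M).arity) :
    (R.set α ((t α).component M k)).weight K.size < R.weight K.size :=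
  weight_set_lt K.size R α ((t α).obj_eq M k) (K.size_lt _ _ _)

/-- If all channels are atoms, a cut-free derivation is an axiom. -/
theorem CutFree.exists_ax {R : Sequent P.Obj} {f : P.Hom R} (hf : K.CutFree f) {U : Sequent A.Obj}
    (σ : Iso (U.map K.atom) R) : ∃ g, f = P.rename σ (K.ax g) := by
  have hobj : ∀ i, ∃ a, R.obj i = K.atom a := fun i => by
    obtain ⟨j, rfl⟩ := σ.equiv.surjective i
    exact ⟨U.obj j, σ.obj_eq j⟩
  have hinp : ∀ {T : Sequent P.Obj} {s t : Side} {n : ℕ} {X : Fin n → P.Obj},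
      Iso (T ⊹ one s (K.inp t X)) R → False := fun τ => by
    obtain ⟨a, ha⟩ := hobj (τ.equiv (Sum.inr ()))
    exact K.atom_ne_inp _ _ _ (ha.symm.trans (τ.obj_eq (Sum.inr ())))
  cases hf with
  | @ax T _ τ g =>
    let ρ : Iso (T.map K.atom) (U.map K.atom) := τ.trans σ.symm
    let κ : Iso T U := ⟨ρ.equiv, ρ.side_eq, fun i => K.atom_injective (ρ.obj_eq i)⟩
    refine ⟨A.rename κ g, ?_⟩
    rw [← K.rename_ax, P.rename_rename]
    refine P.rename_congr _ fun i => ?_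
    exact (σ.equiv.apply_symm_apply _).symm
  | tuple s τ g h => exact (hinp τ).elim
  | send s τ k g h => exact (hinp τ).elim

/-- A cut-free derivation of an output sequent ends with a projection or an injection. -/
theorem CutFree.exists_sendAt (M : Morphism P B) {R : Sequent P.Obj} {f : P.Hom R}
    (hf : K.CutFree f) (t : ∀ α, K.Shape (R.side α) (R.obj α))
    (hR : ∃ (α : R.Ch) (n : ℕ) (X : Fin n → P.Obj), R.obj α = K.inp (R.side α).op X) :
    ∃ (α : R.Ch) (k : Fin ((t α).tag M).arity) (d : P.Hom (R.set α ((t α).component M k))),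
      f = K.sendAt R α ((t α).obj_eq M k) k d := by
  cases hf with
  | ax σ g =>
    obtain ⟨α, n, X, h⟩ := hR
    obtain ⟨i, rfl⟩ := σ.equiv.surjective α
    exact absurd ((σ.obj_eq i).symm.trans h) (K.atom_ne_inp _ _ _)
  | @tuple s U _ n X σ g h =>
    have hs : R.side (σ.equiv (Sum.inr ())) = s := σ.side_eq _
    have ho : R.obj (σ.equiv (Sum.inr ())) = K.inp s X := σ.obj_eq (Sum.inr ())
    rcases t (σ.equiv (Sum.inr ())) with ⟨a, ha⟩ | ⟨Y, hY⟩
    · exact absurd (ha.symm.trans ho) (K.atom_ne_inp _ _ _)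
    · have e := congrArg Sigma.fst (K.inp_injective (hY.symm.trans ho))
      exact absurd ((congrArg Side.op hs).symm.trans e) (Side.op_ne s)
  | @send s U _ n X σ k g h =>
    obtain ⟨α, hα⟩ : ∃ α, σ.equiv (Sum.inr ()) = α := ⟨_, rfl⟩
    have hs : R.side α = s := hα ▸ σ.side_eq (Sum.inr ())
    have ho : R.obj α = K.inp (R.side α).op X := by
      rw [hs, ← hα]
      exact σ.obj_eq (Sum.inr ())
    let σ' : Iso (U ⊹ one s (X k)) (R.set α (X k)) :=
      ⟨σ.equiv, σ.side_eq, by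
        rintro (i | ⟨⟩)
        · refine (set_obj_of_ne R (fun e => ?_) _).trans (σ.obj_eq (Sum.inl i))
          have e' := σ.equiv.injective (e.trans hα.symm)
          cases e'
        · refine Eq.trans ?_ (set_obj_self R α (X k))
          exact congrArg _ hα⟩
    have key := K.sendAt_rename ho k hs σ hα σ' (fun _ => rfl) g
    rcases e : t α with ⟨a, ha⟩ | ⟨Y, hY⟩
    · exact absurd (ha.symm.trans ho) (K.atom_ne_inp _ _ _)
    · cases K.inp_injective (hY.symm.trans ho)
      refine ⟨α, ?_⟩
      rw [e]
      exact ⟨k, _, key.symm⟩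

namespace Interpretation

variable {S : SumsProducts B} {F : Morphism A B} {M : Morphism P B} (I : K.Interpretation S F M)

include I

theorem realize_tag {s : Side} {x : P.Obj} : ∀ t : K.Shape s x,
    (t.tag M).realize S F s = M.obj x
  | .atom a h => ((congrArg M.obj h).trans (I.obj_atom a)).symm
  | .compound X h => ((congrArg M.obj h).trans (I.obj_inp s.op X)).symm

/-- Interpretations preserve projections and injections on arbitrary channels. The types in the
image of `R` are only given up to equality, as `o`; the renamings `ε` and `ε'` account for this. -/
theorem map_sendAt {R : Sequent P.Obj} {α : R.Ch} {n : ℕ} {X : Fin n → P.Obj}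
    (h : R.obj α = K.inp (R.side α).op X) (k : Fin n) (d : P.Hom (R.set α (X k)))
    {o : R.Ch → B.Obj} {Y : Fin n → B.Obj} (hY : Y = fun i => M.obj (X i))
    (ε : Iso (R.map M.obj) ⟨R.Ch, R.finite, R.side, o⟩) (hε : ∀ i, ε.equiv i = i)
    (h' : o α = S.out (R.side α) Y)
    (ε' : Iso ((R.set α (X k)).map M.obj) (Sequent.set ⟨R.Ch, R.finite, R.side, o⟩ α (Y k)))
    (hε' : ∀ i, ε'.equiv i = i) :
    Poly.sendAt S ⟨R.Ch, R.finite, R.side, o⟩ α h' k (B.rename ε' (M.map d)) =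
      B.rename ε (M.map (K.sendAt R α h k d)) := by
  subst hY
  obtain ⟨d, rfl⟩ : ∃ d', d = P.rename (Iso.joinSet R α (X k)) d' :=
    ⟨_, (P.rename_rename_symm _ d).symm⟩
  let ι := (Iso.mapOne M.obj (R.erase α) (R.side α) (K.inp (R.side α).op X)).trans
    (Iso.last _ rfl (I.obj_inp (R.side α).op X))
  have hl : B.rename ε' (M.map (P.rename (Iso.joinSet R α (X k)) d)) =
      B.rename (((Iso.mapOne M.obj (R.erase α) (R.side α) (X k)).symm.trans
        ((Iso.joinSet R α (X k)).map M.obj)).trans ε')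
        (B.rename (Iso.mapOne M.obj (R.erase α) (R.side α) (X k)) (M.map d)) := by
    rw [M.map_rename, B.rename_rename, B.rename_rename]
    exact B.rename_congr _ fun _ => rfl
  rw [hl, Poly.sendAt_rename S (R := ⟨R.Ch, R.finite, R.side, o⟩) h' k rfl
    ((ι.symm.trans ((Iso.join R α h).map M.obj)).trans ε) (hε _) _
    (fun i => (hε' _).trans (hε _).symm), ← I.map_send]
  have hr : K.sendAt R α h k (P.rename (Iso.joinSet R α (X k)) d) =
      P.rename (Iso.join R α h) (K.send (R.side α) k d) :=
    congrArg (fun f => P.rename (Iso.join R α h) (K.send (R.side α) k f))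
      (P.rename_symm_rename _ d)
  rw [hr, M.map_rename, B.rename_rename]
  exact (B.rename_rename ι _ _).trans (B.rename_congr _ fun _ => rfl)

section Output

variable {R : Sequent P.Obj} (t : ∀ α, K.Shape (R.side α) (R.obj α))
    (hR : ∃ (α : R.Ch) (n : ℕ) (X : Fin n → P.Obj), R.obj α = K.inp (R.side α).op X)

/-- The output sequent of `R` is the image of `R`. -/
def outputIso : Iso (R.map M.obj) ((outputSequent M t hR).toSequent S F) :=
  ⟨Equiv.refl _, fun _ => rfl, fun α => I.realize_tag (t α)⟩

/-- `outputIso` with one replacement. -/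
noncomputable def singleIso (c : (outputSequent M t hR).Index) :
    Iso ((R.set c.1 ((t c.1).component M c.2)).map M.obj)
      (((outputSequent M t hR).toSequent S F).set c.1 c.component) :=
  Iso.setMap M.obj R c.1 _ (fun α => I.realize_tag (t α)) (congrFun (Shape.tag_component M _) c.2)

/-- `outputIso` with two replacements. -/
noncomputable def doubleIso (c d : (outputSequent M t hR).Index) :
    Iso (((R.set c.1 ((t c.1).component M c.2)).set d.1 ((t d.1).component M d.2)).map M.obj)
      ((((outputSequent M t hR).toSequent S F).set c.1 c.component).set d.1 d.component) :=
  Iso.setMap M.obj (R.set c.1 ((t c.1).component M c.2)) d.1 _ (I.singleIso t hR c).obj_eq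
    (congrFun (Shape.tag_component M _) d.2)

theorem send_single (c : (outputSequent M t hR).Index)
    (d : P.Hom (R.set c.1 ((t c.1).component M c.2))) :
    (outputSequent M t hR).send S F ⟨c, B.rename (I.singleIso t hR c) (M.map d)⟩ =
      B.rename (I.outputIso t hR)
        (M.map (K.sendAt R c.1 ((t c.1).obj_eq M c.2) c.2 d)) :=
  I.map_sendAt ((t c.1).obj_eq M c.2) c.2 d (Shape.tag_component M (t c.1)) (I.outputIso t hR)
    (fun _ => rfl) (c.obj_eq S F) (I.singleIso t hR c) fun _ => rfl

/-- `send_single` for a second channel `d.1`, after the replacement on `c.1`. -/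
theorem send_double {c d : (outputSequent M t hR).Index} (hcd : d.1 ≠ c.1)
    (f : P.Hom ((R.set c.1 ((t c.1).component M c.2)).set d.1 ((t d.1).component M d.2))) :
    Poly.sendAt S (((outputSequent M t hR).toSequent S F).set c.1 c.component) d.1
        ((set_obj_of_ne ((outputSequent M t hR).toSequent S F) hcd _).trans (d.obj_eq S F)) d.2
        (B.rename (I.doubleIso t hR c d) (M.map f)) =
      B.rename (I.singleIso t hR c) (M.map (K.sendAt (R.set c.1 ((t c.1).component M c.2)) d.1
        ((set_obj_of_ne R hcd _).trans ((t d.1).obj_eq M d.2)) d.2 f)) :=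
  I.map_sendAt (R := R.set c.1 ((t c.1).component M c.2)) _ d.2 f
    (Shape.tag_component M (t d.1)) (I.singleIso t hR c)
    (fun _ => rfl)
    ((set_obj_of_ne ((outputSequent M t hR).toSequent S F) hcd _).trans (d.obj_eq S F))
    (I.doubleIso t hR c d) fun _ => rfl

end Output

theorem map_tuple_eq (s : Side) {R : Sequent P.Obj} {n : ℕ} {X : Fin n → P.Obj}
    (f : ∀ i, P.Hom (R ⊹ one s (X i))) : M.map (K.tuple s f) =
      B.rename ((Iso.mapOne M.obj R s (K.inp s X)).trans (Iso.last _ rfl (I.obj_inp s X))).symm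
        ((S.additive s fun i => M.obj (X i)).tuple fun i =>
          B.rename (Iso.mapOne M.obj R s (X i)) (M.map (f i))) := by
  rw [← I.map_tuple, B.rename_symm_rename]

/-- If `F` is full and semi-soft, then every polymorphism of `B` between formulas is the value of
a derivation, by induction on the sequent: if there is a sum in the domain or a product in the
codomain, it is a (co)tuple; if all channels are atoms, it comes from `A`; otherwise it factors
through a projection or an injection. -/
theorem full (hF : F.Full) (hS : SemiSoft S F) : M.Full := by
  suffices h : ∀ (m : ℕ) (R : Sequent P.Obj), R.weight K.size = m →
      Function.Surjective fun f : P.Hom R => M.map f from fun R => h _ R rfl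
  intro m
  induction m using Nat.strong_induction_on with
  | _ m ih =>
  rintro R rfl f
  rcases K.sequent_cases R with ⟨s, n, X, U, ⟨σ⟩⟩ | ⟨U, ⟨σ⟩⟩ | ⟨t, hR⟩
  · let ι := (Iso.mapOne M.obj U s (K.inp s X)).trans (Iso.last _ rfl (I.obj_inp s X))
    obtain ⟨g, hg⟩ := (S.additive s fun i => M.obj (X i)).tuple.surjective
      (B.rename ((σ.map M.obj).symm.trans ι) f)
    have hlift : ∀ i, ∃ d : P.Hom (U ⊹ one s (X i)),
        M.map d = B.rename (Iso.mapOne M.obj U s (X i)).symm (g i) := fun i =>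
      ih _ (weight_lt K.size σ (K.size_lt s X i)) _ rfl _
    choose d hd using hlift
    refine ⟨P.rename σ (K.tuple s d), ?_⟩
    simp only [M.map_rename, I.map_tuple_eq, hd, B.rename_rename_symm]
    rw [hg, B.rename_rename, B.rename_rename]
    refine B.rename_id f fun i => ?_
    exact σ.equiv.apply_symm_apply i
  · let ι : Iso (U.map F.obj) ((U.map K.atom).map M.obj) :=
      ⟨Equiv.refl _, fun _ => rfl, fun i => I.obj_atom (U.obj i)⟩
    obtain ⟨g, hg⟩ := hF U (B.rename ((σ.map M.obj).symm.trans ι.symm) f)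
    refine ⟨P.rename σ (K.ax g), ?_⟩
    dsimp only at hg ⊢
    rw [M.map_rename, I.map_ax, hg, B.rename_rename, B.rename_rename]
    refine B.rename_id f fun i => ?_
    exact σ.equiv.apply_symm_apply i
  · replace t := fun α => (t α).some
    obtain ⟨⟨c, g⟩, hg⟩ := hS (outputSequent M t hR) (B.rename (I.outputIso t hR) f)
    obtain ⟨d, hd⟩ := ih _ (weight_component_lt M t c.1 c.2) _ rfl
      (B.rename (I.singleIso t hR c).symm g)
    refine ⟨K.sendAt R c.1 ((t c.1).obj_eq M c.2) c.2 d, B.rename_injective (I.outputIso t hR) ?_⟩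
    have h := I.send_single t hR c d
    rw [show M.map d = _ from hd, B.rename_rename_symm] at h
    exact h.symm.trans hg

/-- If `M` is full and `F` is faithful and a soft extension, then `M` is faithful. By cut
elimination, a derivation of an output sequent ends with a projection or an injection, up to
conversion. By induction, the class of such a derivation is a function of the value of its premise,
and this function identifies what the coequalizer in the definition of softness identifies. Hence
it factors through the value of the derivation. -/
theorem faithful (hM : M.Full)
    (hF : ∀ R : Sequent A.Obj, Function.Injective fun f : A.Hom R => F.map f)
    (hS : SoftExtension S F) (R : Sequent P.Obj) :
    Function.Injective fun f : P.Hom R => M.map f := by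
  suffices h : ∀ (m : ℕ) (R : Sequent P.Obj), R.weight K.size = m →
      Function.Injective fun f : P.Hom R => M.map f from h _ R rfl
  intro m
  induction m using Nat.strong_induction_on with
  | _ m ih =>
  rintro R rfl f f' hff'
  dsimp only at hff'
  rcases K.sequent_cases R with ⟨s, n, X, U, ⟨σ⟩⟩ | ⟨U, ⟨σ⟩⟩ | ⟨t, hR⟩
  · obtain ⟨d, hd⟩ := K.tuple_surjective s (P.rename σ.symm f)
    obtain ⟨d', hd'⟩ := K.tuple_surjective s (P.rename σ.symm f')
    refine P.rename_injective σ.symm ?_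
    have h : M.map (P.rename σ.symm f) = M.map (P.rename σ.symm f') := by
      rw [M.map_rename, M.map_rename, hff']
    rw [hd, hd', I.map_tuple_eq, I.map_tuple_eq] at h
    rw [hd, hd']
    have h' := (S.additive s fun i => M.obj (X i)).tuple.injective (B.rename_injective _ h)
    refine congrArg (K.tuple s) (funext fun i => ?_)
    exact ih _ (weight_lt K.size σ (K.size_lt s X i)) _ rfl
      (B.rename_injective _ (congrFun h' i))
  · obtain ⟨g, rfl⟩ := (K.cutFree f).exists_ax σ
    obtain ⟨g', rfl⟩ := (K.cutFree f').exists_ax σ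
    rw [M.map_rename, M.map_rename] at hff'
    have h := B.rename_injective _ hff'
    rw [I.map_ax, I.map_ax] at h
    rw [hF U (B.rename_injective _ h)]
  · replace t := fun α => (t α).some
    let T := outputSequent M t hR
    have hlift : ∀ y : T.Single S F, ∃ d : P.Hom (R.set y.1.1 ((t y.1.1).component M y.1.2)),
        y.2 = B.rename (I.singleIso t hR y.1) (M.map d) := fun y => by
      obtain ⟨d, hd⟩ := hM _ (B.rename (I.singleIso t hR y.1).symm y.2)
      exact ⟨d, by rw [show M.map d = _ from hd, B.rename_rename_symm]⟩
    choose lift hlift using hlift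
    -- by the inductive hypothesis, the lifts are unique
    have lift_eq : ∀ (c : T.Index) (d : P.Hom (R.set c.1 ((t c.1).component M c.2))),
        lift ⟨c, B.rename (I.singleIso t hR c) (M.map d)⟩ = d := fun c d =>
      ih _ (weight_component_lt M t c.1 c.2) _ rfl (B.rename_injective (I.singleIso t hR c)
        (hlift ⟨c, B.rename (I.singleIso t hR c) (M.map d)⟩).symm)
    -- the derivation that adds the last rule to the lift of a premise
    let Φ : T.Single S F → P.Hom R := fun y =>
      K.sendAt R y.1.1 ((t y.1.1).obj_eq M y.1.2) y.1.2 (lift y)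
    have hΦ : Φ ∘ T.sendSnd S F = Φ ∘ T.sendFst S F := by
      funext ⟨⟨⟨c, d⟩, hcd⟩, g⟩
      obtain ⟨x, hx⟩ := hM _ (B.rename (I.doubleIso t hR c d).symm g)
      obtain rfl : g = B.rename (I.doubleIso t hR c d) (M.map x) := by
        rw [show M.map x = _ from hx, B.rename_rename_symm]
      have e : B.rename (Iso.setSet (T.toSequent S F) c.1 d.1 hcd c.component d.component)
            (B.rename (I.doubleIso t hR c d) (M.map x)) =
          B.rename (I.doubleIso t hR d c)
            (M.map (P.rename (Iso.setSet R c.1 d.1 hcd _ _) x)) := by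
        rw [M.map_rename, B.rename_rename]
        exact Eq.trans (B.rename_congr _ fun _ => rfl) (B.rename_rename
          ((Iso.setSet R c.1 d.1 hcd ((t c.1).component M c.2) ((t d.1).component M d.2)).map
            M.obj) (I.doubleIso t hR d c) (M.map x)).symm
      have l := (congrArg (fun y => Φ ⟨c, y⟩)
          (I.send_double t hR (c := c) (d := d) hcd.symm x)).trans
        (congrArg (K.sendAt R c.1 ((t c.1).obj_eq M c.2) c.2) (lift_eq c _))
      have r := (congrArg (fun y => Φ ⟨d, y⟩) ((congrArg (fun y => Poly.sendAt S
          ((T.toSequent S F).set d.1 d.component) c.1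
            ((set_obj_of_ne (T.toSequent S F) hcd _).trans (c.obj_eq S F)) c.2 y) e).trans
          (I.send_double t hR (c := d) (d := c) hcd _))).trans
        (congrArg (K.sendAt R d.1 ((t d.1).obj_eq M d.2) d.2) (lift_eq d _))
      exact l.trans ((K.sendAt_sendAt hcd _ _ _ _ _ _ x).trans r.symm)
    obtain ⟨h, hinj, -⟩ := hS T
    obtain ⟨α, k, d, rfl⟩ := (K.cutFree f).exists_sendAt M t hR
    obtain ⟨α', k', d', rfl⟩ := (K.cutFree f').exists_sendAt M t hR
    let c : T.Index := ⟨α, k⟩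
    let c' : T.Index := ⟨α', k'⟩
    have e₁ := I.send_single t hR c d
    have e₂ := I.send_single t hR c' d'
    have e : Function.Coequalizer.mk (T.sendSnd S F) (T.sendFst S F)
          ⟨c, B.rename (I.singleIso t hR c) (M.map d)⟩ =
        Function.Coequalizer.mk (T.sendSnd S F) (T.sendFst S F)
          ⟨c', B.rename (I.singleIso t hR c') (M.map d')⟩ :=
      hinj (e₁.trans ((congrArg _ hff').trans e₂.symm))
    have e' := congrArg (Function.Coequalizer.desc _ _ Φ hΦ) e
    have r₁ : Φ ⟨c, B.rename (I.singleIso t hR c) (M.map d)⟩ = _ :=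
      congrArg (K.sendAt R c.1 ((t c.1).obj_eq M c.2) c.2) (lift_eq c d)
    have r₂ : Φ ⟨c', B.rename (I.singleIso t hR c') (M.map d')⟩ = _ :=
      congrArg (K.sendAt R c'.1 ((t c'.1).obj_eq M c'.2) c'.2) (lift_eq c' d')
    exact r₁.symm.trans (e'.trans r₂)

end Interpretation

end Calculus

/-! ### Isomorphisms of objects and transport -/

namespace ObjIso

variable {Q : Polycategory.{u, v}} {x y z : Q.Obj}

/-- The inverse isomorphism. -/
def symm (θ : ObjIso Q x y) : ObjIso Q y x := ⟨θ.inv, θ.hom, θ.inv_hom, θ.hom_inv⟩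

/-- Composition with an isomorphism on the last channel. -/
def act (θ : ObjIso Q x y) (s : Side) {R : Sequent Q.Obj} (f : Q.Hom (R ⊹ one s x)) :
    Q.Hom (R ⊹ one s y) :=
  Q.cutAt s f (θ.along s)

theorem act_rename (θ : ObjIso Q x y) (s : Side) {R T : Sequent Q.Obj} (σ : Iso R T)
    (f : Q.Hom (R ⊹ one s x)) :
    θ.act s (Q.rename (σ.app (Iso.refl _)) f) = Q.rename (σ.app (Iso.refl _)) (θ.act s f) :=
  (Q.rename_cutAt_left s σ f _).symm

theorem act_symm_act (θ : ObjIso Q x y) (s : Side) {R : Sequent Q.Obj}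
    (f : Q.Hom (R ⊹ one s x)) : θ.symm.act s (θ.act s f) = f := by
  cases s
  · have key := Q.cutAt_cutAt_two .dom .dom f (Q.rename (Iso.comm _ _) θ.inv) θ.hom
    refine Eq.trans (congrArg (fun h => Q.cutAt .dom (Q.cutAt .dom f h) θ.hom)
      (Q.rename_comm_comm θ.inv)).symm (key.trans ?_)
    have e : Q.rename (Iso.comm _ _) (Q.cutAt .dom (Q.rename (Iso.comm _ _) θ.inv) θ.hom) =
        Q.id x :=
      (congrArg (fun h => Q.rename (Iso.comm _ _) (Q.rename (Iso.comm _ _) h)) θ.hom_inv).trans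
        (Q.rename_comm_comm _)
    refine (congrArg (Q.cutAt .dom f) e).trans ?_
    exact (congrArg (Q.rename (Iso.comm _ _)) (Q.id_cut f)).trans (Q.rename_comm_comm _)
  · have key := Q.cutAt_cutAt_two .cod .cod f θ.hom (Q.rename (Iso.comm _ _) θ.inv)
    refine Eq.trans key ?_
    refine Eq.trans (congrArg (fun h => Q.cut f (Q.rename (Iso.comm _ _) h)) θ.hom_inv) ?_
    exact Q.cut_id f

theorem act_bijective (θ : ObjIso Q x y) (s : Side) {R : Sequent Q.Obj} :
    Function.Bijective (θ.act s (R := R)) :=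
  Function.bijective_iff_has_inverse.2 ⟨θ.symm.act s, θ.act_symm_act s, θ.symm.act_symm_act s⟩

/-- Compositions with isomorphisms commute with cuts along other channels. -/
theorem act_cut (θ : ObjIso Q x y) (s t : Side) {R T : Sequent Q.Obj} {z : Q.Obj}
    (f : Q.Hom (R ⊹ one t z ⊹ one s x)) (g : Q.Hom (T ⊹ one t.op z)) :
    Q.cutAt t (Q.rename (Iso.exch _ _ _) (θ.act s f)) g =
      Q.rename (Iso.exch _ _ _) (θ.act s (Q.rename (Iso.exch _ _ _)
        (Q.cutAt t (Q.rename (Iso.exch _ _ _) f) g))) := by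
  have key := congrArg (Q.rename (Iso.exch _ _ _)) (Q.cutAt_comm t s f g (θ.along s))
  rw [Q.rename_rename, Q.rename_id] at key
  · exact key
  · rintro ((i | i) | i) <;> rfl

theorem act_act {x' y' : Q.Obj} (θ : ObjIso Q x y) (θ' : ObjIso Q x' y') (s t : Side)
    {R : Sequent Q.Obj} (f : Q.Hom (R ⊹ one s x ⊹ one t x')) :
    Q.rename (Iso.exch _ _ _) (θ.act s (Q.rename (Iso.exch _ _ _) (θ'.act t f))) =
      θ'.act t (Q.rename (Iso.exch _ _ _) (θ.act s (Q.rename (Iso.exch _ _ _) f))) :=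
  Q.cutAt_comm s t f (θ.along s) (θ'.along t)

theorem cut_act_act (θ : ObjIso Q x y) {R T : Sequent Q.Obj} (f : Q.Hom (R ⊹ one .cod x))
    (g : Q.Hom (T ⊹ one .dom x)) : Q.cut (θ.act .cod f) (θ.act .dom g) = Q.cut f g := by
  have key := Q.cutAt_cutAt_two .cod .cod (θ.act .cod f) θ.inv g
  have e : Q.cutAt .cod (θ.act .cod f) (Q.rename (Iso.comm _ _) θ.inv) = f :=
    θ.act_symm_act .cod f
  exact ((congrArg (fun h => Q.cut h g) e).symm.trans key).symm

end ObjIso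

namespace Sequent

variable {C : Type u} {D : Type v}

theorem isEmpty_or_iso (U : Sequent C) :
    IsEmpty U.Ch ∨ ∃ (T : Sequent C) (s : Side) (x : C), Nonempty (Iso (T ⊹ one s x) U) := by
  rcases isEmpty_or_nonempty U.Ch with h | ⟨⟨α⟩⟩
  exacts [.inl h, .inr ⟨_, _, _, ⟨Iso.join U α rfl⟩⟩]

namespace Iso

/-- For a sequent without channels, the types are irrelevant. -/
def ofIsEmpty (F G : D → C) (R : Sequent C) (U : Sequent D) (h : IsEmpty U.Ch) :
    Iso (R ⊹ U.map F) (R ⊹ U.map G) where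
  equiv := Equiv.refl _
  side_eq := by rintro (i | i); exacts [rfl, h.elim i]
  obj_eq := by rintro (i | i); exacts [rfl, h.elim i]

/-- A presentation of `V` with a last channel gives one of `R ⊹ V.map F`. -/
def fuse (F : D → C) (R : Sequent C) {U V : Sequent D} {s : Side} {x : D}
    (σ : Iso (U ⊹ one s x) V) : Iso (R ⊹ U.map F ⊹ one s (F x)) (R ⊹ V.map F) :=
  (assoc _ _ _).trans ((refl R).app ((mapOne F U s x).symm.trans (σ.map F)))

end Iso

end Sequent

section Transport

variable {Q : Polycategory.{u, v}} {D : Type u'} {F G : D → Q.Obj}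

/-- The relation between a polymorphism whose channels from `U` have types `F x` and the
polymorphism obtained from it by composition with the isomorphisms `θ x` on these channels, in an
arbitrary order; the channels in `R` are left alone. -/
inductive Transported (θ : ∀ x, ObjIso Q (F x) (G x)) : ∀ {R : Sequent Q.Obj} {U : Sequent D},
    Q.Hom (R ⊹ U.map F) → Q.Hom (R ⊹ U.map G) → Prop
  | nil {R : Sequent Q.Obj} {U : Sequent D} (h : IsEmpty U.Ch) (f : Q.Hom (R ⊹ U.map F)) :
      Transported θ f (Q.rename (Iso.ofIsEmpty F G R U h) f)
  | cons {R : Sequent Q.Obj} {U V : Sequent D} {s : Side} {x : D} (σ : Iso (U ⊹ one s x) V)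
      (f : Q.Hom (R ⊹ U.map F ⊹ one s (F x))) (g : Q.Hom (R ⊹ one s (G x) ⊹ U.map G)) :
      Transported θ (Q.rename (Iso.exch _ _ _) ((θ x).act s f)) g →
      Transported θ (Q.rename (Iso.fuse F R σ) f)
        (Q.rename ((Iso.exch _ _ _).trans (Iso.fuse G R σ)) g)

namespace Transported

variable {θ : ∀ x, ObjIso Q (F x) (G x)}

theorem rename {R : Sequent Q.Obj} {U : Sequent D} {f : Q.Hom (R ⊹ U.map F)}
    {g : Q.Hom (R ⊹ U.map G)} (h : Transported θ f g) : ∀ {R' : Sequent Q.Obj} {U' : Sequent D}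
      (ρ : Iso R R') (τ : Iso U U'),
      Transported θ (Q.rename (ρ.app (τ.map F)) f) (Q.rename (ρ.app (τ.map G)) g) := by
  induction h with
  | @nil R U h f =>
    intro R' U' ρ τ
    have h' : IsEmpty U'.Ch := ⟨fun i => h.elim (τ.equiv.symm i)⟩
    have := Transported.nil (θ := θ) h' (Q.rename (ρ.app (τ.map F)) f)
    rw [Q.rename_rename] at this
    rw [Q.rename_rename]
    rwa [Q.rename_congr (τ := (ρ.app (τ.map F)).trans (Iso.ofIsEmpty F G R' U' h'))]
    rintro (i | i) <;> rfl
  | @cons R U V s x σ f g h ih =>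
    intro R' U' ρ τ
    have key := Transported.cons (σ.trans τ)
      (Q.rename ((ρ.app (Iso.refl _)).app (Iso.refl _)) f)
      (Q.rename ((ρ.app (Iso.refl _)).app ((Iso.refl U).map G)) g) (by
        have := ih (ρ.app (Iso.refl _)) (Iso.refl U)
        rw [ObjIso.act_rename, Q.rename_rename]
        rw [Q.rename_rename] at this
        rwa [Q.rename_congr (τ := (Iso.exch R (U.map F) (one s (G x))).trans
          ((ρ.app (Iso.refl (one s (G x)))).app ((Iso.refl U).map F)))]
        rintro ((i | i) | i) <;> rfl)
    rw [Q.rename_rename, Q.rename_rename] at key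
    rw [Q.rename_rename, Q.rename_rename]
    convert key using 1
    · exact Q.rename_congr _ (by rintro ((i | i) | i) <;> rfl)
    · exact Q.rename_congr _ (by rintro ((i | i) | i) <;> rfl)

/-- Transport is a bijection of poly-hom-sets. -/
theorem exists_bijective (θ : ∀ x, ObjIso Q (F x) (G x)) (R : Sequent Q.Obj) (U : Sequent D) :
    ∃ T : Q.Hom (R ⊹ U.map F) → Q.Hom (R ⊹ U.map G),
      Function.Bijective T ∧ ∀ f, Transported θ f (T f) := by
  suffices h : ∀ (n : ℕ) (U : Sequent D), U.weight (fun _ => 1) = n → ∀ R : Sequent Q.Obj,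
      ∃ T : Q.Hom (R ⊹ U.map F) → Q.Hom (R ⊹ U.map G),
        Function.Bijective T ∧ ∀ f, Transported θ f (T f) from h _ U rfl R
  intro n
  induction n with
  | zero =>
    intro U hU R
    rcases U.isEmpty_or_iso with h | ⟨T, s, x, ⟨σ⟩⟩
    · exact ⟨_, Q.rename_bijective (Iso.ofIsEmpty F G R U h), .nil h⟩
    · rw [← weight_congr _ σ, weight_app_one] at hU
      exact absurd hU (Nat.succ_ne_zero _)
  | succ n ih =>
    intro U hU R
    rcases U.isEmpty_or_iso with h | ⟨T, s, x, ⟨σ⟩⟩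
    · exact ⟨_, Q.rename_bijective (Iso.ofIsEmpty F G R U h), .nil h⟩
    · rw [← weight_congr _ σ, weight_app_one] at hU
      obtain ⟨τ, hτ, hτ'⟩ := ih T (Nat.succ_injective hU) (R ⊹ one s (G x))
      refine ⟨fun f => Q.rename ((Iso.exch _ _ _).trans (Iso.fuse G R σ)) (τ (Q.rename
        (Iso.exch _ _ _) ((θ x).act s (Q.rename (Iso.fuse F R σ).symm f)))), ?_, fun f => ?_⟩
      · exact (Q.rename_bijective _).comp (hτ.comp ((Q.rename_bijective _).comp
          (((θ x).act_bijective s).comp (Q.rename_bijective _))))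
      · have := Transported.cons σ (Q.rename (Iso.fuse F R σ).symm f) _ (hτ' _)
        rwa [Q.rename_rename_symm] at this

theorem congr_iso {R : Sequent Q.Obj} {U : Sequent D} {f f' : Q.Hom (R ⊹ U.map F)}
    {g g' : Q.Hom (R ⊹ U.map G)} (h : Transported θ f g) (hf : f = f') (hg : g = g') :
    Transported θ f' g' := hf ▸ hg ▸ h

/-- The order of the compositions is irrelevant, as compositions on distinct channels commute. -/
theorem unique {R : Sequent Q.Obj} {U : Sequent D} {f : Q.Hom (R ⊹ U.map F)}
    {g g' : Q.Hom (R ⊹ U.map G)} (h : Transported θ f g) (h' : Transported θ f g') : g = g' := by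
  suffices H : ∀ (n : ℕ) (U : Sequent D), U.weight (fun _ => 1) = n → ∀ (R : Sequent Q.Obj)
      (f f' : Q.Hom (R ⊹ U.map F)) (g g' : Q.Hom (R ⊹ U.map G)), Transported θ f g →
      Transported θ f' g' → f = f' → g = g' from H _ U rfl R f f g g' h h' rfl
  clear h h'
  intro n
  induction n using Nat.strong_induction_on with
  | _ n ih =>
  rintro V rfl R f f' g g' h h' e
  cases h with
  | nil hU =>
    cases h' with
    | nil hU' => rw [e]
    | cons σ => exact hU.elim (σ.equiv (Sum.inr ()))
  | @cons _ U _ s x σ f g h =>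
    cases h' with
    | nil hU => exact hU.elim (σ.equiv (Sum.inr ()))
    | @cons _ U' _ s' x' σ' f' g' h' =>
      have hlt : U.weight (fun _ => 1) < V.weight (fun _ => 1) := by
        rw [← weight_congr _ σ, weight_app_one]
        exact Nat.lt_succ_self _
      have hlt' : U'.weight (fun _ => 1) < V.weight (fun _ => 1) := by
        rw [← weight_congr _ σ', weight_app_one]
        exact Nat.lt_succ_self _
      rcases Iso.split (σ.trans σ'.symm) with ⟨rfl, rfl, ρ, hρ⟩ | ⟨W, α, β, hκ⟩
      -- both compositions begin with the same channel
      · have hσ : ∀ i, σ.equiv i = σ'.equiv (Sum.map ρ.equiv _root_.id i) := fun i => by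
          rw [← hρ]
          exact (σ'.equiv.apply_symm_apply _).symm
        have e' : f' = Q.rename (((Iso.refl R).app (ρ.map F)).app (Iso.refl _)) f := by
          refine Q.rename_injective (Iso.fuse F R σ') (e.symm.trans ?_)
          rw [Q.rename_rename]
          refine Q.rename_congr _ ?_
          rintro ((i | i) | i)
          · rfl
          · exact congrArg Sum.inr (hσ (Sum.inl i))
          · exact congrArg Sum.inr (hσ (Sum.inr i))
        have key := ih _ hlt' U' rfl _ _ _ _ _ (h.rename (Iso.refl _) ρ) h' (by
          rw [e', ObjIso.act_rename, Q.rename_rename, Q.rename_rename]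
          refine Q.rename_congr _ ?_
          rintro ((i | i) | i) <;> rfl)
        rw [← key, Q.rename_rename]
        refine Q.rename_congr _ ?_
        rintro ((i | i) | i)
        · rfl
        · exact congrArg Sum.inr (hσ (Sum.inr i))
        · exact congrArg Sum.inr (hσ (Sum.inl i))
      -- they begin with distinct channels: both are compared with one that begins with these two
      · have hσ : ∀ i, σ.equiv i = σ'.equiv ((((α.app (Iso.refl (one s x))).trans (Iso.exch W
            (one s' x') (one s x))).trans (β.app (Iso.refl (one s' x')))).equiv i) := fun i => by
          rw [← hκ]
          exact (σ'.equiv.apply_symm_apply _).symm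
        have hσ₁ : ∀ i, σ.equiv (Sum.inl (α.equiv.symm (Sum.inl i))) =
            σ'.equiv (Sum.inl (β.equiv (Sum.inl i))) := fun i => (hσ _).trans
          (congrArg (fun j => σ'.equiv (Sum.map β.equiv _root_.id
            ((Iso.exch W (one s' x') (one s x)).equiv (Sum.inl j))))
              (α.equiv.apply_symm_apply (Sum.inl i)))
        have hσ₂ : σ.equiv (Sum.inl (α.equiv.symm (Sum.inr ()))) = σ'.equiv (Sum.inr ()) :=
          (hσ _).trans (congrArg (fun j => σ'.equiv (Sum.map β.equiv _root_.id
            ((Iso.exch W (one s' x') (one s x)).equiv (Sum.inl j))))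
              (α.equiv.apply_symm_apply (Sum.inr ())))
        have hσ₃ : σ.equiv (Sum.inr ()) = σ'.equiv (Sum.inl (β.equiv (Sum.inr ()))) := hσ _
        obtain ⟨f, rfl⟩ : ∃ f₀, f = Q.rename ((Iso.fuse F R α.symm).app (Iso.refl _)) f₀ :=
          ⟨_, (Q.rename_rename_symm _ f).symm⟩
        have e' : f' = Q.rename ((Iso.fuse F R β).app (Iso.refl _))
            (Q.rename (Iso.exch _ _ _) f) := by
          refine Q.rename_injective (Iso.fuse F R σ') (e.symm.trans ?_)
          rw [Q.rename_rename, Q.rename_rename, Q.rename_rename]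
          refine Q.rename_congr _ ?_
          rintro (((i | i) | i) | i)
          · rfl
          · exact congrArg Sum.inr (hσ₁ i)
          · exact congrArg Sum.inr hσ₂
          · exact congrArg Sum.inr hσ₃
        obtain ⟨a, ha⟩ : ∃ a, a = (θ x').act s' (Q.rename (Iso.exch _ _ _) ((θ x).act s f)) :=
          ⟨_, rfl⟩
        obtain ⟨T, -, hT⟩ := exists_bijective θ (R ⊹ one s (G x) ⊹ one s' (G x')) W
        obtain ⟨k, hk⟩ : ∃ k, Transported θ (Q.rename
            (((Iso.exch R (W.map F) (one s (G x))).app (Iso.refl (one s' (G x')))).trans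
              (Iso.exch (R ⊹ one s (G x)) (W.map F) (one s' (G x')))) a) k := ⟨_, hT _⟩
        have t₁ := Transported.cons α.symm
          (Q.rename ((Iso.exch R (W.map F) (one s (G x))).app (Iso.refl (one s' (F x'))))
            (Q.rename (Iso.exch _ _ _) ((θ x).act s f))) k (by
            rwa [ObjIso.act_rename, ← ha, Q.rename_rename])
        have t₂ := Transported.cons β
          (Q.rename ((Iso.exch R (W.map F) (one s' (G x'))).app (Iso.refl (one s (F x))))
            (Q.rename (Iso.exch _ _ _) ((θ x').act s' (Q.rename (Iso.exch _ _ _) f))))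
          (Q.rename ((Iso.exch _ _ _).app ((Iso.refl W).map G)) k) (by
            refine (hk.rename (Iso.exch _ _ _) (Iso.refl W)).congr_iso ?_ rfl
            have h := ObjIso.act_act (θ x) (θ x') s s' (Q.rename (Iso.exch _ _ _) f)
            rw [Q.rename_rename (Iso.exch _ _ _) (Iso.exch _ _ _) f, Q.rename_id f, ← ha] at h
            · rw [← h, ObjIso.act_rename, Q.rename_rename, Q.rename_rename, Q.rename_rename]
              exact Q.rename_congr _ (by rintro (((i | i) | i) | i) <;> rfl)
            · rintro (((i | i) | i) | i) <;> rfl)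
        have u₁ := ih _ hlt U rfl _ _ _ _ _ h t₁ (by
          rw [ObjIso.act_rename, Q.rename_rename, Q.rename_rename, Q.rename_rename]
          exact Q.rename_congr _ (by rintro (((i | i) | i) | i) <;> rfl))
        have u₂ := ih _ hlt' U' rfl _ _ _ _ _ h' t₂ (by
          rw [e', ObjIso.act_rename, Q.rename_rename, Q.rename_rename, Q.rename_rename]
          exact Q.rename_congr _ (by rintro (((i | i) | i) | i) <;> rfl))
        rw [u₁, u₂, Q.rename_rename, Q.rename_rename, Q.rename_rename]
        refine Q.rename_congr _ ?_
        rintro (((i | i) | i) | i)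
        · rfl
        · exact congrArg Sum.inr hσ₃
        · exact congrArg Sum.inr hσ₂
        · exact congrArg Sum.inr (hσ₁ i)

end Transported

end Transport

/-! ### Transport and cuts -/

namespace Sequent.Iso

variable {C : Type u} {D : Type v}

/-- `mapApp` next to further channels. -/
def mapAppRight (F : D → C) (R : Sequent C) (U V : Sequent D) :
    Iso (R ⊹ U.map F ⊹ V.map F) (R ⊹ (U ⊹ V).map F) :=
  (assoc _ _ _).trans ((refl R).app (mapApp F U V).symm)

/-- Channels of an empty sequent may be added on the left. -/
def emptyApp (U V : Sequent C) (h : IsEmpty U.Ch) : Iso V (U ⊹ V) where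
  equiv := (Equiv.emptySum U.Ch V.Ch).symm
  side_eq := fun _ => rfl
  obj_eq := fun _ => rfl

/-- Channels of an empty sequent may be removed on the right. -/
def appEmpty (U V : Sequent C) (h : IsEmpty V.Ch) : Iso (U ⊹ V) U where
  equiv := Equiv.sumEmpty U.Ch V.Ch
  side_eq := by rintro (i | i); exacts [rfl, h.elim i]
  obj_eq := by rintro (i | i); exacts [rfl, h.elim i]

end Sequent.Iso

namespace Transported

variable {Q : Polycategory.{u, v}} {D : Type u'} {F G : D → Q.Obj}
  {θ : ∀ x, ObjIso Q (F x) (G x)}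

/-- Transport commutes with cuts along the other channels. -/
theorem cutAt {R₀ : Sequent Q.Obj} {U : Sequent D} {f : Q.Hom (R₀ ⊹ U.map F)}
    {f' : Q.Hom (R₀ ⊹ U.map G)} (h : Transported θ f f') :
    ∀ {R T : Sequent Q.Obj} {t : Side} {z : Q.Obj} (ρ : Iso R₀ (R ⊹ one t z))
      (g : Q.Hom (T ⊹ one t.op z)), Transported θ
        (Q.rename (Iso.exch _ _ _)
          (Q.cutAt t (Q.rename ((ρ.app (Iso.refl _)).trans (Iso.exch _ _ _)) f) g))
        (Q.rename (Iso.exch _ _ _)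
          (Q.cutAt t (Q.rename ((ρ.app (Iso.refl _)).trans (Iso.exch _ _ _)) f') g)) := by
  induction h with
  | @nil R₀ U hU f =>
    intro R T t z ρ g
    refine (Transported.nil hU _).congr_iso rfl ?_
    have e : Q.rename ((ρ.app (Iso.refl _)).trans (Iso.exch _ _ _))
        (Q.rename (Iso.ofIsEmpty F G R₀ U hU) f) =
        Q.rename ((Iso.ofIsEmpty F G R U hU).app (Iso.refl _))
          (Q.rename ((ρ.app (Iso.refl _)).trans (Iso.exch _ _ _)) f) := by
      rw [Q.rename_rename, Q.rename_rename]
      refine Q.rename_congr _ ?_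
      rintro (i | i)
      · change (Iso.exch R (one t z) (U.map G)).equiv (Sum.inl (ρ.equiv i)) = Sum.map _ _
          ((Iso.exch R (one t z) (U.map F)).equiv (Sum.inl (ρ.equiv i)))
        rcases ρ.equiv i with j | j <;> rfl
      · rfl
    rw [e, ← Q.rename_cutAt_left, Q.rename_rename, Q.rename_rename]
    exact Q.rename_congr _ (by rintro ((i | i) | i) <;> rfl)
  | @cons R₀ U V s x σ f g₀ h ih =>
    intro R T t z ρ g
    have key := ih ((ρ.app (Iso.refl (one s (G x)))).trans (Iso.exch R (one t z) (one s (G x)))) g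
    replace key := key.rename (Iso.exch R (one s (G x)) T) (Iso.refl U)
    obtain ⟨f', hf'⟩ : ∃ f', f' = Q.rename (((ρ.app (Iso.refl (U.map F))).trans
      (Iso.exch R (one t z) (U.map F))).app (Iso.refl (one s (F x)))) f := ⟨_, rfl⟩
    have e₁ : Q.rename ((ρ.app (Iso.refl _)).trans (Iso.exch _ _ _))
        (Q.rename (Iso.fuse F R₀ σ) f) =
        Q.rename ((Iso.fuse F R σ).app (Iso.refl _)) (Q.rename (Iso.exch _ _ _) f') := by
      rw [hf', Q.rename_rename, Q.rename_rename, Q.rename_rename]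
      refine Q.rename_congr _ ?_
      rintro ((i | i) | i)
      · change (Iso.exch R (one t z) (V.map F)).equiv (Sum.inl (ρ.equiv i)) =
          Sum.map (Iso.fuse F R σ).equiv _ ((Iso.exch _ (one t z) _).equiv (Sum.inl
            ((Iso.exch R (one t z) (U.map F)).equiv (Sum.inl (ρ.equiv i)))))
        rcases ρ.equiv i with j | j <;> rfl
      · rfl
      · rfl
    have e₂ : Q.rename ((ρ.app (Iso.refl _)).trans (Iso.exch _ _ _))
        (Q.rename ((Iso.exch _ _ _).trans (Iso.fuse G R₀ σ)) g₀) =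
        Q.rename (((Iso.exch _ _ _).trans (Iso.fuse G R σ)).app (Iso.refl _))
          (Q.rename ((((ρ.app (Iso.refl (one s (G x)))).trans
            (Iso.exch R (one t z) (one s (G x)))).app (Iso.refl _)).trans (Iso.exch _ _ _))
            g₀) := by
      rw [Q.rename_rename, Q.rename_rename]
      refine Q.rename_congr _ ?_
      rintro ((i | i) | i)
      · change (Iso.exch R (one t z) (V.map G)).equiv (Sum.inl (ρ.equiv i)) =
          Sum.map ((Iso.exch _ _ _).trans (Iso.fuse G R σ)).equiv _
            ((Iso.exch _ (one t z) _).equiv (Sum.inl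
              ((Iso.exch R (one t z) (one s (G x))).equiv (Sum.inl (ρ.equiv i)))))
        rcases ρ.equiv i with j | j <;> rfl
      · rfl
      · rfl
    have e₃ : Q.rename ((((ρ.app (Iso.refl (one s (G x)))).trans
            (Iso.exch R (one t z) (one s (G x)))).app (Iso.refl _)).trans (Iso.exch _ _ _))
          (Q.rename (Iso.exch _ _ _) ((θ x).act s f)) =
        Q.rename ((Iso.exch _ _ _).app (Iso.refl _))
          (Q.rename (Iso.exch _ _ _) ((θ x).act s f')) := by
      rw [hf', ObjIso.act_rename, Q.rename_rename, Q.rename_rename, Q.rename_rename]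
      refine Q.rename_congr _ ?_
      rintro ((i | i) | i)
      · change (Iso.exch _ (one t z) (U.map F)).equiv (Sum.inl
            ((Iso.exch R (one t z) (one s (G x))).equiv (Sum.inl (ρ.equiv i)))) =
          Sum.map (Iso.exch _ _ _).equiv _ ((Iso.exch _ (one t z) (one s (G x))).equiv (Sum.inl
            ((Iso.exch R (one t z) (U.map F)).equiv (Sum.inl (ρ.equiv i)))))
        rcases ρ.equiv i with j | j <;> rfl
      · rfl
      · rfl
    rw [e₁, e₂, ← Q.rename_cutAt_left, ← Q.rename_cutAt_left]
    have c := Transported.cons σ (Q.rename ((Iso.exch _ _ _).app (Iso.refl _))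
      (Q.rename (Iso.exch _ _ _) (Q.cutAt t (Q.rename (Iso.exch _ _ _) f') g))) _
      (key.congr_iso (by
        rw [e₃, ← Q.rename_cutAt_left, ObjIso.act_cut, ObjIso.act_rename, Q.rename_rename,
          Q.rename_rename, Q.rename_rename, Q.rename_rename]
        exact Q.rename_congr _ (by rintro (((i | i) | i) | i) <;> rfl)) rfl)
    refine c.congr_iso ?_ ?_
    · rw [Q.rename_rename, Q.rename_rename, Q.rename_rename]
      exact Q.rename_congr _ (by rintro (((i | i) | i) | i) <;> rfl)
    · rw [Q.rename_rename, Q.rename_rename, Q.rename_rename]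
      exact Q.rename_congr _ (by rintro (((i | i) | i) | i) <;> rfl)

/-- Transport along two sequents, one after the other. -/
theorem app {R₀ : Sequent Q.Obj} {U : Sequent D} {f : Q.Hom (R₀ ⊹ U.map F)}
    {f' : Q.Hom (R₀ ⊹ U.map G)} (h : Transported θ f f') :
    ∀ {R : Sequent Q.Obj} {V : Sequent D} (ρ : Iso R₀ (R ⊹ V.map F))
      {g : Q.Hom (R ⊹ U.map G ⊹ V.map G)},
      Transported θ (Q.rename ((ρ.app (Iso.refl _)).trans (Iso.exch _ _ _)) f') g →
      Transported θ
        (Q.rename (((ρ.app (Iso.refl _)).trans (Iso.exch _ _ _)).trans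
          (Iso.mapAppRight F R U V)) f)
        (Q.rename (Iso.mapAppRight G R U V) g) := by
  induction h with
  | @nil R₀ U hU f =>
    intro R V ρ g h
    refine (h.rename (Iso.appEmpty R (U.map G) hU) (Iso.emptyApp U V hU)).congr_iso ?_ ?_
    · rw [Q.rename_rename, Q.rename_rename]
      refine Q.rename_congr _ ?_
      rintro (i | i)
      · change Sum.map _ _ ((Iso.exch R (V.map F) (U.map G)).equiv (Sum.inl (ρ.equiv i))) =
          (Iso.mapAppRight F R U V).equiv
            ((Iso.exch R (V.map F) (U.map F)).equiv (Sum.inl (ρ.equiv i)))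
        rcases ρ.equiv i with j | j <;> rfl
      · exact hU.elim i
    · refine Q.rename_congr _ ?_
      rintro ((i | i) | i)
      exacts [rfl, hU.elim i, rfl]
  | @cons R₀ U W s x σ f g₀ h ih =>
    intro R V ρ g hg
    let κ : Iso (R ⊹ one s (G x) ⊹ U.map G) (R ⊹ W.map G) :=
      (Iso.exch _ _ _).trans (Iso.fuse G R σ)
    have hg' := hg.rename κ.symm (Iso.refl V)
    have key := ih (R := R ⊹ one s (G x)) (V := V)
      ((ρ.app (Iso.refl (one s (G x)))).trans (Iso.exch R (V.map F) (one s (G x))))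
      (hg'.congr_iso (by
        rw [Q.rename_rename, Q.rename_rename]
        refine Q.rename_congr _ ?_
        rintro ((i | i) | i)
        · change Sum.map κ.equiv.symm _
            ((Iso.exch R (V.map F) (W.map G)).equiv (Sum.inl (ρ.equiv i))) =
              (Iso.exch _ (V.map F) (U.map G)).equiv (Sum.inl
                ((Iso.exch R (V.map F) (one s (G x))).equiv (Sum.inl (ρ.equiv i))))
          rcases ρ.equiv i with j | j
          · exact congrArg Sum.inl (κ.equiv.symm_apply_apply (Sum.inl (Sum.inl j)))
          · rfl
        · exact congrArg Sum.inl (κ.equiv.symm_apply_apply (Sum.inl (Sum.inr i)))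
        · exact congrArg Sum.inl (κ.equiv.symm_apply_apply (Sum.inr i))) rfl)
    have c := Transported.cons (θ := θ) (R := R) (U := U ⊹ V) (V := W ⊹ V)
      ((Iso.exch U V (one s x)).trans (σ.app (Iso.refl V)))
      (Q.rename ((((ρ.app (Iso.refl _)).trans (Iso.exch _ _ _)).trans
        (Iso.mapAppRight F R U V)).app (Iso.refl _)) f) _ (key.congr_iso (by
          rw [ObjIso.act_rename, Q.rename_rename, Q.rename_rename]
          refine Q.rename_congr _ ?_
          rintro ((i | i) | i)
          · change (Iso.mapAppRight F (R ⊹ one s (G x)) U V).equiv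
              ((Iso.exch _ (V.map F) (U.map F)).equiv (Sum.inl
                ((Iso.exch R (V.map F) (one s (G x))).equiv (Sum.inl (ρ.equiv i))))) =
              (Iso.exch R ((U ⊹ V).map F) (one s (G x))).equiv (Sum.inl
                ((Iso.mapAppRight F R U V).equiv
                  ((Iso.exch R (V.map F) (U.map F)).equiv (Sum.inl (ρ.equiv i)))))
            rcases ρ.equiv i with j | j <;> rfl
          · rfl
          · rfl) rfl)
    refine c.congr_iso ?_ ?_
    · rw [Q.rename_rename, Q.rename_rename]
      refine Q.rename_congr _ ?_
      rintro ((i | i) | i)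
      · change (Iso.fuse F R ((Iso.exch U V (one s x)).trans (σ.app (Iso.refl V)))).equiv
          (Sum.inl ((Iso.mapAppRight F R U V).equiv
            ((Iso.exch R (V.map F) (U.map F)).equiv (Sum.inl (ρ.equiv i))))) =
          (Iso.mapAppRight F R W V).equiv
            ((Iso.exch R (V.map F) (W.map F)).equiv (Sum.inl (ρ.equiv i)))
        rcases ρ.equiv i with j | j <;> rfl
      · rfl
      · rfl
    · obtain ⟨g, rfl⟩ : ∃ g', g = Q.rename (κ.app (Iso.refl _)) g' :=
        ⟨Q.rename (κ.app (Iso.refl _)).symm g, (Q.rename_rename_symm _ g).symm⟩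
      have e : Q.rename (κ.symm.app ((Iso.refl V).map G))
          (Q.rename (κ.app (Iso.refl _)) g) = g := by
        rw [Q.rename_rename]
        refine Q.rename_id _ ?_
        rintro (i | i)
        · exact congrArg Sum.inl (κ.equiv.symm_apply_apply i)
        · rfl
      rw [e, Q.rename_rename, Q.rename_rename]
      exact Q.rename_congr _ (by rintro (((i | i) | i) | i) <;> rfl)

/-- Transport along a single channel. -/
theorem single {R : Sequent Q.Obj} {s : Side} {x : D} (f : Q.Hom (R ⊹ one s (F x))) :
    Transported θ (U := one s x) f ((θ x).act s f) := by
  have hn : IsEmpty (Sequent.nil (C := D)).Ch := inferInstanceAs (IsEmpty Empty)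
  have h := Transported.cons (θ := θ) (Iso.nilApp (one s x))
    (Q.rename ((Iso.appEmpty R ((Sequent.nil (C := D)).map F) hn).symm.app (Iso.refl _)) f) _
    (Transported.nil hn _)
  refine h.congr_iso ?_ ?_
  · rw [Q.rename_rename]
    exact Q.rename_id _ (by rintro (i | i) <;> rfl)
  · rw [ObjIso.act_rename, Q.rename_rename, Q.rename_rename, Q.rename_rename]
    exact Q.rename_id _ (by rintro (i | i) <;> rfl)

end Transported

/-! ### Transport and morphisms -/

theorem Morphism.map_cutAt {P : Polycategory.{u, v}} {Q : Polycategory.{u', v'}}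
    (M : Morphism P Q) (s : Side) {S T : Sequent P.Obj} {x : P.Obj} (f : P.Hom (S ⊹ one s x))
    (g : P.Hom (T ⊹ one s.op x)) :
    Q.rename (Iso.mapApp M.obj S T) (M.map (P.cutAt s f g)) =
      Q.cutAt s (Q.rename (Iso.mapOne M.obj S s x) (M.map f))
        (Q.rename (Iso.mapOne M.obj T s.op x) (M.map g)) := by
  cases s
  · have h := congrArg (Q.rename (Iso.comm _ _)) (M.map_cut g f)
    refine Eq.trans ?_ h
    refine (congrArg _ (M.map_rename _ _)).trans ?_
    rw [Q.rename_rename, Q.rename_rename]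
    exact Q.rename_congr _ (by rintro (i | i) <;> rfl)
  · exact M.map_cut f g

/-- The image of an isomorphism. -/
def Morphism.mapIso {P : Polycategory.{u, v}} {Q : Polycategory.{u', v'}} (M : Morphism P Q)
    {x y : P.Obj} (θ : ObjIso P x y) : ObjIso Q (M.obj x) (M.obj y) where
  hom := Q.rename (Iso.mapTwo M.obj .dom .cod x y) (M.map θ.hom)
  inv := Q.rename (Iso.mapTwo M.obj .dom .cod y x) (M.map θ.inv)
  hom_inv := by
    have h := M.map_cut θ.hom (P.rename (Iso.comm _ _) θ.inv)
    rw [θ.hom_inv, M.map_rename] at h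
    refine Eq.trans ?_ (h.symm.trans (M.map_id x))
    refine congrArg (Q.cut (Q.rename (Iso.mapTwo M.obj .dom .cod x y) (M.map θ.hom))) ?_
    refine (Q.rename_rename _ _ _).trans (Eq.trans ?_ (Q.rename_rename _ _ _).symm)
    exact Q.rename_congr _ (by rintro (i | i) <;> rfl)
  inv_hom := by
    have h := M.map_cut θ.inv (P.rename (Iso.comm _ _) θ.hom)
    rw [θ.inv_hom, M.map_rename] at h
    refine Eq.trans ?_ (h.symm.trans (M.map_id y))
    refine congrArg (Q.cut (Q.rename (Iso.mapTwo M.obj .dom .cod y x) (M.map θ.inv))) ?_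
    refine (Q.rename_rename _ _ _).trans (Eq.trans ?_ (Q.rename_rename _ _ _).symm)
    exact Q.rename_congr _ (by rintro (i | i) <;> rfl)

theorem Morphism.map_act {P : Polycategory.{u, v}} {Q : Polycategory.{u', v'}}
    (M : Morphism P Q) {x y : P.Obj} (θ : ObjIso P x y) (s : Side) {R : Sequent P.Obj}
    (f : P.Hom (R ⊹ one s x)) :
    Q.rename (Iso.mapOne M.obj R s y) (M.map (θ.act s f)) =
      (M.mapIso θ).act s (Q.rename (Iso.mapOne M.obj R s x) (M.map f)) := by
  refine (M.map_cutAt s f (θ.along s)).trans ?_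
  refine congrArg (Q.cutAt s (Q.rename (Iso.mapOne M.obj R s x) (M.map f))) ?_
  cases s
  · rfl
  · refine (congrArg _ (M.map_rename _ _)).trans ?_
    refine (Q.rename_rename _ _ _).trans (Eq.trans ?_ (Q.rename_rename _ _ _).symm)
    exact Q.rename_congr _ (by rintro (i | i) <;> rfl)

namespace Transported

variable {Q : Polycategory.{u, v}} {D : Type u'} {F G : D → Q.Obj}
  {θ : ∀ x, ObjIso Q (F x) (G x)}

/-- Transport along a family of isomorphisms that is reindexed by `m`. -/
theorem of_comp {D' : Type u''} (m : D' → D) {R : Sequent Q.Obj} {U : Sequent D'}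
    {f : Q.Hom (R ⊹ U.map fun x => F (m x))} {f' : Q.Hom (R ⊹ U.map fun x => G (m x))}
    (h : Transported (fun x => θ (m x)) f f') : Transported θ (U := U.map m) f f' := by
  induction h with
  | nil hU f => exact Transported.nil (U := Sequent.map m _) hU f
  | @cons R U V s x σ f g h ih =>
    refine (Transported.cons (θ := θ) (U := U.map m) (V := V.map m)
      ((Iso.mapOne m U s x).symm.trans (σ.map m)) f g ih).congr_iso ?_ ?_
    · exact Q.rename_congr _ (by rintro ((i | i) | i) <;> rfl)
    · exact Q.rename_congr _ (by rintro ((i | i) | i) <;> rfl)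

/-- Morphisms preserve transport. -/
theorem map {Q' : Polycategory.{u'', v''}} (M : Morphism Q Q') {R : Sequent Q.Obj} {U : Sequent D}
    {f : Q.Hom (R ⊹ U.map F)} {f' : Q.Hom (R ⊹ U.map G)} (h : Transported θ f f') :
    Transported (F := fun x => M.obj (F x)) (G := fun x => M.obj (G x))
      (fun x => M.mapIso (θ x))
      (Q'.rename (Iso.mapApp M.obj R (U.map F)) (M.map f))
      (Q'.rename (Iso.mapApp M.obj R (U.map G)) (M.map f')) := by
  induction h with
  | @nil R U hU f =>
    refine (Transported.nil (θ := fun x => M.mapIso (θ x)) hU _).congr_iso rfl ?_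
    rw [M.map_rename]
    refine (Q'.rename_rename _ _ _).trans (Eq.trans ?_ (Q'.rename_rename _ _ _).symm)
    exact Q'.rename_congr _ (by rintro (i | i) <;> rfl)
  | @cons R U V s x σ f g h ih =>
    have e : Q'.rename (Iso.exch _ _ _) ((M.mapIso (θ x)).act s
        (Q'.rename ((Iso.mapOne M.obj (R ⊹ U.map F) s (F x)).trans
          ((Iso.mapApp M.obj R (U.map F)).app (Iso.refl _))) (M.map f))) =
        Q'.rename ((Iso.mapOne M.obj R s (G x)).app (Iso.refl _)) (Q'.rename
          (Iso.mapApp M.obj (R ⊹ one s (G x)) (U.map F))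
            (M.map (Q.rename (Iso.exch _ _ _) ((θ x).act s f)))) := by
      rw [Q'.rename_trans, ObjIso.act_rename, ← M.map_act, M.map_rename]
      simp only [Q'.rename_rename]
      exact Q'.rename_congr _ (by rintro ((i | i) | i) <;> rfl)
    have c := Transported.cons (θ := fun x => M.mapIso (θ x)) σ
      (Q'.rename ((Iso.mapOne M.obj (R ⊹ U.map F) s (F x)).trans
        ((Iso.mapApp M.obj R (U.map F)).app (Iso.refl _))) (M.map f)) _
      ((ih.rename (Iso.mapOne M.obj R s (G x)) (Iso.refl U)).congr_iso e.symm rfl)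
    refine c.congr_iso ?_ ?_
    · rw [M.map_rename]
      refine (Q'.rename_rename _ _ _).trans (Eq.trans ?_ (Q'.rename_rename _ _ _).symm)
      exact Q'.rename_congr _ (by rintro ((i | i) | i) <;> rfl)
    · rw [M.map_rename]
      refine (congrArg _ (Q'.rename_rename _ _ _)).trans ?_
      refine (Q'.rename_rename _ _ _).trans (Eq.trans ?_ (Q'.rename_rename _ _ _).symm)
      exact Q'.rename_congr _ (by rintro ((i | i) | i) <;> rfl)

/-- `Polycategory.transport`, which follows the order of a list, is an instance of transport. -/
theorem transport (θ : ∀ x, ObjIso Q (F x) (G x)) : ∀ (l : List (Side × D)) (R : Sequent Q.Obj)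
    (f : Q.Hom (R ⊹ ofList (l.map (Prod.map _root_.id F)))),
    Transported θ (U := ofList l) (Q.rename ((Iso.refl R).app (Iso.mapOfList F l).symm) f)
      (Q.rename ((Iso.refl R).app (Iso.mapOfList G l).symm) (Q.transport θ l R f))
  | [], R, f => by
    refine (Transported.nil (inferInstanceAs (IsEmpty Empty)) _).congr_iso rfl ?_
    refine (Q.rename_rename _ _ _).trans ?_
    exact Q.rename_congr _ (by rintro (i | i) <;> rfl)
  | (s, x) :: l, R, f => by
    have ih := transport θ l (R ⊹ one s (G x)) (Q.rename (Iso.exch R _ (one s (G x)))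
      ((θ x).act s (Q.rename (Iso.exch R (one s (F x)) _)
        (Q.rename (Iso.assoc R (one s (F x)) _).symm f))))
    have c := Transported.cons (θ := θ) (R := R) (Iso.comm (ofList l) (one s x))
      (Q.rename (((Iso.refl R).app (Iso.mapOfList F l).symm).app (Iso.refl _))
        (Q.rename (Iso.exch R (one s (F x)) _)
          (Q.rename (Iso.assoc R (one s (F x)) _).symm f))) _ (ih.congr_iso (by
        rw [ObjIso.act_rename, Q.rename_rename, Q.rename_rename]
        exact Q.rename_congr _ (by rintro ((i | i) | i) <;> rfl)) rfl)
    refine c.congr_iso ?_ ?_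
    · refine (congrArg _ (congrArg _ (Q.rename_rename _ _ _))).trans ?_
      refine (congrArg _ (Q.rename_rename _ _ _)).trans ((Q.rename_rename _ _ _).trans ?_)
      exact Q.rename_congr _ (by rintro (i | (i | i)) <;> rfl)
    · refine (Q.rename_rename _ _ _).trans (Eq.trans ?_ (Q.rename_rename _ _ _).symm)
      exact Q.rename_congr _ (by rintro ((i | i) | i) <;> rfl)

end Transported

/-- Composition with the isomorphisms `θ x` on all channels turns `f` into `g`: the relation
`Transported` where there are no further channels. -/
def Carries {Q : Polycategory.{u, v}} {D : Type u'} {F G : D → Q.Obj}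
    (θ : ∀ x, ObjIso Q (F x) (G x)) {U : Sequent D} (f : Q.Hom (U.map F)) (g : Q.Hom (U.map G)) :
    Prop :=
  Transported θ (R := nil) (Q.rename (Iso.nilApp _).symm f) (Q.rename (Iso.nilApp _).symm g)

namespace Carries

variable {Q : Polycategory.{u, v}} {D : Type u'} {F G : D → Q.Obj}
  {θ : ∀ x, ObjIso Q (F x) (G x)}

theorem rename {U U' : Sequent D} {f : Q.Hom (U.map F)} {g : Q.Hom (U.map G)}
    (h : Carries θ f g) (σ : Iso U U') :
    Carries θ (Q.rename (σ.map F) f) (Q.rename (σ.map G) g) := by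
  refine (Transported.rename h (Iso.refl _) σ).congr_iso ?_ ?_
  · rw [Q.rename_rename, Q.rename_rename]
    exact Q.rename_congr _ fun _ => rfl
  · rw [Q.rename_rename, Q.rename_rename]
    exact Q.rename_congr _ fun _ => rfl

theorem exists_bijective (θ : ∀ x, ObjIso Q (F x) (G x)) (U : Sequent D) :
    ∃ T : Q.Hom (U.map F) → Q.Hom (U.map G), Function.Bijective T ∧ ∀ f, Carries θ f (T f) := by
  obtain ⟨T, hT, h⟩ := Transported.exists_bijective θ nil U
  refine ⟨fun f => Q.rename (Iso.nilApp _) (T (Q.rename (Iso.nilApp _).symm f)),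
    (Q.rename_bijective _).comp (hT.comp (Q.rename_bijective _)), fun f => ?_⟩
  unfold Carries
  rw [Q.rename_symm_rename]
  exact h _

theorem unique {U : Sequent D} {f : Q.Hom (U.map F)} {g g' : Q.Hom (U.map G)}
    (h : Carries θ f g) (h' : Carries θ f g') : g = g' :=
  Q.rename_injective _ (Transported.unique h h')

/-- The composition on the channel `x` can be made last. -/
theorem factor {U : Sequent D} {s : Side} {x : D} {f : Q.Hom ((U ⊹ one s x).map F)}
    {g : Q.Hom ((U ⊹ one s x).map G)} (h : Carries θ f g) :
    ∃ k : Q.Hom (one s (F x) ⊹ U.map G),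
      Transported θ (Q.rename (Iso.comm _ _) (Q.rename (Iso.mapOne F U s x) f)) k ∧
      Q.rename (Iso.mapOne G U s x) g = (θ x).act s (Q.rename (Iso.comm _ _) k) := by
  obtain ⟨T, -, hT⟩ := Transported.exists_bijective θ (one s (F x)) U
  obtain ⟨k, hk⟩ : ∃ k, Transported θ
    (Q.rename (Iso.comm _ _) (Q.rename (Iso.mapOne F U s x) f)) k := ⟨_, hT _⟩
  refine ⟨k, hk, ?_⟩
  have t := Transported.app hk (R := nil) (V := one s x) (Iso.nilApp (one s (F x))).symm
    (Transported.single _)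
  have e := Transported.unique h (t.congr_iso (by
    rw [Q.rename_rename, Q.rename_rename]
    exact Q.rename_congr _ (by rintro (i | i) <;> rfl)) rfl)
  have e' : (θ x).act s (Q.rename (((Iso.nilApp (one s (F x))).symm.app (Iso.refl _)).trans
      (Iso.exch nil (one s (F x)) (U.map G))) k) =
      Q.rename ((Iso.nilApp _).symm.app (Iso.refl _))
        ((θ x).act s (Q.rename (Iso.comm _ _) k)) := by
    rw [← ObjIso.act_rename, Q.rename_rename]
    refine congrArg _ ?_
    exact Q.rename_congr _ (by rintro (i | i) <;> rfl)
  have e'' := congrArg (Q.rename ((Iso.nilApp _).trans (Iso.mapOne G U s x)))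
    (e.trans (congrArg (Q.rename (Iso.mapAppRight G nil U (one s x))) e'))
  refine Eq.trans ?_ (e''.trans ?_)
  · rw [Q.rename_rename]
    exact Q.rename_congr _ fun _ => rfl
  · refine (Q.rename_rename _ _ _).trans ((Q.rename_rename _ _ _).trans ?_)
    exact Q.rename_id _ (by rintro (i | i) <;> rfl)

/-- Composition with isomorphisms on all channels commutes with cuts: on the channel that is cut,
an isomorphism meets its inverse. -/
theorem cut {S T : Sequent D} {x : D} {f : Q.Hom ((S ⊹ one .cod x).map F)}
    {f' : Q.Hom ((S ⊹ one .cod x).map G)} {g : Q.Hom ((T ⊹ one .dom x).map F)}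
    {g' : Q.Hom ((T ⊹ one .dom x).map G)} (hf : Carries θ f f') (hg : Carries θ g g') :
    Carries θ (U := S ⊹ T)
      (Q.rename (Iso.mapApp F S T).symm
        (Q.cut (Q.rename (Iso.mapOne F S .cod x) f) (Q.rename (Iso.mapOne F T .dom x) g)))
      (Q.rename (Iso.mapApp G S T).symm
        (Q.cut (Q.rename (Iso.mapOne G S .cod x) f') (Q.rename (Iso.mapOne G T .dom x) g'))) := by
  obtain ⟨k, hk, ek⟩ := hf.factor
  obtain ⟨l, hl, el⟩ := hg.factor
  rw [ek, el, ObjIso.cut_act_act]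
  obtain ⟨f, rfl⟩ : ∃ f₀, f = Q.rename (Iso.mapOne F S .cod x).symm f₀ :=
    ⟨_, (Q.rename_symm_rename _ f).symm⟩
  obtain ⟨g, rfl⟩ : ∃ g₀, g = Q.rename (Iso.mapOne F T .dom x).symm g₀ :=
    ⟨_, (Q.rename_symm_rename _ g).symm⟩
  rw [Q.rename_rename_symm] at hk hl ⊢
  rw [Q.rename_rename_symm]
  have h₁ := hk.cutAt (R := nil) (t := .cod) (Iso.nilApp _).symm g
  have h₂ := hl.cutAt (R := nil) (t := .dom) (Iso.nilApp _).symm (Q.rename (Iso.comm _ _) k)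
  have aux : ∀ {s : Side} {x : Q.Obj} {R : Sequent Q.Obj} (k : Q.Hom (one s x ⊹ R)),
      Q.rename (((Iso.nilApp (one s x)).symm.app (Iso.refl _)).trans (Iso.exch nil (one s x) R)) k =
      Q.rename ((Iso.nilApp _).symm.app (Iso.refl _)) (Q.rename (Iso.comm _ _) k) := by
    intro s x R k
    rw [Q.rename_rename]
    exact Q.rename_congr _ (by rintro (i | i) <;> rfl)
  have cut_nil : ∀ (s : Side) {x : Q.Obj} {R T : Sequent Q.Obj} (f : Q.Hom (R ⊹ one s x))
      (g : Q.Hom (T ⊹ one s.op x)),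
      Q.rename (Iso.exch nil R T)
          (Q.cutAt s (Q.rename ((Iso.nilApp R).symm.app (Iso.refl _)) f) g) =
        Q.rename (((Iso.nilApp R).symm.app (Iso.refl T)).trans (Iso.exch nil R T))
          (Q.cutAt s f g) := by
    intro s x R T f g
    rw [← Q.rename_cutAt_left, Q.rename_rename]
  rw [aux, aux, Q.rename_comm_comm] at h₁ h₂
  replace h₁ := h₁.congr_iso (cut_nil .cod f g) (cut_nil .cod _ g)
  replace h₂ := h₂.congr_iso (cut_nil .dom g (Q.rename (Iso.comm _ _) k))
    (cut_nil .dom _ (Q.rename (Iso.comm _ _) k))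
  have h₃ := Transported.app h₁ (R := nil) (V := T) (Iso.refl _) (h₂.congr_iso (by
    change Q.rename _ (Q.rename (Iso.comm _ _) (Q.cut (Q.rename _ k) g)) =
      Q.rename _ (Q.rename _ (Q.cut (Q.rename _ k) g))
    simp only [Q.rename_rename]
    exact Q.rename_congr _ (by rintro (i | i) <;> rfl)) rfl)
  refine h₃.congr_iso ?_ ?_
  · change Q.rename _ (Q.rename _ (Q.cut f g)) = _
    simp only [Q.rename_rename]
    exact Q.rename_congr _ (by rintro (i | i) <;> rfl)
  · change Q.rename _ (Q.rename _ (Q.rename (Iso.comm _ _)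
      (Q.cut (Q.rename _ k) (Q.rename _ l)))) = _
    simp only [Q.rename_rename]
    exact Q.rename_congr _ (by rintro (i | i) <;> rfl)

end Carries

/-! ### Equivalences -/

namespace ObjIso

variable {Q : Polycategory.{u, v}} {x y z : Q.Obj}

/-- The identity isomorphism. -/
def refl (x : Q.Obj) : ObjIso Q x x := ⟨Q.id x, Q.id x, Q.cut_id _, Q.cut_id _⟩

/-- Composition of isomorphisms. -/
def trans (θ : ObjIso Q x y) (θ' : ObjIso Q y z) : ObjIso Q x z where
  hom := θ'.act .cod θ.hom
  inv := θ.symm.act .cod θ'.inv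
  hom_inv := (θ'.cut_act_act θ.hom (Q.rename (Iso.comm _ _) θ.inv)).trans θ.hom_inv
  inv_hom := (θ.symm.cut_act_act θ'.inv (Q.rename (Iso.comm _ _) θ'.hom)).trans θ'.inv_hom

/-- `act_cut` where `f` has no other channels. -/
theorem act_cut_two (θ : ObjIso Q x y) (s t : Side) {T : Sequent Q.Obj}
    (f : Q.Hom (one t z ⊹ one s x)) (g : Q.Hom (T ⊹ one t.op z)) :
    Q.cutAt t (Q.rename (Iso.comm _ _) (θ.act s f)) g =
      Q.rename (Iso.comm _ _) (θ.act s (Q.rename (Iso.comm _ _)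
        (Q.cutAt t (Q.rename (Iso.comm _ _) f) g))) := by
  cases t
  · refine (congrArg (Q.rename (Iso.comm _ _))
      (Q.cutAt_cutAt_two .cod s g f (θ.along s)).symm).trans ?_
    exact congrArg (fun h => Q.rename (Iso.comm _ _) (θ.act s h)) (Q.rename_comm_comm _).symm
  · refine (Q.cutAt_cod _ _).trans (congrArg (Q.rename (Iso.comm _ _)) ?_)
    exact (Q.cutAt_cutAt_two .dom s g f (θ.along s)).symm

end ObjIso

namespace Additive

variable {Q : Polycategory.{u, v}} {n : ℕ} {X Y : Fin n → Q.Obj} {o p : Q.Obj}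

/-- The comparison between the poly-products (`s = .dom`) or poly-sums (`s = .cod`) of two
families of isomorphic objects. -/
def comparison {s : Side} (A : Additive Q s.op X o) (A' : Additive Q s.op Y p)
    (θ : ∀ i, ObjIso Q (X i) (Y i)) : Q.Hom (one s o ⊹ one s.op p) :=
  A'.tuple fun i => (θ i).act s.op (A.leg i)

/-- The comparisons in the two directions compose to the identity. -/
theorem comparison_cut {s : Side} (A : Additive Q s.op X o) (A' : Additive Q s.op Y p)
    (θ : ∀ i, ObjIso Q (X i) (Y i)) :
    Q.rename (Iso.comm _ _) (Q.cutAt s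
      (Q.rename (Iso.comm _ _) (A'.comparison A fun i => (θ i).symm)) (A.comparison A' θ)) =
      Q.idAt s o := by
  rw [comparison, A.tuple_cut_two, Q.rename_comm_comm, ← A.tuple_leg]
  refine congrArg A.tuple (funext fun i => ?_)
  rw [ObjIso.act_cut_two, Q.rename_comm_comm, ← A'.tuple_symm, comparison,
    Equiv.symm_apply_apply, ObjIso.act_symm_act]

/-- Poly-sums and poly-products of isomorphic families are isomorphic. -/
def objIso : ∀ {s : Side} (_ : Additive Q s.op X o) (_ : Additive Q s.op Y p)
    (_ : ∀ i, ObjIso Q (X i) (Y i)), ObjIso Q o p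
  | .dom, A, A', θ =>
    { hom := A.comparison (s := .dom) A' θ
      inv := A'.comparison (s := .dom) A fun i => (θ i).symm
      hom_inv := (Q.rename_comm_comm _).symm.trans (A.comparison_cut (s := .dom) A' θ)
      inv_hom := (Q.rename_comm_comm _).symm.trans
        (A'.comparison_cut (s := .dom) A fun i => (θ i).symm) }
  | .cod, A, A', θ =>
    { hom := Q.rename (Iso.comm _ _) (A'.comparison (s := .cod) A fun i => (θ i).symm)
      inv := Q.rename (Iso.comm _ _) (A.comparison (s := .cod) A' θ)
      hom_inv := by
        have h := congrArg (Q.rename (Iso.comm _ _)) (A.comparison_cut (s := .cod) A' θ)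
        refine Eq.trans ?_ (h.trans (Q.rename_comm_comm _))
        refine (congrArg (Q.cut _) (Q.rename_comm_comm _)).trans ?_
        exact (Q.rename_comm_comm _).symm
      inv_hom := by
        have h := congrArg (Q.rename (Iso.comm _ _))
          (A'.comparison_cut (s := .cod) A fun i => (θ i).symm)
        refine Eq.trans ?_ (h.trans (Q.rename_comm_comm _))
        refine (congrArg (Q.cut _) (Q.rename_comm_comm _)).trans ?_
        exact (Q.rename_comm_comm _).symm }

end Additive

/-- An interpretation of the calculus reaches every generated object up to isomorphism. -/
theorem Calculus.Interpretation.exists_objIso {A : Polycategory.{u, v}} {P : Polycategory.{u', v'}}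
    {B : Polycategory.{u'', v''}} {K : Calculus A P} {S : SumsProducts B} {F : Morphism A B}
    {M : Morphism P B} (I : K.Interpretation S F M) {b : B.Obj} (h : Generated S F b) :
    ∃ X : P.Obj, Nonempty (ObjIso B (M.obj X) b) := by
  induction h with
  | atom a => exact ⟨K.atom a, I.obj_atom a ▸ ⟨ObjIso.refl _⟩⟩
  | inp s X _ ih =>
    choose Y θ using ih
    refine ⟨K.inp s Y, ?_⟩
    rw [I.obj_inp]
    cases s
    · exact ⟨Additive.objIso (s := .cod) (S.additive .dom _) (S.additive .dom X)
        fun i => (θ i).some⟩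
    · exact ⟨Additive.objIso (s := .dom) (S.additive .cod _) (S.additive .cod X)
        fun i => (θ i).some⟩
  | iso φ _ ih =>
    obtain ⟨X, ⟨θ⟩⟩ := ih
    exact ⟨X, ⟨θ.trans φ⟩⟩

namespace Carries

variable {Q : Polycategory.{u, v}} {D : Type u'} {F G : D → Q.Obj}
  {θ : ∀ x, ObjIso Q (F x) (G x)}

theorem map {Q' : Polycategory.{u'', v''}} (M : Morphism Q Q') {U : Sequent D}
    {f : Q.Hom (U.map F)} {g : Q.Hom (U.map G)} (h : Carries θ f g) :
    Carries (F := fun x => M.obj (F x)) (G := fun x => M.obj (G x)) (U := U)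
      (fun x => M.mapIso (θ x)) (M.map f) (M.map g) := by
  refine ((Transported.map M h).rename (R' := nil) ⟨Equiv.refl _, fun i => i.elim, fun i => i.elim⟩
    (Iso.refl U)).congr_iso ?_ ?_
  · rw [M.map_rename]
    refine (congrArg _ (Q'.rename_rename _ _ _)).trans ((Q'.rename_rename _ _ _).trans ?_)
    exact Q'.rename_congr _ fun _ => rfl
  · rw [M.map_rename]
    refine (congrArg _ (Q'.rename_rename _ _ _)).trans ((Q'.rename_rename _ _ _).trans ?_)
    exact Q'.rename_congr _ fun _ => rfl

/-- The naturality square of a natural isomorphism, in terms of `Carries`. -/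
theorem transport {l : List (Side × D)} {f : Q.Hom ((ofList l).map F)}
    {g : Q.Hom ((ofList l).map G)} (h : Carries θ f g) :
    Q.transport θ l nil (Q.rename (Iso.nilApp _).symm (Q.rename (Iso.mapOfList F l) f)) =
      Q.rename (Iso.nilApp _).symm (Q.rename (Iso.mapOfList G l) g) := by
  have t := Transported.transport θ l nil
    (Q.rename (Iso.nilApp _).symm (Q.rename (Iso.mapOfList F l) f))
  have e : Q.rename ((Iso.refl nil).app (Iso.mapOfList F l).symm)
      (Q.rename (Iso.nilApp _).symm (Q.rename (Iso.mapOfList F l) f)) =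
      Q.rename (Iso.nilApp _).symm f := by
    rw [Q.rename_rename, Q.rename_rename]
    exact Q.rename_congr _ fun i =>
      congrArg Sum.inr ((Iso.mapOfList F l).equiv.symm_apply_apply i)
  have e' := congrArg (Q.rename ((Iso.refl nil).app (Iso.mapOfList G l)))
    ((t.congr_iso e rfl).unique h)
  have e₁ := Q.rename_rename_symm ((Iso.refl nil).app (Iso.mapOfList G l)) (Q.transport θ l nil
    (Q.rename (Iso.nilApp _).symm (Q.rename (Iso.mapOfList F l) f)))
  refine e₁.symm.trans (e'.trans ?_)
  rw [Q.rename_rename, Q.rename_rename]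
  exact Q.rename_congr _ fun _ => rfl

end Carries

namespace Morphism

variable {P : Polycategory.{u, v}} {Q : Polycategory.{u', v'}} (M : Morphism P Q)

/-- A morphism that is bijective on each poly-hom-set reflects isomorphisms. -/
theorem exists_mapIso (hM : ∀ R, Function.Bijective fun f : P.Hom R => M.map f) {x y : P.Obj}
    (θ : ObjIso Q (M.obj x) (M.obj y)) : ∃ φ : ObjIso P x y, M.mapIso φ = θ := by
  have cut : ∀ {x y : P.Obj} (d : P.Hom (one .dom x ⊹ one .cod y))
      (e : P.Hom (one .dom y ⊹ one .cod x)),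
      Q.cut (Q.rename (Iso.mapTwo M.obj .dom .cod x y) (M.map d)) (Q.rename (Iso.comm _ _)
        (Q.rename (Iso.mapTwo M.obj .dom .cod y x) (M.map e))) = Q.id (M.obj x) →
      P.cut d (P.rename (Iso.comm _ _) e) = P.id x := by
    intro x y d e h
    have k := M.map_cut d (P.rename (Iso.comm _ _) e)
    refine (hM _).injective (Q.rename_injective (Iso.mapTwo M.obj .dom .cod x x) ?_)
    refine k.trans (Eq.trans ?_ (h.trans (M.map_id x).symm))
    refine congrArg (Q.cut (Q.rename (Iso.mapTwo M.obj .dom .cod x y) (M.map d))) ?_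
    rw [M.map_rename]
    refine (Q.rename_rename _ _ _).trans (Eq.trans ?_ (Q.rename_rename _ _ _).symm)
    exact Q.rename_congr _ (by rintro (i | i) <;> rfl)
  obtain ⟨hom, inv, hom_inv, inv_hom⟩ := θ
  have lift : ∀ {x y : P.Obj} (f : Q.Hom (one .dom (M.obj x) ⊹ one .cod (M.obj y))),
      ∃ d, Q.rename (Iso.mapTwo M.obj .dom .cod x y) (M.map d) = f := by
    intro x y f
    obtain ⟨d, hd⟩ := (hM _).surjective (Q.rename (Iso.mapTwo M.obj .dom .cod x y).symm f)
    exact ⟨d, (congrArg _ hd).trans (Q.rename_rename_symm _ f)⟩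
  obtain ⟨d, rfl⟩ := lift hom
  obtain ⟨e, rfl⟩ := lift inv
  exact ⟨⟨d, e, cut d e hom_inv, cut e d inv_hom⟩, rfl⟩

section QuasiInverse

variable {M}

/-- Every polymorphism `f` of `Q` is isomorphic, along `θ`, to one in the image of `M`. -/
theorem exists_carries (hM : ∀ R, Function.Bijective fun f : P.Hom R => M.map f)
    {g : Q.Obj → P.Obj} (θ : ∀ b, ObjIso Q (M.obj (g b)) b) {U : Sequent Q.Obj} (f : Q.Hom U) :
    ∃ d : P.Hom (U.map g),
      Carries (F := fun b => M.obj (g b)) (G := fun b => b) (U := U) θ (M.map d) f := by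
  obtain ⟨T, hT, h⟩ := Carries.exists_bijective (F := fun b => M.obj (g b)) (G := fun b => b) θ U
  obtain ⟨d', rfl⟩ := hT.surjective f
  obtain ⟨d, rfl⟩ := (hM (U.map g)).surjective d'
  exact ⟨d, h _⟩

theorem eq_of_carries (hM : ∀ R, Function.Bijective fun f : P.Hom R => M.map f)
    {g : Q.Obj → P.Obj} {θ : ∀ b, ObjIso Q (M.obj (g b)) b} {U : Sequent Q.Obj} {f : Q.Hom U}
    {d d' : P.Hom (U.map g)}
    (h : Carries (F := fun b => M.obj (g b)) (G := fun b => b) (U := U) θ (M.map d) f)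
    (h' : Carries (F := fun b => M.obj (g b)) (G := fun b => b) (U := U) θ (M.map d') f) :
    d = d' := by
  obtain ⟨T, hT, k⟩ := Carries.exists_bijective (F := fun b => M.obj (g b)) (G := fun b => b) θ U
  exact (hM (U.map g)).injective
    (hT.injective (((k (M.map d)).unique h).trans ((k (M.map d')).unique h').symm))

/-- The quasi-inverse of a morphism `M` that is bijective on each poly-hom-set: it takes `f` to
the polymorphism whose image under `M` becomes `f` by composition with `θ` on all channels. -/
noncomputable def quasiInverse (hM : ∀ R, Function.Bijective fun f : P.Hom R => M.map f)
    {g : Q.Obj → P.Obj} (θ : ∀ b, ObjIso Q (M.obj (g b)) b) : Morphism Q P :=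
  have spec : ∀ {U : Sequent Q.Obj} (f : Q.Hom U),
      Carries (F := fun b => M.obj (g b)) (G := fun b => b) (U := U) θ
        (M.map (exists_carries hM θ f).choose) f := fun f => (exists_carries hM θ f).choose_spec
  have map_rename : ∀ {S T : Sequent Q.Obj} (σ : Iso S T) (f : Q.Hom S),
      (exists_carries hM θ (Q.rename σ f)).choose =
        P.rename (σ.map g) (exists_carries hM θ f).choose := by
    intro S T σ f
    refine eq_of_carries hM (spec _) ?_
    rw [M.map_rename]
    exact (spec f).rename σ
  have map_cut : ∀ {S T : Sequent Q.Obj} {x : Q.Obj} (f : Q.Hom (S ⊹ one .cod x))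
      (h : Q.Hom (T ⊹ one .dom x)),
      P.rename (Iso.mapApp g S T) (exists_carries hM θ (Q.cut f h)).choose =
        P.cut (P.rename (Iso.mapOne g S .cod x) (exists_carries hM θ f).choose)
          (P.rename (Iso.mapOne g T .dom x) (exists_carries hM θ h).choose) := by
    intro S T x f h
    refine (congrArg _ (eq_of_carries hM (spec _)
      (d' := P.rename (Iso.mapApp g S T).symm _) ?_)).trans (P.rename_rename_symm _ _)
    refine Transported.congr_iso ((spec f).cut (spec h)) (congrArg _ ?_) (congrArg _ ?_)
    · have k := M.map_cut (P.rename (Iso.mapOne g S .cod x) (exists_carries hM θ f).choose)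
        (P.rename (Iso.mapOne g T .dom x) (exists_carries hM θ h).choose)
      rw [M.map_rename, M.map_rename] at k
      have k' := congrArg (Q.rename (Iso.mapApp (fun b => M.obj (g b)) S T).symm) k
      refine Eq.trans (congrArg _ (congrArg₂ Q.cut ?_ ?_)) (k'.symm.trans ?_)
      · refine Eq.trans ?_ (Q.rename_rename _ _ _).symm
        exact Q.rename_congr _ fun _ => rfl
      · refine Eq.trans ?_ (Q.rename_rename _ _ _).symm
        exact Q.rename_congr _ fun _ => rfl
      · rw [M.map_rename]
        refine (Q.rename_rename _ _ _).trans ?_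
        exact Q.rename_congr _ fun _ => rfl
    · exact (Q.rename_id _ fun _ => rfl).trans
        (congrArg₂ Q.cut (Q.rename_id _ fun _ => rfl) (Q.rename_id _ fun _ => rfl))
  { obj := g
    map := fun f => (exists_carries hM θ f).choose
    map_rename := map_rename
    map_cut := map_cut
    map_id := fun x => by
      -- cutting the image of an identity with any image leaves the latter unchanged, and
      -- identities are among the images
      obtain ⟨f, hf⟩ : ∃ f : Q.Hom (one .cod x ⊹ one .dom x),
          P.rename (Iso.mapOne g (one .cod x) .dom x) (exists_carries hM θ f).choose =
            P.rename (Iso.comm _ _) (P.id (g x)) := by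
        obtain ⟨T, -, k⟩ := Carries.exists_bijective (F := fun b => M.obj (g b))
          (G := fun b => b) θ (one .cod x ⊹ one .dom x)
        refine ⟨T (M.map (P.rename (Iso.mapOne g (one .cod x) .dom x).symm
          (P.rename (Iso.comm _ _) (P.id (g x))))), ?_⟩
        rw [eq_of_carries hM (spec _) (k _)]
        exact P.rename_rename_symm _ _
      have h := map_cut (Q.id x) f
      rw [Q.id_cut, map_rename, hf] at h
      refine (P.cut_id _).symm.trans (h.symm.trans ?_)
      have h' := congrArg (P.rename (Iso.comm _ _)) hf
      refine Eq.trans ?_ (h'.trans (P.rename_comm_comm _))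
      refine (P.rename_rename _ _ _).trans (Eq.trans ?_ (P.rename_rename _ _ _).symm)
      exact P.rename_congr _ (by rintro (i | i) <;> rfl) }

theorem carries_quasiInverse (hM : ∀ R, Function.Bijective fun f : P.Hom R => M.map f)
    {g : Q.Obj → P.Obj} (θ : ∀ b, ObjIso Q (M.obj (g b)) b) {U : Sequent Q.Obj} (f : Q.Hom U) :
    Carries (F := fun b => M.obj (g b)) (G := fun b => b) (U := U) θ
      (M.map ((quasiInverse hM θ).map f)) f :=
  (exists_carries hM θ f).choose_spec

/-- A morphism that is bijective on each poly-hom-set and reaches every object up to isomorphism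
is an equivalence. -/
theorem isEquivalence (hM : ∀ R, Function.Bijective fun f : P.Hom R => M.map f)
    (h : ∀ b, ∃ x, Nonempty (ObjIso Q (M.obj x) b)) : M.IsEquivalence := by
  choose g hg using h
  let θ : ∀ b, ObjIso Q (M.obj (g b)) b := fun b => (hg b).some
  choose φ hφ using fun x => M.exists_mapIso hM (θ (M.obj x))
  refine ⟨quasiInverse hM θ, ⟨⟨φ, fun l f => ?_⟩⟩, ⟨⟨θ, fun l f => ?_⟩⟩⟩
  · have key : Carries (F := fun x => g (M.obj x)) (G := fun x => x) (U := ofList l) φ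
        ((quasiInverse hM θ).map (M.map f)) f := by
      obtain ⟨T, -, hT⟩ := Carries.exists_bijective (F := fun x => g (M.obj x))
        (G := fun x => x) φ (ofList l)
      have c := (hT ((quasiInverse hM θ).map (M.map f))).map M
      rw [funext hφ] at c
      have c' := Transported.of_comp (θ := θ) (G := fun b => b) M.obj c
      have e := (hM _).injective
        (Q.rename_injective _ (c'.unique (carries_quasiInverse hM θ (M.map f))))
      exact (hT ((quasiInverse hM θ).map (M.map f))).congr_iso rfl (congrArg _ e)
    exact key.transport
  · exact (carries_quasiInverse hM θ f).transport

end QuasiInverse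

end Morphism

end Poly

theorem mainTheorem2 {A : Poly.Polycategory.{u, v}} {B : Poly.Polycategory.{u', v'}}
    (S : Poly.SumsProducts B) (F : Poly.Morphism A B) (hF : F.FullInclusion)
    (hgen : ∀ x : B.Obj, Poly.Generated S F x) :
    (Poly.SemiSoft S F → (Poly.comparison S F).Full) ∧
      (Poly.Soft S F → (Poly.comparison S F).IsEquivalence) := by
  have I := Poly.comparison_interpretation S F
  have full : Poly.SemiSoft S F → (Poly.comparison S F).Full := fun hS =>
    I.full (fun R => (hF.2 R).surjective) hS
  refine ⟨full, fun hS => Poly.Morphism.isEquivalence (fun R => ⟨?_, full hS.1 R⟩)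
    fun b => I.exists_objIso (hgen b)⟩
  exact I.faithful (full hS.1) (fun R => (hF.2 R).injective) hS.2 R
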